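/- **Setting.** Clusters have a type $L\in\{1,\dots,K\}$. A cluster of type $k$ has $M_k$ units, outcomes $Y\in\mathbb R^{M_k}$, treatments $A\in\mathcal A(M_k)=\{0,1\}^{M_k}$, covariates $X$ of finite dimension, and potential outcomes $Y(a)\in\mathbb R^{M_k}$, $a\in\mathcal A(M_k)$. The observed data $(L_i,O_i)$, $O_i=(Y_i,A_i,X_i)$, $i=1,\dots,N$, of $N$ clusters are independent with common law $P$. Let $p_k^*=P(L=k)>0$, $e^*(a\mid x,k)=P(A=a\mid X=x,L=k)$, $g^*(a,x,k)=E(Y\mid A=a,X=x,L=k)$ and $\Sigma^*(a,x,k)=\mathrm{var}(Y\mid A=a,X=x,L=k)$. Assume (A1) $Y=Y(A)$; (A2) $Y(a)\perp A\mid X$ given $L=k$, for all $a,k$; (A3) $c<e^*(a\mid X,k)<1-c$ almost surely given $L=k$, for some constant $c>0$ and all $a,k$; (A4) $E\{g^*(a,X,k)\mid L=k\}$ and $E\{\Sigma^*(a,X,k)\mid L=k\}$ exist and are finite, and $\Sigma^*$ is positive definite. For given weight functions $w_k(a,x)\in\mathbb R^{M_k}$ such that the following expectations exist, and continuously differentiable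 $v_k:\mathbb R\to\mathbb R$, the estimand is $$\tau^*=\sum_{k=1}^K v_k(p_k^*)\theta_k^*,\qquad \theta_k^*=\sum_{a\in\mathcal A(M_k)}E\{w_k(a,X)^{\mathsf T}Y(a)\mid L=k\}.$$ **Estimator.** Let $e(\cdot;\beta_e)$ and $g(\cdot;\beta_g)$ be parametric models for $e^*$ and $g^*$, and $\beta=(\beta_e,\beta_g)$. Put $$\phi_k(O,e,g)=\mathbb 1(L=k)\Big[\frac{w_k(A,X)^{\mathsf T}\{Y-g(A,X,k)\}}{e(A\mid X,k)}+\sum_{a}w_k(a,X)^{\mathsf T}g(a,X,k)\Big],$$ $\Psi_{\theta,k}(\theta_k,\beta)=\mathbb 1(L=k)\{\phi_k(O,e(\cdot;\beta_e),g(\cdot;\beta_g))-\theta_k\}$, and $\Psi=(\Psi_{\theta,1},\dots,\Psi_{\theta,K},\Psi_\beta)$, where $\Psi_\beta(\beta)$ is an estimating function for $\beta$, of the same dimension as $\beta$. Let $(\hat\theta,\hat\beta)$ solve $0=\sum_{i=1}^N\Psi(\theta,\beta)$, where the $i$-th summand is evaluated at $(L_i,O_i)$ (it suffices that this holds with probability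 tending to one), let $\hat p_k=N_k/N$ be the sample fraction of clusters of type $k$, and put $\hat\tau=\sum_k v_k(\hat p_k)\hat\theta_k$. Assume that $\hat\beta$ converges in probability to some $\beta^\dagger=(\beta_e^\dagger,\beta_g^\dagger)$. **Regularity conditions.** (R1) $(\theta,\beta)$ ranges over a bounded open set $\Omega_0$ of a Euclidean space, and $\beta_e,\beta_g$ are variationally independent. (R2) $\Psi$ is twice continuously differentiable in $(\theta,\beta)\in\Omega_0$. (R3) The equation $E\{\Psi(\theta,\beta)\}=0$ has a unique root in $\Omega_0$; its $\beta$-component is $\beta^\dagger$; at this root $E\|\Psi\|_2^2<\infty$ and the expected Jacobian $E\{\partial\Psi/\partial(\theta,\beta)\}$ exists and is nonsingular. (R4) All second-order partial derivatives of $\Psi$ in $(\theta,\beta)$ are dominated, in a neighbourhood of that root, by a fixed integrable function. **Models.** $\mathcal M_e$ (respectively $\mathcal M_g$) is the set of laws for which there is a unique $\beta_e^*$ with $e^*=e(\cdot;\beta_e^*)$ (respectively a unique $\beta_g^*$ with $g^*=g(\cdot;\beta_g^*)$). It is understood that $\hat\beta$ estimates these parameters, i.e. $\beta_e^\dagger=\beta_e^*$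 under $\mathcal M_e$ and $\beta_g^\dagger=\beta_g^*$ under $\mathcal M_g$. **Theorem.** (0) $\tau^*=\tau(P)$, where $\tau(P)=\sum_k v_k(p_k^*)\sum_a E\{w_k(a,X)^{\mathsf T}g^*(a,X,k)\mid L=k\}$. (i) *(Double robustness.)* Under $\mathcal M_e\cup\mathcal M_g$, $$N^{1/2}(\hat\tau-\tau^*)=N^{-1/2}\sum_{i=1}^N\varphi_i^{\rm Par}+o_P(1),$$ where $\varphi_i^{\rm Par}$ is the value at $(L_i,O_i)$ of the mean-zero, square-integrable influence function $$\varphi^{\rm Par}=\sum_{k=1}^K\Big[v_k(p_k^*)\,\varphi^{\rm Par}_k+\{\mathbb 1(L=k)-p_k^*\}\,v_k'(p_k^*)\,\theta_k^*\Big],$$ $$\varphi_k^{\rm Par}=\frac1{p_k^*}\Big[\Psi_{\theta,k}(\theta_k^*,\beta^\dagger)-E\Big\{\frac{\partial\Psi_{\theta,k}(\theta_k^*,\beta^\dagger)}{\partial\beta^{\mathsf T}}\Big\}\Big[E\Big\{\frac{\partial\Psi_\beta(\beta^\dagger)}{\partial\beta^{\mathsf T}}\Big\}\Big]^{-1}\Psi_\beta(\beta^\dagger)\Big].$$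 (ii) *(Local efficiency.)* Under $\mathcal M_e\cap\mathcal M_g$, $\varphi^{\rm Par}$ equals almost surely $$\varphi(\tau^*)=\sum_{k=1}^K\Big[v_k(p_k^*)\frac{\mathbb 1(L=k)\{\phi_k(O,e^*,g^*)-\theta_k^*\}}{p_k^*}+\{\mathbb 1(L=k)-p_k^*\}\,v_k'(p_k^*)\,\theta_k^*\Big],$$ and also the same expression with $e(\cdot;\beta_e^\dagger),g(\cdot;\beta_g^\dagger)$ in place of $e^*,g^*$. This $\varphi(\tau^*)$ is the efficient influence function of $\tau(P)$ in the nonparametric model (all laws of $(L,O)$): it represents the pathwise derivative of $\tau(P)$ along every regular parametric submodel (differentiable in quadratic mean, with likelihood ratios locally bounded away from $0$ and $\infty$), and it lies in the tangent space. Its variance is the semiparametric efficiency bound, i.e. the supremum of the Cramér–Rao bounds over these submodels. Further, $\hat\tau$ is asymptotically linear with influence function $\varphi(\tau^*)$, and $N^{1/2}(\hat\tau-\tau^*)$ converges in distribution to $N(0,\mathrm{var}\{\varphi(\tau^*)\})$. That is, $\hat\tau$ is locally efficient. -/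

import Mathlib

open MeasureTheory ProbabilityTheory Filter Topology
open scoped ENNReal

namespace PartialInterference

noncomputable section

/-! ### Data -/

/-- Treatment vectors `𝒜(m)` of a cluster of `m` units. -/
abbrev Treat (m : ℕ) : Type := Fin m → Bool

/-- Observed data `O = (Y, A, X)` of a cluster with `m` units and `d`-dimensional
(stacked) covariates. -/
abbrev TypeObs (m d : ℕ) : Type := (Fin m → ℝ) × Treat m × (Fin d → ℝ)

/-- Full data `((Y(a))_a, A, X)` of such a cluster: all potential outcomes, treatment, covariates. -/
abbrev TypeFull (m d : ℕ) : Type := (Treat m → Fin m → ℝ) × Treat m × (Fin d → ℝ)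

variable {K : ℕ} {M d : Fin K → ℕ} {de dg : ℕ}

/-- Observed data `(L, O)` of a cluster of random type `L`; a cluster of type `k` has `M k` units
and `d k`-dimensional covariates. -/
abbrev Obs (M d : Fin K → ℕ) : Type := Σ k : Fin K, TypeObs (M k) (d k)

/-- Full data of a cluster of random type. -/
abbrev Full (M d : Fin K → ℕ) : Type := Σ k : Fin K, TypeFull (M k) (d k)

/-- Consistency (A1): the observed outcome vector is the potential outcome vector under the
treatment vector received. -/
def observe (u : Full M d) : Obs M d := ⟨u.1, (u.2.1 u.2.2.1, u.2.2.1, u.2.2.2)⟩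

theorem measurable_mk_type {T : Fin K → Type} [∀ k, MeasurableSpace (T k)] (k : Fin K) :
    Measurable (Sigma.mk k : T k → Σ k, T k) :=
  fun _ hs => MeasurableSpace.measurableSet_iInf.1 hs k

theorem measurable_of_measurable_comp_mk {T : Fin K → Type} [∀ k, MeasurableSpace (T k)]
    {S : Type} [MeasurableSpace S] {f : (Σ k, T k) → S}
    (h : ∀ k, Measurable (fun x : T k => f ⟨k, x⟩)) : Measurable f :=
  fun _ hs => MeasurableSpace.measurableSet_iInf.2 fun k => h k hs

theorem measurable_observe : Measurable (observe : Full M d → Obs M d) := by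
  refine measurable_of_measurable_comp_mk fun k => ?_
  have h1 : Measurable (fun u : TypeFull (M k) (d k) => u.1 u.2.1) := by
    have h2 : Measurable (fun p : (Treat (M k) → Fin (M k) → ℝ) × Treat (M k) => p.1 p.2) := by
      refine measurable_from_prod_countable_left ?_
      intro a
      exact measurable_pi_apply a
    exact h2.comp (measurable_fst.prodMk (measurable_fst.comp measurable_snd))
  have h3 : Measurable (fun u : TypeFull (M k) (d k) => (u.1 u.2.1, u.2.1, u.2.2)) :=
    h1.prodMk measurable_snd
  exact (measurable_mk_type k).comp h3

/-- Law of the observed data induced by a law of the full data. -/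
def observedLaw (Q : ProbabilityMeasure (Full M d)) : ProbabilityMeasure (Obs M d) :=
  Q.map measurable_observe.aemeasurable

section Laws

variable {T : Fin K → Type} [∀ k, MeasurableSpace (T k)]

/-- `p_k = P(L = k)`. -/
def typeProb (P : ProbabilityMeasure (Σ k, T k)) (k : Fin K) : ℝ :=
  (P : Measure (Σ k, T k)).real {z | z.1 = k}

/-- Conditional law of the cluster data given `L = k`. -/
def typeLaw (P : ProbabilityMeasure (Σ k, T k)) (k : Fin K) : Measure (T k) :=
  ((P : Measure (Σ k, T k))[|{z | z.1 = k}]).comap (Sigma.mk k)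

instance (P : ProbabilityMeasure (Σ k, T k)) (k : Fin K) : IsFiniteMeasure (typeLaw P k) := by
  unfold typeLaw
  infer_instance

end Laws

/-- Conditional law of `X` given `L = k`. -/
def covLaw (P : ProbabilityMeasure (Obs M d)) (k : Fin K) : Measure (Fin (d k) → ℝ) :=
  (typeLaw P k).map (fun o => o.2.2)

/-- Propensity score `e(a | x, k) = P(A = a | X = x, L = k)`. -/
def propensity (P : ProbabilityMeasure (Obs M d)) (k : Fin K)
    (a : Treat (M k)) (x : Fin (d k) → ℝ) : ℝ :=
  (condDistrib (fun o : TypeObs (M k) (d k) => o.2.1) (fun o => o.2.2) (typeLaw P k) x).real {a}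

/-- Conditional law of `Y` given `A = a, X = x, L = k`. -/
def outcomeLaw (P : ProbabilityMeasure (Obs M d)) (k : Fin K)
    (a : Treat (M k)) (x : Fin (d k) → ℝ) : Measure (Fin (M k) → ℝ) :=
  condDistrib (fun o : TypeObs (M k) (d k) => o.1) (fun o => o.2) (typeLaw P k) (a, x)

/-- Outcome regression `g(a, x, k) = E(Y | A = a, X = x, L = k)`. -/
def outcomeReg (P : ProbabilityMeasure (Obs M d)) (k : Fin K)
    (a : Treat (M k)) (x : Fin (d k) → ℝ) : Fin (M k) → ℝ :=
  fun j => ∫ y, y j ∂(outcomeLaw P k a x)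

/-- Conditional covariance `Σ(a, x, k) = var(Y | A = a, X = x, L = k)`. -/
def outcomeCov (P : ProbabilityMeasure (Obs M d)) (k : Fin K)
    (a : Treat (M k)) (x : Fin (d k) → ℝ) : Matrix (Fin (M k)) (Fin (M k)) ℝ :=
  Matrix.of fun i j =>
    ∫ y, (y i - outcomeReg P k a x i) * (y j - outcomeReg P k a x j) ∂(outcomeLaw P k a x)

/-- Conditions (A2)-(A4) on the law of the full data; (A1) is built into `observe`. -/
structure CausalAssumptions (Q : ProbabilityMeasure (Full M d)) : Prop where
  /-- (A2) conditional ignorability: `Y(a) ⫫ A | X, L = k`. -/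
  ignorability : ∀ (k : Fin K) (a : Treat (M k)),
    CondIndepFun (MeasurableSpace.comap (fun u : TypeFull (M k) (d k) => u.2.2) inferInstance)
      (measurable_snd.comp measurable_snd).comap_le
      (fun u => u.1 a) (fun u => u.2.1) (typeLaw Q k)
  /-- (A3) overlap. -/
  overlap : ∃ c : ℝ, 0 < c ∧ ∀ (k : Fin K) (a : Treat (M k)),
    ∀ᵐ x ∂(covLaw (observedLaw Q) k),
      c < propensity (observedLaw Q) k a x ∧ propensity (observedLaw Q) k a x < 1 - c
  /-- (A4) the conditional first and second moments of `Y` exist, -/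
  moments : ∀ (k : Fin K) (a : Treat (M k)),
    ∀ᵐ x ∂(covLaw (observedLaw Q) k), MemLp id 2 (outcomeLaw (observedLaw Q) k a x)
  /-- `E{g(a, X, k) | L = k}` exists and is finite, -/
  integrable_reg : ∀ (k : Fin K) (a : Treat (M k)),
    Integrable (outcomeReg (observedLaw Q) k a) (covLaw (observedLaw Q) k)
  /-- `E{Σ(a, X, k) | L = k}` exists and is finite, -/
  integrable_cov : ∀ (k : Fin K) (a : Treat (M k)) (i j : Fin (M k)),
    Integrable (fun x => outcomeCov (observedLaw Q) k a x i j) (covLaw (observedLaw Q) k)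
  /-- and `Σ(a, x, k)` is positive definite. -/
  posDef : ∀ (k : Fin K) (a : Treat (M k)),
    ∀ᵐ x ∂(covLaw (observedLaw Q) k), (outcomeCov (observedLaw Q) k a x).PosDef

/-! ### Estimands -/

/-- Weight functions `w_k(a, x) ∈ ℝ^{M_k}`. -/
abbrev Weights (M d : Fin K → ℕ) : Type :=
  ∀ k : Fin K, Treat (M k) → (Fin (d k) → ℝ) → (Fin (M k) → ℝ)

/-- The causal parameter `θ_k = ∑_a E{w_k(a, X)ᵀ Y(a) | L = k}`. -/
def causalTheta (w : Weights M d) (Q : ProbabilityMeasure (Full M d)) (k : Fin K) : ℝ :=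
  ∑ a : Treat (M k), ∫ u, w k a u.2.2 ⬝ᵥ u.1 a ∂(typeLaw Q k)

/-- The causal parameter `τ = ∑_k v_k(p_k) θ_k`. -/
def causalTau (w : Weights M d) (v : Fin K → ℝ → ℝ) (Q : ProbabilityMeasure (Full M d)) : ℝ :=
  ∑ k, v k (typeProb Q k) * causalTheta w Q k

/-- The observed-data functional `P ↦ ∑_k v_k(p_k) ∑_a E{w_k(a, X)ᵀ g(a, X, k) | L = k}`. -/
def tauFunctional (w : Weights M d) (v : Fin K → ℝ → ℝ)
    (P : ProbabilityMeasure (Obs M d)) : ℝ :=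
  ∑ k, v k (typeProb P k) *
    ∑ a : Treat (M k), ∫ x, w k a x ⬝ᵥ outcomeReg P k a x ∂(covLaw P k)

/-! ### Semiparametric efficiency in the nonparametric model -/

section Efficiency

variable {E : Type} [MeasurableSpace E]

/-- A regular one-dimensional parametric submodel `t ↦ path t` of the nonparametric model, passing
through `P` at `t = 0`, with score `s`: it is differentiable in quadratic mean, with likelihood
ratios `dP_t / dP` bounded away from `0` and `∞` for small `t`, so that overlap and all moment
conditions that hold at `P` also hold along the submodel. -/
structure IsRegularSubmodel (P : ProbabilityMeasure E) (path : ℝ → ProbabilityMeasure E)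
    (s : E → ℝ) : Prop where
  base : path 0 = P
  score_memLp : MemLp s 2 (P : Measure E)
  differentiable : ∃ f : ℝ → E → ℝ, (∀ t, Measurable (f t)) ∧
    (∃ C : ℝ, 0 < C ∧ ∀ᶠ t in 𝓝 (0 : ℝ), ∀ z, C⁻¹ ≤ f t z ∧ f t z ≤ C) ∧
    (∀ᶠ t in 𝓝 (0 : ℝ),
      (path t : Measure E) = (P : Measure E).withDensity (fun z => ENNReal.ofReal (f t z))) ∧
    Tendsto (fun t : ℝ => eLpNorm (fun z => (√(f t z) - 1) / t - s z / 2) 2 (P : Measure E))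
      (𝓝[≠] 0) (𝓝 0)

/-- Tangent space: the closed linear span in `L²(P)` of the scores of regular submodels. -/
def tangentSpace (P : ProbabilityMeasure E) : Submodule ℝ (Lp ℝ 2 (P : Measure E)) :=
  (Submodule.span ℝ {u : Lp ℝ 2 (P : Measure E) | ∃ path s, IsRegularSubmodel P path s ∧
    u =ᵐ[(P : Measure E)] s}).topologicalClosure

/-- `ψ` is the efficient influence function of the functional `τ` at `P`: it represents the pathwise
derivative of `τ` along every regular submodel, and it belongs to the tangent space. -/
def IsEfficientInfluenceFunction (P : ProbabilityMeasure E) (τ : ProbabilityMeasure E → ℝ)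
    (ψ : E → ℝ) : Prop :=
  (∀ path s, IsRegularSubmodel P path s →
      HasDerivAt (fun t => τ (path t)) (∫ z, ψ z * s z ∂(P : Measure E)) 0) ∧
  ∃ hψ : MemLp ψ 2 (P : Measure E), hψ.toLp ψ ∈ tangentSpace P

/-- `B` is the semiparametric efficiency bound of the functional `τ` at `P`: the supremum of the
Cramér-Rao bounds `(dτ/dt)² / E(s²)` over all regular one-dimensional submodels. -/
def IsEfficiencyBound (P : ProbabilityMeasure E) (τ : ProbabilityMeasure E → ℝ) (B : ℝ) : Prop :=
  IsLUB {b : ℝ | ∃ path s D, IsRegularSubmodel P path s ∧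
    0 < ∫ z, s z ^ 2 ∂(P : Measure E) ∧ HasDerivAt (fun t => τ (path t)) D 0 ∧
    b = D ^ 2 / ∫ z, s z ^ 2 ∂(P : Measure E)} B

variable {Ω : Type*} [MeasurableSpace Ω]

/-- `√N (T_N - τ) = N^{-1/2} ∑_{i ≤ N} φ(Z_i) + o_P(1)` with `E φ = 0` and `E φ² < ∞`:
the estimator `T` of `τ` is asymptotically linear with influence function `φ`. -/
def IsAsymptoticallyLinear (μ : Measure Ω) (P : ProbabilityMeasure E) (Z : ℕ → Ω → E)
    (T : ℕ → Ω → ℝ) (τ : ℝ) (φ : E → ℝ) : Prop :=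
  MemLp φ 2 (P : Measure E) ∧ ∫ z, φ z ∂(P : Measure E) = 0 ∧
  TendstoInMeasure μ
    (fun (N : ℕ) ω => √(N : ℝ) * (T N ω - τ) - (√(N : ℝ))⁻¹ * ∑ i ∈ Finset.range N, φ (Z i ω))
    atTop (fun _ => 0)

end Efficiency

/-! ### Working models, estimating equations and the estimator -/

/-- Parametric working models `e(a | x, k; β_e)`, `β_e ∈ Be`, for the propensity score and
`g(a, x, k; β_g)`, `β_g ∈ Bg`, for the outcome regression. -/
structure WorkingModel (M d : Fin K → ℕ) (de dg : ℕ) where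
  Be : Set (Fin de → ℝ)
  Bg : Set (Fin dg → ℝ)
  e : (Fin de → ℝ) → ∀ k : Fin K, Treat (M k) → (Fin (d k) → ℝ) → ℝ
  g : (Fin dg → ℝ) → ∀ k : Fin K, Treat (M k) → (Fin (d k) → ℝ) → (Fin (M k) → ℝ)
  measurable_e : ∀ βe k a, Measurable (e βe k a)
  measurable_g : ∀ βg k a, Measurable (g βg k a)
  e_pos : ∀ βe ∈ Be, ∀ k a x, 0 < e βe k a x
  e_sum : ∀ βe ∈ Be, ∀ k x, ∑ a, e βe k a x = 1

/-- `βe` gives the true propensity score. -/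
def IsTrueE (P : ProbabilityMeasure (Obs M d)) (m : WorkingModel M d de dg)
    (βe : Fin de → ℝ) : Prop :=
  βe ∈ m.Be ∧ ∀ k a, ∀ᵐ x ∂(covLaw P k), propensity P k a x = m.e βe k a x

/-- `βg` gives the true outcome regression. -/
def IsTrueG (P : ProbabilityMeasure (Obs M d)) (m : WorkingModel M d de dg)
    (βg : Fin dg → ℝ) : Prop :=
  βg ∈ m.Bg ∧ ∀ k a, ∀ᵐ x ∂(covLaw P k), outcomeReg P k a x = m.g βg k a x

/-- `P ∈ ℳ_e`: the propensity model is correct, with a unique true parameter. -/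
def InModelE (P : ProbabilityMeasure (Obs M d)) (m : WorkingModel M d de dg) : Prop :=
  ∃! βe, IsTrueE P m βe

/-- `P ∈ ℳ_g`: the outcome model is correct, with a unique true parameter. -/
def InModelG (P : ProbabilityMeasure (Obs M d)) (m : WorkingModel M d de dg) : Prop :=
  ∃! βg, IsTrueG P m βg

/-- The augmented inverse probability weighted score of a cluster; for a cluster of type `k` it is
`φ_k(O, e, g) = w_k(A, X)ᵀ {Y - g(A, X, k)} / e(A | X, k) + ∑_a w_k(a, X)ᵀ g(a, X, k)`. -/
def aipw (w : Weights M d) (e : ∀ k : Fin K, Treat (M k) → (Fin (d k) → ℝ) → ℝ)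
    (g : ∀ k : Fin K, Treat (M k) → (Fin (d k) → ℝ) → (Fin (M k) → ℝ)) (z : Obs M d) : ℝ :=
  let k := z.1
  let y := z.2.1
  let a := z.2.2.1
  let x := z.2.2.2
  (w k a x ⬝ᵥ (y - g k a x)) / e k a x + ∑ a', w k a' x ⬝ᵥ g k a' x

/-- Nuisance parameters `β = (β_e, β_g)`. -/
abbrev Beta (de dg : ℕ) : Type := (Fin de → ℝ) × (Fin dg → ℝ)

/-- All parameters `(θ, β)`. -/
abbrev Param (K de dg : ℕ) : Type := (Fin K → ℝ) × Beta de dg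

/-- `Ψ_{θ,k}(θ_k, β) = 1(L = k) {φ_k(O, e(· ; β_e), g(· ; β_g)) - θ_k}`. -/
def psiTheta (w : Weights M d) (m : WorkingModel M d de dg) (z : Obs M d)
    (η : Param K de dg) (k : Fin K) : ℝ :=
  if z.1 = k then aipw w (m.e η.2.1) (m.g η.2.2) z - η.1 k else 0

/-- The stacked estimating function `Ψ(θ, β) = (Ψ_θ(θ, β), Ψ_β(β))`. -/
def psi (w : Weights M d) (m : WorkingModel M d de dg)
    (psiBeta : Obs M d → Beta de dg → Beta de dg) (z : Obs M d) (η : Param K de dg) :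
    Param K de dg :=
  (psiTheta w m z η, psiBeta z η.2)

/-- Regularity conditions (R1)-(R4) on the estimating function, with population root
`η₀ = (θ₀, β₀)`. -/
structure RegularityConditions (P : ProbabilityMeasure (Obs M d)) (w : Weights M d)
    (m : WorkingModel M d de dg) (psiBeta : Obs M d → Beta de dg → Beta de dg)
    (Ω₀ : Set (Param K de dg)) (η₀ : Param K de dg) : Prop where
  /-- (R1) the parameter space is open and bounded, -/
  isOpen : IsOpen Ω₀
  isBounded : Bornology.IsBounded Ω₀
  /-- and `β_e`, `β_g` are variationally independent. -/
  variationIndependent : Prod.snd '' Ω₀ = m.Be ×ˢ m.Bg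
  /-- (R2) -/
  contDiff : ∀ᵐ z ∂(P : Measure (Obs M d)), ContDiffOn ℝ 2 (psi w m psiBeta z) Ω₀
  /-- (R3) `η₀` is the unique root of the population equation (i); -/
  root_mem : η₀ ∈ Ω₀
  root : ∫ z, psi w m psiBeta z η₀ ∂(P : Measure (Obs M d)) = 0
  root_unique : ∀ η ∈ Ω₀, Integrable (fun z => psi w m psiBeta z η) (P : Measure (Obs M d)) →
    ∫ z, psi w m psiBeta z η ∂(P : Measure (Obs M d)) = 0 → η = η₀
  /-- (ii) finite second moment at the root; -/
  memLp : MemLp (fun z => psi w m psiBeta z η₀) 2 (P : Measure (Obs M d))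
  /-- (iii) the expected Jacobian exists and is nonsingular. -/
  integrable_jacobian :
    Integrable (fun z => fderiv ℝ (psi w m psiBeta z) η₀) (P : Measure (Obs M d))
  nonsingular :
    (∫ z, fderiv ℝ (psi w m psiBeta z) η₀ ∂(P : Measure (Obs M d))).IsInvertible
  /-- (R4) the second derivatives are dominated near the root by an integrable function. -/
  dominated : ∃ U ∈ 𝓝 η₀, ∃ G : Obs M d → ℝ, Integrable G (P : Measure (Obs M d)) ∧
    ∀ᵐ z ∂(P : Measure (Obs M d)), ∀ η ∈ U, ‖iteratedFDeriv ℝ 2 (psi w m psiBeta z) η‖ ≤ G z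

/-- Influence function of `τ = ∑_k v_k(p_k) θ_k` built from the influence functions `φ k` of the
`θ_k`: `∑_k [v_k(p_k) φ_k + {1(L = k) - p_k} v_k'(p_k) θ_k]`. -/
def tauInfluence (P : ProbabilityMeasure (Obs M d)) (v : Fin K → ℝ → ℝ) (θ : Fin K → ℝ)
    (φ : Fin K → Obs M d → ℝ) (z : Obs M d) : ℝ :=
  ∑ k, (v k (typeProb P k) * φ k z +
    ((if z.1 = k then 1 else 0) - typeProb P k) * deriv (v k) (typeProb P k) * θ k)

/-- `1(L = k) {φ_k(O, e, g) - θ_k} / p_k`. -/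
def plugInfluence (P : ProbabilityMeasure (Obs M d)) (w : Weights M d) (θ : Fin K → ℝ)
    (e : ∀ k : Fin K, Treat (M k) → (Fin (d k) → ℝ) → ℝ)
    (g : ∀ k : Fin K, Treat (M k) → (Fin (d k) → ℝ) → (Fin (M k) → ℝ))
    (k : Fin K) (z : Obs M d) : ℝ :=
  (if z.1 = k then aipw w e g z - θ k else 0) / typeProb P k

/-- `p_k⁻¹ [Ψ_{θ,k}(θ_k, β) - E{∂Ψ_{θ,k}(θ_k, β)/∂β} [E{∂Ψ_β(β)/∂β}]⁻¹ Ψ_β(β)]`. -/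
def parInfluence (P : ProbabilityMeasure (Obs M d)) (w : Weights M d)
    (m : WorkingModel M d de dg) (psiBeta : Obs M d → Beta de dg → Beta de dg)
    (θ : Fin K → ℝ) (β : Beta de dg) (k : Fin K) (z : Obs M d) : ℝ :=
  (psiTheta w m z (θ, β) k
    - (∫ z', fderiv ℝ (fun b => psiTheta w m z' (θ, b) k) β ∂(P : Measure (Obs M d)))
        ((∫ z', fderiv ℝ (psiBeta z') β ∂(P : Measure (Obs M d))).inverse (psiBeta z β)))
    / typeProb P k

/-- `p̂_k = N_k / N`. -/
def pHat {Ω : Type*} (Z : ℕ → Ω → Obs M d) (N : ℕ) (ω : Ω) (k : Fin K) : ℝ :=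
  (((Finset.range N).filter (fun i => (Z i ω).1 = k)).card : ℝ) / N

/-- `τ̂ = v(p̂)ᵀ θ̂`. -/
def tauHat {Ω : Type*} (v : Fin K → ℝ → ℝ) (Z : ℕ → Ω → Obs M d)
    (θHat : ℕ → Ω → Fin K → ℝ) (N : ℕ) (ω : Ω) : ℝ :=
  ∑ k, v k (pHat Z N ω k) * θHat N ω k

end

end PartialInterference

open PartialInterference

/-! Identification rests on one identity between measures. Under ignorability, on the event `A = a`
the pair `(X, Y(a))` has density `e(a | X)` with respect to its unconditional law
(`map_potential_restrict_treat`). Dividing by the propensity score removes this density, so the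
inverse probability weighted outcome has mean `θ_k`; conditioning the same variable on `(A, X)`
turns its mean into the regression functional.

Double robustness: the score `φ_k(O, e, g)` has mean `θ_k` as soon as one of `e`, `g` is the true
function. With the true `e` the terms in `g` cancel on averaging over `A` given `X`; with the true
`g` the residual is centred given `(A, X)` (`integral_clusterAipw_of_propensity`,
`integral_clusterAipw_of_reg`). Hence the `θ`-component of the population root is the causal
parameter. The estimating equation is linearised at this root by a quadratic Taylor bound, the law
of large numbers for the Jacobian and Chebyshev's inequality for the score
(`negligible_estimating_equation`). Since `Ψ` is affine in `θ` with a slope free of `β`, the Taylor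
remainder involves only the error of `βHat`, and consistency of `βHat` is enough. The expected
Jacobian is block triangular, and its inverse produces `parInfluence` (`parInfluence_eq`). A delta
method brings in the sample fractions of the types.

When both models are correct, moving `β_g` alone leaves `e` true and moving `β_e` alone leaves `g`
true. The mean of `Ψ_{θ,k}` therefore stays zero along both families of lines, its gradient in `β`
vanishes, and so does the correction for estimating `β` (`parInfluence_eq_plugInfluence`).

For efficiency, the mean under `P_t` of the score with the nuisance functions of `P` differs from
`θ_k(P_t)` by the integral of a product: a difference of inverse propensities times a change of
density weighted by the residual (`sq_integral_clusterAipw_sub_le`). In `L²` the first factor is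
`O(t)` and the second `o(1)`, so the difference is `o(t)` and only means of fixed functions remain
to be differentiated. Every bounded centred function is a score, and these functions are dense among
the centred square-integrable ones. So the influence function lies in the tangent space;
Cauchy-Schwarz bounds every Cramér-Rao quotient by its variance, and density shows that this bound
is the supremum. The limit law follows from the central limit theorem and Slutsky's lemma. -/

namespace PartialInterference

noncomputable section

/-! ### Conditional laws, inverse weighting and double robustness for a single cluster type. -/

section ClusterLaw

variable {m d : ℕ}

/-- Propensity score of the law `ν` of a single cluster. -/
def clusterPropensity (ν : Measure (TypeObs m d)) [IsFiniteMeasure ν] (a : Treat m)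
    (x : Fin d → ℝ) : ℝ :=
  (condDistrib (fun o : TypeObs m d => o.2.1) (fun o => o.2.2) ν x).real {a}

/-- Conditional law of the outcome under the law `ν` of a single cluster. -/
def clusterOutcome (ν : Measure (TypeObs m d)) [IsFiniteMeasure ν] (a : Treat m)
    (x : Fin d → ℝ) : Measure (Fin m → ℝ) :=
  condDistrib (fun o : TypeObs m d => o.1) (fun o => o.2) ν (a, x)

/-- Outcome regression of the law `ν` of a single cluster. -/
def clusterReg (ν : Measure (TypeObs m d)) [IsFiniteMeasure ν] (a : Treat m)
    (x : Fin d → ℝ) : Fin m → ℝ :=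
  fun j => ∫ y, y j ∂(clusterOutcome ν a x)

/-- Law of the covariates of a single cluster. -/
def clusterCov (ν : Measure (TypeObs m d)) : Measure (Fin d → ℝ) := ν.map (fun o => o.2.2)

/-- Augmented inverse probability weighted score of a single cluster. -/
def clusterAipw (w : Treat m → (Fin d → ℝ) → Fin m → ℝ) (e : Treat m → (Fin d → ℝ) → ℝ)
    (g : Treat m → (Fin d → ℝ) → Fin m → ℝ) (o : TypeObs m d) : ℝ :=
  (w o.2.1 o.2.2 ⬝ᵥ (o.1 - g o.2.1 o.2.2)) / e o.2.1 o.2.2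
    + ∑ a, w a o.2.2 ⬝ᵥ g a o.2.2

theorem measurable_cov : Measurable (fun o : TypeObs m d => o.2.2) :=
  measurable_snd.comp measurable_snd

theorem measurable_treat : Measurable (fun o : TypeObs m d => o.2.1) :=
  measurable_fst.comp measurable_snd

theorem measurableSet_treat (a : Treat m) : MeasurableSet {o : TypeObs m d | o.2.1 = a} :=
  measurable_treat (measurableSet_singleton a)

theorem measurable_uncurry_treat {S : Type*} [MeasurableSpace S] {f : Treat m → (Fin d → ℝ) → S}
    (hf : ∀ a, Measurable (f a)) : Measurable (fun p : Treat m × (Fin d → ℝ) => f p.1 p.2) :=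
  measurable_from_prod_countable_right hf

theorem ae_treat_cov (ν : Measure (TypeObs m d)) {p : Treat m → (Fin d → ℝ) → Prop}
    (h : ∀ a, ∀ᵐ x ∂(clusterCov ν), p a x) : ∀ᵐ o ∂ν, ∀ a, p a o.2.2 :=
  ae_all_iff.2 fun a => ae_of_ae_map measurable_cov.aemeasurable (h a)

theorem clusterAipw_congr (ν : Measure (TypeObs m d))
    {w : Treat m → (Fin d → ℝ) → Fin m → ℝ}
    {e e' : Treat m → (Fin d → ℝ) → ℝ} {g g' : Treat m → (Fin d → ℝ) → Fin m → ℝ}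
    (he : ∀ a, ∀ᵐ x ∂(clusterCov ν), e a x = e' a x)
    (hg : ∀ a, ∀ᵐ x ∂(clusterCov ν), g a x = g' a x) :
    clusterAipw w e g =ᵐ[ν] clusterAipw w e' g' := by
  filter_upwards [ae_treat_cov ν he, ae_treat_cov ν hg] with o h1 h2
  simp [clusterAipw, h1, h2]

variable (ν : Measure (TypeObs m d)) [IsFiniteMeasure ν]

instance : IsFiniteMeasure (clusterCov ν) := by unfold clusterCov; infer_instance

theorem measurable_clusterPropensity (a : Treat m) : Measurable (clusterPropensity ν a) :=
  (Kernel.measurable_coe _ (measurableSet_singleton a)).ennreal_toReal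

theorem clusterPropensity_nonneg (a : Treat m) (x : Fin d → ℝ) : 0 ≤ clusterPropensity ν a x :=
  measureReal_nonneg

theorem clusterPropensity_le_one (a : Treat m) (x : Fin d → ℝ) : clusterPropensity ν a x ≤ 1 :=
  measureReal_le_one

theorem sum_clusterPropensity (x : Fin d → ℝ) : ∑ a, clusterPropensity ν a x = 1 := by
  unfold clusterPropensity
  rw [sum_measureReal_singleton]
  simp

theorem measurable_clusterReg (a : Treat m) : Measurable (clusterReg ν a) := by
  refine measurable_pi_iff.2 fun j => ?_
  have h : StronglyMeasurable (fun p : (Treat m × (Fin d → ℝ)) × (Fin m → ℝ) => p.2 j) :=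
    ((measurable_pi_apply j).comp measurable_snd).stronglyMeasurable
  have h2 := (h.integral_condDistrib (Y := fun o : TypeObs m d => o.1) (X := fun o => o.2)
    (μ := ν)).measurable
  exact h2.comp (measurable_prodMk_left (x := a))

theorem measurable_clusterAipw {w : Treat m → (Fin d → ℝ) → Fin m → ℝ}
    {e : Treat m → (Fin d → ℝ) → ℝ} {g : Treat m → (Fin d → ℝ) → Fin m → ℝ}
    (hw : ∀ a, Measurable (w a)) (he : ∀ a, Measurable (e a)) (hg : ∀ a, Measurable (g a)) :
    Measurable (clusterAipw w e g) := by
  have hw' := (measurable_uncurry_treat hw).comp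
    (measurable_snd : Measurable (Prod.snd : TypeObs m d → _))
  have he' := (measurable_uncurry_treat he).comp
    (measurable_snd : Measurable (Prod.snd : TypeObs m d → _))
  have hg' := (measurable_uncurry_treat hg).comp
    (measurable_snd : Measurable (Prod.snd : TypeObs m d → _))
  unfold clusterAipw dotProduct
  refine Measurable.add (Measurable.div ?_ he') ?_
  · refine Finset.measurable_sum _ fun j _ => ?_
    exact ((measurable_pi_apply j).comp hw').mul
      ((measurable_pi_apply j).comp (measurable_fst.sub hg'))
  · refine Finset.measurable_sum _ fun a _ => Finset.measurable_sum _ fun j _ => ?_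
    exact (((measurable_pi_apply j).comp (hw a)).mul
      ((measurable_pi_apply j).comp (hg a))).comp measurable_cov

/-- Disintegration of the event `A = a` over `X`. It trades integrals with a treatment indicator for
covariate integrals weighted by the propensity score. -/
theorem map_cov_restrict_treat (a : Treat m) :
    (ν.restrict {o | o.2.1 = a}).map (fun o => o.2.2)
      = (clusterCov ν).withDensity (fun x => ENNReal.ofReal (clusterPropensity ν a x)) := by
  ext s hs
  rw [Measure.map_apply measurable_cov hs, Measure.restrict_apply (measurable_cov hs),
    withDensity_apply _ hs, clusterCov,
    setLIntegral_map hs (measurable_clusterPropensity ν a).ennreal_ofReal measurable_cov]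
  have h := setLIntegral_preimage_condDistrib (μ := ν) (Y := fun o : TypeObs m d => o.2.1)
    measurable_cov measurable_treat.aemeasurable (measurableSet_singleton a) hs
  rw [show (fun o : TypeObs m d => o.2.2) ⁻¹' s ∩ {o | o.2.1 = a}
    = (fun o : TypeObs m d => o.2.2) ⁻¹' s ∩ (fun o => o.2.1) ⁻¹' {a} from rfl, ← h]
  refine lintegral_congr fun o => ?_
  simp [clusterPropensity]

theorem integrable_treat_iff {h : (Fin d → ℝ) → ℝ} (hh : Measurable h) (a : Treat m) :
    Integrable (fun o : TypeObs m d => if o.2.1 = a then h o.2.2 else 0) ν ↔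
      Integrable (fun x => clusterPropensity ν a x * h x) (clusterCov ν) := by
  have h1 : (fun o : TypeObs m d => if o.2.1 = a then h o.2.2 else 0)
      = {o : TypeObs m d | o.2.1 = a}.indicator (fun o => h o.2.2) := by
    ext o; simp [Set.indicator_apply]
  rw [h1, integrable_indicator_iff (measurableSet_treat a), IntegrableOn,
    show (fun o : TypeObs m d => h o.2.2) = h ∘ (fun o => o.2.2) from rfl,
    ← integrable_map_measure hh.aestronglyMeasurable measurable_cov.aemeasurable,
    map_cov_restrict_treat,
    integrable_withDensity_iff (measurable_clusterPropensity ν a).ennreal_ofReal (by simp)]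
  refine integrable_congr (ae_of_all _ fun x => ?_)
  simp [ENNReal.toReal_ofReal (clusterPropensity_nonneg ν a x), mul_comm]

theorem integral_treat {h : (Fin d → ℝ) → ℝ} (hh : Measurable h) (a : Treat m) :
    ∫ o, (if o.2.1 = a then h o.2.2 else 0) ∂ν
      = ∫ x, clusterPropensity ν a x * h x ∂(clusterCov ν) := by
  have h1 : (fun o : TypeObs m d => if o.2.1 = a then h o.2.2 else 0)
      = {o : TypeObs m d | o.2.1 = a}.indicator (fun o => h o.2.2) := by
    ext o; simp [Set.indicator_apply]
  rw [h1, integral_indicator (measurableSet_treat a),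
    ← integral_map (φ := fun o : TypeObs m d => o.2.2) (f := h) measurable_cov.aemeasurable
      hh.aestronglyMeasurable, map_cov_restrict_treat,
    integral_withDensity_eq_integral_toReal_smul
      (measurable_clusterPropensity ν a).ennreal_ofReal (by simp)]
  refine integral_congr_ae (ae_of_all _ fun x => ?_)
  simp [ENNReal.toReal_ofReal (clusterPropensity_nonneg ν a x)]

theorem integrable_and_integral_treat_cov {F : Treat m → (Fin d → ℝ) → ℝ}
    (hF : ∀ a, Measurable (F a)) (hi : Integrable (fun o : TypeObs m d => F o.2.1 o.2.2) ν) :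
    (∀ a, Integrable (fun x => clusterPropensity ν a x * F a x) (clusterCov ν)) ∧
      ∫ o, F o.2.1 o.2.2 ∂ν = ∑ a, ∫ x, clusterPropensity ν a x * F a x ∂(clusterCov ν) := by
  have h0 : ∀ a, Integrable (fun o : TypeObs m d => if o.2.1 = a then F a o.2.2 else 0) ν := by
    intro a
    have := hi.indicator (measurableSet_treat a)
    refine this.congr (ae_of_all _ fun o => ?_)
    by_cases h : o.2.1 = a
    · simp [← h]
    · simp [h]
  refine ⟨fun a => (integrable_treat_iff ν (hF a) a).1 (h0 a), ?_⟩
  simp_rw [← integral_treat ν (hF _) _]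
  rw [← integral_finsetSum _ fun a _ => h0 a]
  refine integral_congr_ae (ae_of_all _ fun o => ?_)
  simp

/-- The outcome has finite conditional expectations. -/
def CondIntegrable : Prop :=
  ∀ᵐ p ∂(ν.map (fun o => o.2)), ∀ j, Integrable (fun y : Fin m → ℝ => y j)
    (clusterOutcome ν p.1 p.2)

theorem condIntegrable_of_integrable (h : ∀ j, Integrable (fun o : TypeObs m d => o.1 j) ν) :
    CondIntegrable ν := by
  refine ae_all_iff.2 fun j => ?_
  have h1 : Integrable (fun p : (Treat m × (Fin d → ℝ)) × (Fin m → ℝ) => p.2 j)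
      (ν.map fun o => (o.2, o.1)) := by
    rw [integrable_map_measure (by fun_prop) (by fun_prop)]
    exact h j
  exact h1.condDistrib_ae_map measurable_fst.aemeasurable

/-- Tower property: the law of `(A, X)` composed with the outcome kernel is the joint law, so Fubini
for `compProd` applies. -/
theorem integral_eq_integral_outcome {f : (Treat m × (Fin d → ℝ)) → (Fin m → ℝ) → ℝ}
    (hf : Measurable (fun p : (Treat m × (Fin d → ℝ)) × (Fin m → ℝ) => f p.1 p.2))
    (hi : Integrable (fun o : TypeObs m d => f o.2 o.1) ν) :
    Integrable (fun o : TypeObs m d => ∫ y, f o.2 y ∂(clusterOutcome ν o.2.1 o.2.2)) ν ∧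
      ∫ o, f o.2 o.1 ∂ν = ∫ o, ∫ y, f o.2 y ∂(clusterOutcome ν o.2.1 o.2.2) ∂ν := by
  have h1 : Integrable (fun p : (Treat m × (Fin d → ℝ)) × (Fin m → ℝ) => f p.1 p.2)
      (ν.map fun o => (o.2, o.1)) := by
    rw [integrable_map_measure hf.aestronglyMeasurable (by fun_prop)]
    exact hi
  refine ⟨h1.integral_condDistrib measurable_snd.aemeasurable measurable_fst.aemeasurable, ?_⟩
  have h2 := h1
  rw [← compProd_map_condDistrib measurable_fst.aemeasurable] at h2
  have h3 := Measure.integral_compProd h2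
  rw [compProd_map_condDistrib measurable_fst.aemeasurable,
    integral_map (by fun_prop) hf.aestronglyMeasurable, integral_map (by fun_prop)] at h3
  · exact h3
  · exact h1.aestronglyMeasurable.integral_condDistrib_map measurable_fst.aemeasurable

theorem measurable_dot {c : Treat m → (Fin d → ℝ) → Fin m → ℝ} (hc : ∀ a, Measurable (c a)) :
    Measurable (fun p : (Treat m × (Fin d → ℝ)) × (Fin m → ℝ) => c p.1.1 p.1.2 ⬝ᵥ p.2) := by
  have := (measurable_uncurry_treat hc).comp
    (measurable_fst : Measurable
      (Prod.fst : (Treat m × (Fin d → ℝ)) × (Fin m → ℝ) → _))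
  unfold dotProduct
  refine Finset.measurable_sum _ fun j _ => ?_
  exact ((measurable_pi_apply j).comp this).mul ((measurable_pi_apply j).comp measurable_snd)

theorem integral_dot_outcome (p : Treat m × (Fin d → ℝ)) (c : Fin m → ℝ)
    (h : ∀ j, Integrable (fun y : Fin m → ℝ => y j) (clusterOutcome ν p.1 p.2)) :
    ∫ y, c ⬝ᵥ y ∂(clusterOutcome ν p.1 p.2) = c ⬝ᵥ clusterReg ν p.1 p.2 := by
  unfold dotProduct clusterReg
  rw [integral_finsetSum _ fun j _ => (h j).const_mul _]
  simp_rw [integral_const_mul]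

theorem integrable_and_integral_dot_reg {c : Treat m → (Fin d → ℝ) → Fin m → ℝ}
    (hc : ∀ a, Measurable (c a)) (hν : CondIntegrable ν)
    (hi : Integrable (fun o : TypeObs m d => c o.2.1 o.2.2 ⬝ᵥ o.1) ν) :
    Integrable (fun o : TypeObs m d => c o.2.1 o.2.2 ⬝ᵥ clusterReg ν o.2.1 o.2.2) ν ∧
      ∫ o, c o.2.1 o.2.2 ⬝ᵥ o.1 ∂ν = ∫ o, c o.2.1 o.2.2 ⬝ᵥ clusterReg ν o.2.1 o.2.2 ∂ν := by
  have h := integral_eq_integral_outcome ν (f := fun p y => c p.1 p.2 ⬝ᵥ y) (measurable_dot hc) hi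
  have h2 : (fun o : TypeObs m d => ∫ y, c o.2.1 o.2.2 ⬝ᵥ y ∂(clusterOutcome ν o.2.1 o.2.2))
      =ᵐ[ν] fun o => c o.2.1 o.2.2 ⬝ᵥ clusterReg ν o.2.1 o.2.2 := by
    filter_upwards [ae_of_ae_map (by fun_prop) hν] with o ho
    exact integral_dot_outcome ν o.2 _ ho
  exact ⟨h.1.congr h2, h.2.trans (integral_congr_ae h2)⟩

instance (a : Treat m) (x : Fin d → ℝ) : IsProbabilityMeasure (clusterOutcome ν a x) := by
  unfold clusterOutcome; infer_instance

/-- The residual has conditional mean zero given `(A, X)`. Integrability is available only for the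
weighted residual as a whole, so the tower property is applied to it unsplit and the difference is
separated only inside the conditional law. -/
theorem integral_dot_residual {c : Treat m → (Fin d → ℝ) → Fin m → ℝ}
    (hc : ∀ a, Measurable (c a)) (hν : CondIntegrable ν)
    (hi : Integrable
      (fun o : TypeObs m d => c o.2.1 o.2.2 ⬝ᵥ (o.1 - clusterReg ν o.2.1 o.2.2)) ν) :
    ∫ o, c o.2.1 o.2.2 ⬝ᵥ (o.1 - clusterReg ν o.2.1 o.2.2) ∂ν = 0 := by
  have hm : Measurable (fun p : (Treat m × (Fin d → ℝ)) × (Fin m → ℝ) =>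
      c p.1.1 p.1.2 ⬝ᵥ (p.2 - clusterReg ν p.1.1 p.1.2)) := by
    refine (measurable_dot hc).comp (measurable_fst.prodMk (measurable_snd.sub ?_))
    exact (measurable_uncurry_treat (measurable_clusterReg ν)).comp measurable_fst
  have h := integral_eq_integral_outcome ν
    (f := fun p y => c p.1 p.2 ⬝ᵥ (y - clusterReg ν p.1 p.2)) hm hi
  rw [h.2]
  refine integral_eq_zero_of_ae ?_
  filter_upwards [ae_of_ae_map (by fun_prop) hν] with o ho
  simp only [dotProduct_sub, Pi.zero_apply]
  rw [integral_sub, integral_dot_outcome ν o.2 _ ho]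
  · simp
  · exact integrable_finsetSum _ fun j _ => (ho j).const_mul _
  · exact integrable_const _

/-- Inverse probability weighting. -/
theorem integrable_and_integral_ipw {w : Treat m → (Fin d → ℝ) → Fin m → ℝ}
    (hw : ∀ a, Measurable (w a)) (hν : CondIntegrable ν)
    (he : ∀ a, ∀ᵐ x ∂(clusterCov ν), 0 < clusterPropensity ν a x)
    (hi : Integrable
      (fun o : TypeObs m d => (w o.2.1 o.2.2 ⬝ᵥ o.1) / clusterPropensity ν o.2.1 o.2.2) ν) :
    (∀ a, Integrable (fun x => w a x ⬝ᵥ clusterReg ν a x) (clusterCov ν)) ∧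
      ∫ o, (w o.2.1 o.2.2 ⬝ᵥ o.1) / clusterPropensity ν o.2.1 o.2.2 ∂ν
        = ∑ a, ∫ x, w a x ⬝ᵥ clusterReg ν a x ∂(clusterCov ν) := by
  -- The factor `1 / e` is absorbed into the weight, which reduces the claim to an unweighted tower
  -- property.
  set c : Treat m → (Fin d → ℝ) → Fin m → ℝ := fun a x => (clusterPropensity ν a x)⁻¹ • w a x
    with hc_def
  have hc : ∀ a, Measurable (c a) := fun a =>
    (measurable_clusterPropensity ν a).inv.smul (hw a)
  have hcd : ∀ a x y, c a x ⬝ᵥ y = (w a x ⬝ᵥ y) / clusterPropensity ν a x := by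
    intro a x y
    rw [hc_def, smul_dotProduct, smul_eq_mul, div_eq_inv_mul]
  simp_rw [← hcd] at hi ⊢
  obtain ⟨h1, h2⟩ := integrable_and_integral_dot_reg ν hc hν hi
  have hm : ∀ a, Measurable (fun x => c a x ⬝ᵥ clusterReg ν a x) := fun a =>
    Finset.measurable_sum _ fun j _ => ((measurable_pi_apply j).comp (hc a)).mul
      ((measurable_pi_apply j).comp (measurable_clusterReg ν a))
  obtain ⟨h3, h4⟩ := integrable_and_integral_treat_cov ν hm h1
  -- Averaging over the treatment multiplies by the propensity score, which cancels the inverse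
  -- weight; this is where positivity enters.
  have h5 : ∀ a, (fun x => clusterPropensity ν a x * (c a x ⬝ᵥ clusterReg ν a x))
      =ᵐ[clusterCov ν] fun x => w a x ⬝ᵥ clusterReg ν a x := by
    intro a
    filter_upwards [he a] with x hx
    rw [hcd]
    field_simp
  refine ⟨fun a => (h3 a).congr (h5 a), ?_⟩
  rw [h2, h4]
  exact Finset.sum_congr rfl fun a _ => integral_congr_ae (h5 a)

/-- Double robustness, propensity score correct. -/
theorem integral_clusterAipw_of_propensity {w : Treat m → (Fin d → ℝ) → Fin m → ℝ}
    (hw : ∀ a, Measurable (w a)) (hν : CondIntegrable ν)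
    (hpos : ∀ a, ∀ᵐ x ∂(clusterCov ν), 0 < clusterPropensity ν a x)
    (hi : Integrable
      (fun o : TypeObs m d => (w o.2.1 o.2.2 ⬝ᵥ o.1) / clusterPropensity ν o.2.1 o.2.2) ν)
    {g : Treat m → (Fin d → ℝ) → Fin m → ℝ} (hg : ∀ a, Measurable (g a))
    (hint : Integrable (clusterAipw w (clusterPropensity ν) g) ν) :
    ∫ o, clusterAipw w (clusterPropensity ν) g o ∂ν
      = ∑ a, ∫ x, w a x ⬝ᵥ clusterReg ν a x ∂(clusterCov ν) := by
  rw [← (integrable_and_integral_ipw ν hw hν hpos hi).2, ← sub_eq_zero, ← integral_sub hint hi]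
  -- Subtracting the inverse weighted outcome removes `Y`. What remains depends on `(A, X)` only and
  -- averages to zero over `A` given `X`, whatever `g` is.
  set F : Treat m → (Fin d → ℝ) → ℝ := fun a x =>
    (∑ a', w a' x ⬝ᵥ g a' x) - (w a x ⬝ᵥ g a x) / clusterPropensity ν a x with hF
  have hFeq : ∀ o : TypeObs m d, clusterAipw w (clusterPropensity ν) g o
      - (w o.2.1 o.2.2 ⬝ᵥ o.1) / clusterPropensity ν o.2.1 o.2.2 = F o.2.1 o.2.2 := by
    intro o
    simp only [clusterAipw, hF, dotProduct_sub]
    ring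
  have hd : ∀ a, Measurable (fun x => w a x ⬝ᵥ g a x) := fun a =>
    Finset.measurable_sum _ fun j _ => ((measurable_pi_apply j).comp (hw a)).mul
      ((measurable_pi_apply j).comp (hg a))
  have hFm : ∀ a, Measurable (F a) := fun a =>
    (Finset.measurable_sum _ fun a' _ => hd a').sub
      ((hd a).div (measurable_clusterPropensity ν a))
  have hFi : Integrable (fun o : TypeObs m d => F o.2.1 o.2.2) ν := by
    exact (hint.sub hi).congr (ae_of_all _ hFeq)
  simp_rw [hFeq]
  obtain ⟨h1, h2⟩ := integrable_and_integral_treat_cov ν hFm hFi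
  rw [h2, ← integral_finsetSum _ fun a _ => h1 a]
  refine integral_eq_zero_of_ae ?_
  filter_upwards [ae_all_iff.2 hpos] with x hx
  simp only [hF, mul_sub, Finset.sum_sub_distrib, ← Finset.sum_mul, sum_clusterPropensity,
    one_mul, Pi.zero_apply, sub_eq_zero]
  refine Finset.sum_congr rfl fun a _ => ?_
  have := (hx a).ne'
  field_simp

/-- Double robustness, outcome regression correct. -/
theorem integral_clusterAipw_of_reg {w : Treat m → (Fin d → ℝ) → Fin m → ℝ}
    (hw : ∀ a, Measurable (w a)) (hν : CondIntegrable ν)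
    (hi : ∀ a, Integrable (fun x => w a x ⬝ᵥ clusterReg ν a x) (clusterCov ν))
    {e : Treat m → (Fin d → ℝ) → ℝ} (he : ∀ a, Measurable (e a))
    (hint : Integrable (clusterAipw w e (clusterReg ν)) ν) :
    ∫ o, clusterAipw w e (clusterReg ν) o ∂ν
      = ∑ a, ∫ x, w a x ⬝ᵥ clusterReg ν a x ∂(clusterCov ν) := by
  have hS : Integrable (fun o : TypeObs m d => ∑ a, w a o.2.2 ⬝ᵥ clusterReg ν a o.2.2) ν :=
    integrable_finsetSum _ fun a _ => (hi a).comp_measurable measurable_cov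
  -- For the centring of the residual any weight will do, so `e` need not be positive: where it
  -- vanishes, both `w / e` and `e⁻¹ • w` take the default value zero.
  set c : Treat m → (Fin d → ℝ) → Fin m → ℝ := fun a x => (e a x)⁻¹ • w a x
    with hc_def
  have hc : ∀ a, Measurable (c a) := fun a => (he a).inv.smul (hw a)
  have hcd : ∀ o : TypeObs m d, clusterAipw w e (clusterReg ν) o
      - ∑ a, w a o.2.2 ⬝ᵥ clusterReg ν a o.2.2
        = c o.2.1 o.2.2 ⬝ᵥ (o.1 - clusterReg ν o.2.1 o.2.2) := by
    intro o
    rw [hc_def, smul_dotProduct, smul_eq_mul, ← div_eq_inv_mul, clusterAipw]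
    ring
  have h1 := integral_dot_residual ν hc hν ((hint.sub hS).congr (ae_of_all _ hcd))
  simp_rw [← hcd] at h1
  rw [integral_sub hint hS, sub_eq_zero] at h1
  rw [h1, integral_finsetSum]
  swap
  · exact fun a _ => (hi a).comp_measurable measurable_cov
  refine Finset.sum_congr rfl fun a _ => ?_
  rw [clusterCov, integral_map measurable_cov.aemeasurable (hi a).aestronglyMeasurable]

end ClusterLaw

/-! ### Laws on the disjoint union over cluster types, and conditioning on the type. -/

section SigmaLaws

variable {K : ℕ} {T : Fin K → Type} [∀ k, MeasurableSpace (T k)]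

theorem measurableSet_type (k : Fin K) : MeasurableSet {z : Σ k, T k | z.1 = k} := by
  refine MeasurableSpace.measurableSet_iInf.2 fun j => ?_
  change MeasurableSet {x : T j | j = k}
  exact MeasurableSet.const _

theorem measurableEmbedding_mk (k : Fin K) :
    MeasurableEmbedding (Sigma.mk k : T k → Σ k, T k) where
  injective := sigma_mk_injective
  measurable := measurable_mk_type k
  measurableSet_image' := by
    intro s hs
    refine MeasurableSpace.measurableSet_iInf.2 fun j => ?_
    change MeasurableSet (Sigma.mk j ⁻¹' (Sigma.mk k '' s))
    by_cases h : j = k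
    · subst h
      rwa [Set.preimage_image_eq _ sigma_mk_injective]
    · rw [Set.preimage_image_sigmaMk_of_ne h]
      exact MeasurableSet.empty

omit [∀ k, MeasurableSpace (T k)] in
theorem range_mk_type (k : Fin K) : Set.range (Sigma.mk k : T k → Σ k, T k) = {z | z.1 = k} := by
  ext ⟨j, x⟩
  constructor
  · rintro ⟨y, hy⟩
    exact (congrArg Sigma.fst hy).symm
  · rintro rfl
    exact ⟨x, rfl⟩

variable (P : ProbabilityMeasure (Σ k, T k))

theorem ofReal_typeProb (k : Fin K) :
    ENNReal.ofReal (typeProb P k) = (P : Measure (Σ k, T k)) {z | z.1 = k} := by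
  simp [typeProb, Measure.real]

theorem typeProb_nonneg (k : Fin K) : 0 ≤ typeProb P k := measureReal_nonneg

theorem typeLaw_apply (k : Fin K) (s : Set (T k)) :
    typeLaw P k s = (ENNReal.ofReal (typeProb P k))⁻¹ * (P : Measure (Σ k, T k)) (Sigma.mk k '' s)
    := by
  rw [typeLaw, (measurableEmbedding_mk k).comap_apply, cond_apply (measurableSet_type k),
    ofReal_typeProb]
  congr 2
  refine Set.inter_eq_right.2 ?_
  rw [← range_mk_type]
  exact Set.image_subset_range _ _

/-- The bridge between the joint law and the conditional laws. It needs no positivity: if type `k`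
has probability zero, both sides vanish. -/
theorem restrict_type (k : Fin K) :
    (P : Measure (Σ k, T k)).restrict {z | z.1 = k}
      = ENNReal.ofReal (typeProb P k) • (typeLaw P k).map (Sigma.mk k) := by
  rw [typeLaw, (measurableEmbedding_mk k).map_comap, range_mk_type, ProbabilityTheory.cond,
    Measure.restrict_smul, Measure.restrict_restrict (measurableSet_type k), Set.inter_self,
    ofReal_typeProb, smul_smul]
  by_cases h : (P : Measure (Σ k, T k)) {z | z.1 = k} = 0
  · rw [Measure.restrict_eq_zero.2 h]; simp
  · rw [ENNReal.mul_inv_cancel h (measure_ne_top _ _), one_smul]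

theorem isProbabilityMeasure_typeLaw {k : Fin K} (hk : 0 < typeProb P k) :
    IsProbabilityMeasure (typeLaw P k) := by
  refine ⟨?_⟩
  rw [typeLaw_apply, Set.image_univ, range_mk_type, ← ofReal_typeProb]
  exact ENNReal.inv_mul_cancel (by simpa using hk) (by simp)

theorem ae_of_forall_ae_typeLaw {p : (Σ k, T k) → Prop}
    (h : ∀ k, ∀ᵐ o ∂(typeLaw P k), p ⟨k, o⟩) : ∀ᵐ z ∂(P : Measure (Σ k, T k)), p z := by
  have h1 : ∀ k, ∀ᵐ z ∂((P : Measure (Σ k, T k)).restrict {z | z.1 = k}), p z := by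
    intro k
    rw [restrict_type]
    refine Measure.ae_smul_measure ?_ _
    rw [(measurableEmbedding_mk k).ae_map_iff]
    exact h k
  have h2 : (⋃ k, {z : Σ k, T k | z.1 = k}) = Set.univ := by
    ext z; simp
  rw [← Measure.restrict_univ (μ := (P : Measure (Σ k, T k))), ← h2, ae_restrict_iUnion_iff]
  exact h1

theorem memLp_typeLaw {E : Type*} [NormedAddCommGroup E] {f : (Σ k, T k) → E} {q : ℝ≥0∞}
    (h : MemLp f q (P : Measure (Σ k, T k))) {k : Fin K} (hk : 0 < typeProb P k) :
    MemLp (fun o => f ⟨k, o⟩) q (typeLaw P k) := by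
  have h1 := h.restrict {z | z.1 = k}
  rw [restrict_type] at h1
  have h2 := h1.smul_measure (c := (ENNReal.ofReal (typeProb P k))⁻¹) (by simpa using hk)
  rw [smul_smul, ENNReal.inv_mul_cancel (by simpa using hk) (by simp), one_smul,
    (measurableEmbedding_mk k).memLp_map_measure_iff] at h2
  exact h2

theorem integrable_typeLaw {E : Type*} [NormedAddCommGroup E] {f : (Σ k, T k) → E}
    (h : Integrable f (P : Measure (Σ k, T k))) {k : Fin K} (hk : 0 < typeProb P k) :
    Integrable (fun o => f ⟨k, o⟩) (typeLaw P k) :=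
  memLp_one_iff_integrable.1 (memLp_typeLaw P (memLp_one_iff_integrable.2 h) hk)

theorem integral_type (f : (Σ k, T k) → ℝ) (k : Fin K) :
    ∫ z, (if z.1 = k then f z else 0) ∂(P : Measure (Σ k, T k))
      = typeProb P k * ∫ o, f ⟨k, o⟩ ∂(typeLaw P k) := by
  have h1 : (fun z : Σ k, T k => if z.1 = k then f z else 0) = {z | z.1 = k}.indicator f := by
    ext z; simp [Set.indicator_apply]
  rw [h1, integral_indicator (measurableSet_type k), restrict_type, integral_smul_measure,
    (measurableEmbedding_mk k).integral_map, ENNReal.toReal_ofReal (typeProb_nonneg P k),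
    smul_eq_mul]

/-- A change of density acts type by type; only the normalising constant is affected by the change
of the type probabilities. -/
theorem typeLaw_withDensity (P' : ProbabilityMeasure (Σ k, T k)) {f : (Σ k, T k) → ℝ≥0∞}
    (h : (P' : Measure (Σ k, T k)) = (P : Measure (Σ k, T k)).withDensity f) (k : Fin K) :
    typeLaw P' k = (ENNReal.ofReal (typeProb P' k))⁻¹ • ENNReal.ofReal (typeProb P k) •
      (typeLaw P k).withDensity (fun o => f ⟨k, o⟩) := by
  ext s hs
  rw [typeLaw_apply, h, withDensity_apply _ ((measurableEmbedding_mk k).measurableSet_image.2 hs),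
    Measure.smul_apply, Measure.smul_apply, withDensity_apply _ hs, smul_eq_mul, smul_eq_mul]
  congr 1
  have h2 : Sigma.mk k '' s ⊆ {z : Σ k, T k | z.1 = k} := by
    rw [← range_mk_type]
    exact Set.image_subset_range _ _
  rw [← Set.inter_eq_left.2 h2,
    ← Measure.restrict_restrict ((measurableEmbedding_mk k).measurableSet_image.2 hs),
    restrict_type, Measure.restrict_smul, lintegral_smul_measure,
    (measurableEmbedding_mk k).restrict_map, (measurableEmbedding_mk k).lintegral_map,
    Set.preimage_image_eq _ sigma_mk_injective, smul_eq_mul]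

end SigmaLaws

/-! ### Consistency commutes with conditioning on the cluster type. -/

section ObservedLaw

variable {K : ℕ} {M d : Fin K → ℕ} (Q : ProbabilityMeasure (Full M d))

/-- Consistency within a cluster type. -/
def observeType {m d : ℕ} (u : TypeFull m d) : TypeObs m d := (u.1 u.2.1, u.2.1, u.2.2)

theorem measurable_observeType {m d : ℕ} :
    Measurable (observeType : TypeFull m d → TypeObs m d) := by
  have h2 : Measurable (fun p : (Treat m → Fin m → ℝ) × Treat m => p.1 p.2) :=
    measurable_from_prod_countable_left fun a => measurable_pi_apply a
  exact (h2.comp (measurable_fst.prodMk (measurable_fst.comp measurable_snd))).prodMk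
    measurable_snd

theorem typeProb_observedLaw (k : Fin K) : typeProb (observedLaw Q) k = typeProb Q k := by
  simp only [typeProb, observedLaw, ProbabilityMeasure.toMeasure_map]
  rw [map_measureReal_apply measurable_observe (measurableSet_type k)]
  rfl

theorem typeLaw_observedLaw (k : Fin K) :
    typeLaw (observedLaw Q) k = (typeLaw Q k).map observeType := by
  ext s hs
  rw [Measure.map_apply measurable_observeType hs, typeLaw_apply, typeLaw_apply,
    typeProb_observedLaw]
  congr 1
  simp only [observedLaw, ProbabilityMeasure.toMeasure_map]
  rw [Measure.map_apply measurable_observe ((measurableEmbedding_mk k).measurableSet_image.2 hs)]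
  congr 1
  ext ⟨j, u⟩
  constructor
  · rintro ⟨o, ho, h⟩
    obtain rfl : k = j := congrArg Sigma.fst h
    refine ⟨u, ?_, rfl⟩
    have := sigma_mk_injective h
    subst this
    exact ho
  · rintro ⟨o, ho, h⟩
    obtain rfl : k = j := congrArg Sigma.fst h
    have := sigma_mk_injective h
    subst this
    exact ⟨_, ho, rfl⟩

end ObservedLaw

/-! ### Identification of means of potential outcomes from observed data. -/

section Identification

variable {m d : ℕ}

theorem ae_map_treat_cov (ν : Measure (TypeObs m d)) {p : Treat m → (Fin d → ℝ) → Prop}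
    (h : ∀ a, ∀ᵐ x ∂(clusterCov ν), p a x) : ∀ᵐ q ∂(ν.map (fun o => o.2)), p q.1 q.2 := by
  -- The predicate need not be measurable, so the exceptional sets are enlarged to measurable null
  -- sets, one for each of the finitely many treatments.
  choose N hN hNm hN0 using fun a => exists_measurable_superset_of_null (ae_iff.1 (h a))
  have hm : MeasurableSet {q : Treat m × (Fin d → ℝ) | q.2 ∈ N q.1} := by
    have h1 : {q : Treat m × (Fin d → ℝ) | q.2 ∈ N q.1} = ⋃ a, ({a} : Set (Treat m)) ×ˢ N a := by
      ext q; simp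
    rw [h1]
    exact MeasurableSet.iUnion fun a => (measurableSet_singleton a).prod (hNm a)
  have h2 : ∀ᵐ q ∂(ν.map (fun o : TypeObs m d => o.2)), q.2 ∉ N q.1 := by
    refine (ae_map_iff measurable_snd.aemeasurable hm.compl).2 ?_
    have h3 : ∀ᵐ o ∂ν, ∀ a, o.2.2 ∉ N a := ae_treat_cov (p := fun a x => x ∉ N a) ν fun a => by
      rw [ae_iff]; simpa using hN0 a
    filter_upwards [h3] with o ho
    exact ho _
  filter_upwards [h2] with q hq
  by_contra hcon
  exact hq (hN _ hcon)

theorem condIntegrable_of_memLp (ν : Measure (TypeObs m d)) [IsFiniteMeasure ν]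
    (h : ∀ a, ∀ᵐ x ∂(clusterCov ν), MemLp id 2 (clusterOutcome ν a x)) : CondIntegrable ν := by
  filter_upwards [ae_map_treat_cov ν h] with q hq j
  have h1 : Integrable id (clusterOutcome ν q.1 q.2) := hq.integrable (by norm_num)
  exact (ContinuousLinearMap.proj (R := ℝ) (φ := fun _ : Fin m => ℝ) j).integrable_comp h1

/-- The moment conditions concern conditional moments as functions of `X`. They give integrability
of `Y_j` because the conditional mean of `|Y_j|` is at most `|g_j| + 1 + Σ_jj`. -/
theorem integrable_outcome_of_moments (ν : Measure (TypeObs m d)) [IsFiniteMeasure ν]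
    (h2 : ∀ a, ∀ᵐ x ∂(clusterCov ν), MemLp id 2 (clusterOutcome ν a x))
    (hreg : ∀ a, Integrable (clusterReg ν a) (clusterCov ν))
    (hcov : ∀ a j, Integrable (fun x => ∫ y, (y j - clusterReg ν a x j) * (y j - clusterReg ν a x j)
      ∂(clusterOutcome ν a x)) (clusterCov ν)) (j : Fin m) :
    Integrable (fun o : TypeObs m d => o.1 j) ν := by
  have hf : AEStronglyMeasurable (fun p : (Treat m × (Fin d → ℝ)) × (Fin m → ℝ) => p.2 j)
      (ν.map fun o => (o.2, o.1)) := by fun_prop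
  have key := hf.ae_integrable_condDistrib_map_iff (X := fun o : TypeObs m d => o.2)
    (Y := fun o : TypeObs m d => o.1) (μ := ν) measurable_fst.aemeasurable
  have goal : Integrable (fun p : (Treat m × (Fin d → ℝ)) × (Fin m → ℝ) => p.2 j)
      (ν.map fun o => (o.2, o.1)) := by
    refine key.1 ⟨?_, ?_⟩
    · filter_upwards [condIntegrable_of_memLp ν h2] with q hq
      exact hq j
    · have hm : StronglyMeasurable (fun q : Treat m × (Fin d → ℝ) =>
          ∫ y, ‖y j‖ ∂(condDistrib (fun o : TypeObs m d => o.1) (fun o => o.2) ν q)) :=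
        StronglyMeasurable.integral_condDistrib
          (f := fun p : (Treat m × (Fin d → ℝ)) × (Fin m → ℝ) => ‖p.2 j‖)
          (by fun_prop : Measurable _).stronglyMeasurable
      rw [integrable_map_measure hm.aestronglyMeasurable (by fun_prop)]
      set B : Treat m → (Fin d → ℝ) → ℝ := fun a x => ‖clusterReg ν a x j‖ + 1
        + ∫ y, (y j - clusterReg ν a x j) * (y j - clusterReg ν a x j) ∂(clusterOutcome ν a x)
        with hB
      have hBi : ∀ a, Integrable (B a) (clusterCov ν) := fun a =>
        ((((ContinuousLinearMap.proj (R := ℝ) (φ := fun _ : Fin m => ℝ) j).integrable_comp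
          (hreg a)).norm).add (integrable_const _)).add (hcov a j)
      have hB0 : ∀ a x, 0 ≤ B a x := fun a x =>
        add_nonneg (add_nonneg (norm_nonneg _) zero_le_one)
          (integral_nonneg fun y => mul_self_nonneg _)
      have hsum : Integrable (fun o : TypeObs m d => ∑ a, B a o.2.2) ν :=
        integrable_finsetSum _ fun a _ => (hBi a).comp_measurable measurable_cov
      refine hsum.mono' (hm.comp_measurable measurable_snd).aestronglyMeasurable ?_
      filter_upwards [ae_treat_cov ν h2] with o ho
      have ho' := ho o.2.1
      -- The bound for the treatment received is enlarged to the sum over all treatments, which is a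
      -- function of `X` alone and hence integrable without inverse weighting.
      refine le_trans ?_ (Finset.single_le_sum (fun a _ => hB0 a o.2.2) (Finset.mem_univ o.2.1))
      have hY : MemLp (fun y : Fin m → ℝ => y j) 2 (clusterOutcome ν o.2.1 o.2.2) :=
        (ContinuousLinearMap.proj (R := ℝ) (φ := fun _ : Fin m => ℝ) j).comp_memLp' ho'
      set c := clusterReg ν o.2.1 o.2.2 j
      have hYc : MemLp (fun y : Fin m → ℝ => y j - c) 2 (clusterOutcome ν o.2.1 o.2.2) :=
        hY.sub (memLp_const c)
      have hsq : Integrable (fun y : Fin m → ℝ => (y j - c) * (y j - c))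
          (clusterOutcome ν o.2.1 o.2.2) := by
        simpa only [← sq] using hYc.integrable_sq
      rw [Function.comp_apply, Real.norm_of_nonneg (integral_nonneg fun y => norm_nonneg _)]
      calc ∫ y, ‖y j‖ ∂(clusterOutcome ν o.2.1 o.2.2)
          ≤ ∫ y, ((‖c‖ + 1) + (y j - c) * (y j - c)) ∂(clusterOutcome ν o.2.1 o.2.2) := by
            refine integral_mono (hY.integrable (by norm_num)).norm
              ((integrable_const _).add hsq) fun y => ?_
            have h1 : ‖y j‖ ≤ ‖c‖ + ‖y j - c‖ := by
              have := norm_add_le c (y j - c)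
              simpa using this
            have h3 : ‖y j - c‖ * ‖y j - c‖ = (y j - c) * (y j - c) := by
              rw [Real.norm_eq_abs, abs_mul_abs_self]
            change ‖y j‖ ≤ (‖c‖ + 1) + (y j - c) * (y j - c)
            nlinarith [sq_nonneg (‖y j - c‖ - 1), norm_nonneg (y j - c)]
        _ = B o.2.1 o.2.2 := by
            rw [integral_add (integrable_const _) hsq, integral_const]
            simp [hB, c]
  rw [integrable_map_measure hf (by fun_prop)] at goal
  exact goal

theorem measurable_full_cov : Measurable (fun u : TypeFull m d => u.2.2) :=
  measurable_snd.comp measurable_snd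

theorem measurable_full_treat : Measurable (fun u : TypeFull m d => u.2.1) :=
  measurable_fst.comp measurable_snd

theorem measurable_potential (a : Treat m) : Measurable (fun u : TypeFull m d => u.1 a) :=
  (measurable_pi_apply a).comp measurable_fst

theorem clusterCov_map_observeType (ν : Measure (TypeFull m d)) :
    clusterCov (ν.map observeType) = ν.map (fun u => u.2.2) := by
  rw [clusterCov, Measure.map_map measurable_cov measurable_observeType]
  rfl

variable (ν : Measure (TypeFull m d)) [IsFiniteMeasure ν]

/-- Ignorability as an identity between measures. It suffices to test rectangles, where conditional
independence makes the probability of `A = a` factor out given `X`. -/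
theorem map_potential_restrict_treat (a : Treat m)
    (hind : CondIndepFun (MeasurableSpace.comap (fun u : TypeFull m d => u.2.2) inferInstance)
      (measurable_snd.comp measurable_snd).comap_le (fun u => u.1 a) (fun u => u.2.1) ν) :
    (ν.restrict {u | u.2.1 = a}).map (fun u => (u.2.2, u.1 a))
      = (ν.map (fun u => (u.2.2, u.1 a))).withDensity
        (fun p => ENNReal.ofReal (clusterPropensity (ν.map observeType) a p.1)) := by
  have hXY : Measurable (fun u : TypeFull m d => (u.2.2, u.1 a)) :=
    measurable_full_cov.prodMk (measurable_potential a)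
  have hfin : IsFiniteMeasure ((ν.map (fun u : TypeFull m d => (u.2.2, u.1 a))).withDensity
        (fun p => ENNReal.ofReal (clusterPropensity (ν.map observeType) a p.1))) := by
    refine isFiniteMeasure_withDensity ?_
    refine ne_of_lt (lt_of_le_of_lt (lintegral_mono (g := fun _ => 1) fun p => ?_) ?_)
    · exact ENNReal.ofReal_le_one.2 (clusterPropensity_le_one _ _ _)
    · simp [measure_lt_top]
  have hA : MeasurableSet {u : TypeFull m d | u.2.1 = a} :=
    measurable_full_treat (measurableSet_singleton a)
  have hem : Measurable (fun p : (Fin d → ℝ) × (Fin m → ℝ) =>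
      ENNReal.ofReal (clusterPropensity (ν.map observeType) a p.1)) :=
    ((measurable_clusterPropensity _ a).comp measurable_fst).ennreal_ofReal
  have h1 := (condIndepFun_iff_map_prod_eq_prod_condDistrib_prod_condDistrib (μ := ν)
    (measurable_potential a) measurable_full_treat measurable_full_cov).1 hind
  -- Consistency leaves `(A, X)` unchanged, so the propensity score of the observed law is that of
  -- the full law.
  have h2 : ∀ᵐ x ∂(ν.map (fun u : TypeFull m d => u.2.2)),
      ENNReal.ofReal (clusterPropensity (ν.map observeType) a x)
        = condDistrib (fun u : TypeFull m d => u.2.1) (fun u => u.2.2) ν x {a} := by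
    have := condDistrib_map (ν := ν) (f := observeType) (X := fun o : TypeObs m d => o.2.2)
      (Y := fun o : TypeObs m d => o.2.1) measurable_cov.aemeasurable
      measurable_treat.aemeasurable measurable_observeType.aemeasurable
    filter_upwards [this] with x hx
    rw [clusterPropensity, hx, ofReal_measureReal]
    rfl
  refine Measure.ext_prod fun {s t} hs ht => ?_
  have h3 : ν.map (fun u : TypeFull m d => (u.2.2, u.1 a, u.2.1)) (s ×ˢ t ×ˢ {a})
      = ν ((fun u : TypeFull m d => (u.2.2, u.1 a)) ⁻¹' (s ×ˢ t) ∩ {u | u.2.1 = a}) := by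
    rw [Measure.map_apply
      (measurable_full_cov.prodMk ((measurable_potential a).prodMk measurable_full_treat))
      (hs.prod (ht.prod (measurableSet_singleton a)))]
    congr 1
    ext u
    simp [and_assoc]
  rw [Measure.map_apply hXY (hs.prod ht), Measure.restrict_apply (hXY (hs.prod ht)), ← h3, h1,
    Measure.bind_apply (hs.prod (ht.prod (measurableSet_singleton a))) (by fun_prop),
    withDensity_apply _ (hs.prod ht),
    ← compProd_map_condDistrib (measurable_potential a).aemeasurable,
    Measure.setLIntegral_compProd hem hs ht, ← lintegral_indicator hs]
  refine lintegral_congr_ae ?_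
  filter_upwards [h2] with x hx
  rw [Kernel.prod_apply_prod, Kernel.prod_apply_prod, Kernel.id_apply, Measure.dirac_apply' _ hs]
  by_cases hxs : x ∈ s
  · simp [hxs, hx, mul_comm]
  · simp [hxs]

/-- The density `e(a | X)` that restriction to `A = a` introduces is cancelled by the inverse
weight. -/
theorem integral_potential_eq_ipw (a : Treat m)
    (hind : CondIndepFun (MeasurableSpace.comap (fun u : TypeFull m d => u.2.2) inferInstance)
      (measurable_snd.comp measurable_snd).comap_le (fun u => u.1 a) (fun u => u.2.1) ν)
    (hpos : ∀ᵐ x ∂(clusterCov (ν.map observeType)), 0 < clusterPropensity (ν.map observeType) a x)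
    {f : (Fin d → ℝ) × (Fin m → ℝ) → ℝ} (hf : Measurable f)
    (hi : Integrable (fun u : TypeFull m d => f (u.2.2, u.1 a)) ν) :
    Integrable (fun u : TypeFull m d => if u.2.1 = a then
        f (u.2.2, u.1 a) / clusterPropensity (ν.map observeType) a u.2.2 else 0) ν ∧
      ∫ u, (if u.2.1 = a then
        f (u.2.2, u.1 a) / clusterPropensity (ν.map observeType) a u.2.2 else 0) ∂ν
        = ∫ u, f (u.2.2, u.1 a) ∂ν := by
  have hXY : Measurable (fun u : TypeFull m d => (u.2.2, u.1 a)) :=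
    measurable_full_cov.prodMk (measurable_potential a)
  have hA : MeasurableSet {u : TypeFull m d | u.2.1 = a} :=
    measurable_full_treat (measurableSet_singleton a)
  have he : Measurable (fun p : (Fin d → ℝ) × (Fin m → ℝ) =>
      clusterPropensity (ν.map observeType) a p.1) :=
    (measurable_clusterPropensity _ a).comp measurable_fst
  set h : (Fin d → ℝ) × (Fin m → ℝ) → ℝ := fun p =>
    f p / clusterPropensity (ν.map observeType) a p.1 with hh
  have hhm : Measurable h := hf.div he
  have h1 : (fun u : TypeFull m d => if u.2.1 = a then
        f (u.2.2, u.1 a) / clusterPropensity (ν.map observeType) a u.2.2 else 0)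
      = {u : TypeFull m d | u.2.1 = a}.indicator (fun u => h (u.2.2, u.1 a)) := by
    ext u; simp [Set.indicator_apply, hh]
  have h0 : ∀ᵐ p ∂(ν.map (fun u : TypeFull m d => (u.2.2, u.1 a))),
      (ENNReal.ofReal (clusterPropensity (ν.map observeType) a p.1)).toReal * h p = f p := by
    rw [clusterCov_map_observeType] at hpos
    have h3 : ∀ᵐ u ∂ν, 0 < clusterPropensity (ν.map observeType) a u.2.2 :=
      ae_of_ae_map measurable_full_cov.aemeasurable hpos
    rw [ae_map_iff hXY.aemeasurable]
    · filter_upwards [h3] with u hu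
      rw [ENNReal.toReal_ofReal hu.le, hh]
      field_simp
    · exact measurableSet_eq_fun (he.ennreal_ofReal.ennreal_toReal.mul hhm) hf
  rw [h1, integrable_indicator_iff hA, integral_indicator hA, IntegrableOn]
  have h4 : (fun u : TypeFull m d => h (u.2.2, u.1 a)) = h ∘ (fun u => (u.2.2, u.1 a)) := rfl
  have h5 : (fun u : TypeFull m d => f (u.2.2, u.1 a)) = f ∘ (fun u => (u.2.2, u.1 a)) := rfl
  rw [h5, ← integrable_map_measure hf.aestronglyMeasurable hXY.aemeasurable] at hi
  constructor
  · rw [h4, ← integrable_map_measure hhm.aestronglyMeasurable hXY.aemeasurable,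
      map_potential_restrict_treat ν a hind, integrable_withDensity_iff he.ennreal_ofReal (by simp)]
    refine hi.congr ?_
    filter_upwards [h0] with p hp
    rw [← hp, mul_comm]
  · rw [← integral_map (f := h) hXY.aemeasurable hhm.aestronglyMeasurable,
      map_potential_restrict_treat ν a hind,
      integral_withDensity_eq_integral_toReal_smul he.ennreal_ofReal (by simp),
      ← integral_map (f := f) hXY.aemeasurable hf.aestronglyMeasurable]
    exact integral_congr_ae h0

theorem integrable_and_integral_ipw_potential {w : Treat m → (Fin d → ℝ) → Fin m → ℝ}
    (hw : ∀ a, Measurable (w a))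
    (hind : ∀ a, CondIndepFun
      (MeasurableSpace.comap (fun u : TypeFull m d => u.2.2) inferInstance)
      (measurable_snd.comp measurable_snd).comap_le (fun u => u.1 a) (fun u => u.2.1) ν)
    (hpos : ∀ a, ∀ᵐ x ∂(clusterCov (ν.map observeType)),
      0 < clusterPropensity (ν.map observeType) a x)
    (hi : ∀ a, Integrable (fun u : TypeFull m d => w a u.2.2 ⬝ᵥ u.1 a) ν) :
    Integrable (fun o : TypeObs m d => (w o.2.1 o.2.2 ⬝ᵥ o.1)
        / clusterPropensity (ν.map observeType) o.2.1 o.2.2) (ν.map observeType) ∧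
      ∫ o, (w o.2.1 o.2.2 ⬝ᵥ o.1) / clusterPropensity (ν.map observeType) o.2.1 o.2.2
        ∂(ν.map observeType) = ∑ a, ∫ u, w a u.2.2 ⬝ᵥ u.1 a ∂ν := by
  have hm : Measurable (fun o : TypeObs m d => (w o.2.1 o.2.2 ⬝ᵥ o.1)
        / clusterPropensity (ν.map observeType) o.2.1 o.2.2) :=
    ((measurable_dot hw).comp (measurable_snd.prodMk measurable_fst)).div
      ((measurable_uncurry_treat (measurable_clusterPropensity _)).comp measurable_snd)
  have hfm : ∀ a, Measurable (fun p : (Fin d → ℝ) × (Fin m → ℝ) => w a p.1 ⬝ᵥ p.2) := fun a =>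
    Finset.measurable_sum _ fun j _ => ((measurable_pi_apply j).comp
      ((hw a).comp measurable_fst)).mul ((measurable_pi_apply j).comp measurable_snd)
  have h := fun a => integral_potential_eq_ipw ν a (hind a) (hpos a) (hfm a) (hi a)
  -- Consistency: of the sum over `a` only the treatment received survives, and there the potential
  -- outcome is the observed one.
  have heq : ((fun o : TypeObs m d => (w o.2.1 o.2.2 ⬝ᵥ o.1)
        / clusterPropensity (ν.map observeType) o.2.1 o.2.2) ∘ observeType)
      = fun u => ∑ a, (if u.2.1 = a then (w a u.2.2 ⬝ᵥ u.1 a) /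
        clusterPropensity (ν.map observeType) a u.2.2 else 0) := by
    ext u
    simp [observeType]
  rw [integrable_map_measure hm.aestronglyMeasurable measurable_observeType.aemeasurable,
    integral_map measurable_observeType.aemeasurable hm.aestronglyMeasurable]
  have h6 := congrArg (fun F => ∫ u, F u ∂ν) heq
  simp only [Function.comp_apply] at h6
  rw [heq, h6]
  refine ⟨integrable_finsetSum _ fun a _ => (h a).1, ?_⟩
  rw [integral_finsetSum _ fun a _ => (h a).1]
  exact Finset.sum_congr rfl fun a _ => (h a).2

end Identification

/-! ### Identification and unbiased estimating functions under the causal assumptions. -/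

section CausalLaw

variable {K de dg : ℕ} {M d : Fin K → ℕ} {Q : ProbabilityMeasure (Full M d)}

theorem propensity_pos (hQ : CausalAssumptions Q) (k : Fin K) (a : Treat (M k)) :
    ∀ᵐ x ∂(covLaw (observedLaw Q) k), 0 < propensity (observedLaw Q) k a x := by
  obtain ⟨c, hc, h⟩ := hQ.overlap
  filter_upwards [h k a] with x hx
  exact hc.trans hx.1

theorem condIndepFun_typeLaw (hQ : CausalAssumptions Q) (k : Fin K) (a : Treat (M k)) :
    CondIndepFun (MeasurableSpace.comap (fun u : TypeFull (M k) (d k) => u.2.2) inferInstance)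
      (measurable_snd.comp measurable_snd).comap_le (fun u => u.1 a) (fun u => u.2.1)
      (typeLaw Q k) := hQ.ignorability k a

theorem condIntegrable_typeLaw (hQ : CausalAssumptions Q) (k : Fin K) :
    CondIntegrable (typeLaw (observedLaw Q) k) :=
  condIntegrable_of_memLp _ (hQ.moments k)

theorem integrable_outcome (hQ : CausalAssumptions Q) (k : Fin K) (j : Fin (M k)) :
    Integrable (fun o : TypeObs (M k) (d k) => o.1 j) (typeLaw (observedLaw Q) k) :=
  integrable_outcome_of_moments _ (hQ.moments k) (hQ.integrable_reg k)
    (fun a j => hQ.integrable_cov k a j j) j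

variable {w : Weights M d} (hw : ∀ k a, Measurable (w k a))
  (hθ : ∀ k a, Integrable (fun u : TypeFull (M k) (d k) => w k a u.2.2 ⬝ᵥ u.1 a) (typeLaw Q k))

include hw hθ

theorem integrable_and_integral_ipw_typeLaw (hQ : CausalAssumptions Q) (k : Fin K) :
    Integrable (fun o : TypeObs (M k) (d k) => (w k o.2.1 o.2.2 ⬝ᵥ o.1)
        / clusterPropensity (typeLaw (observedLaw Q) k) o.2.1 o.2.2) (typeLaw (observedLaw Q) k) ∧
      ∫ o : TypeObs (M k) (d k), (w k o.2.1 o.2.2 ⬝ᵥ o.1)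
        / clusterPropensity (typeLaw (observedLaw Q) k) o.2.1 o.2.2
        ∂(typeLaw (observedLaw Q) k) = causalTheta w Q k := by
  have hpos := propensity_pos hQ k
  have h := integrable_and_integral_ipw_potential (typeLaw Q k) (hw k) (condIndepFun_typeLaw hQ k)
  simp only [← typeLaw_observedLaw] at h
  exact h hpos (hθ k)

/-- The inverse weighted mean is the hinge: ignorability equates it with the causal parameter, the
tower property with the regression functional. The integrability of the regression terms comes along
the same way. -/
theorem integrable_reg_and_sum_integral (hQ : CausalAssumptions Q) (k : Fin K) :
    (∀ a, Integrable (fun x => w k a x ⬝ᵥ outcomeReg (observedLaw Q) k a x)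
      (covLaw (observedLaw Q) k)) ∧
    ∑ a : Treat (M k), ∫ x, w k a x ⬝ᵥ outcomeReg (observedLaw Q) k a x
      ∂(covLaw (observedLaw Q) k) = causalTheta w Q k := by
  obtain ⟨h1, h2⟩ := integrable_and_integral_ipw_typeLaw hw hθ hQ k
  have h3 := integrable_and_integral_ipw _ (hw k) (condIntegrable_typeLaw hQ k)
    (propensity_pos hQ k) h1
  exact ⟨h3.1, h3.2.symm.trans h2⟩

theorem tauFunctional_eq_causalTau (hQ : CausalAssumptions Q) (v : Fin K → ℝ → ℝ) :
    tauFunctional w v (observedLaw Q) = causalTau w v Q := by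
  unfold tauFunctional causalTau
  refine Finset.sum_congr rfl fun k _ => ?_
  rw [(integrable_reg_and_sum_integral hw hθ hQ k).2, typeProb_observedLaw]

theorem integral_clusterAipw_of_ae_eq_propensity (hQ : CausalAssumptions Q) (k : Fin K)
    {e : Treat (M k) → (Fin (d k) → ℝ) → ℝ} {g : Treat (M k) → (Fin (d k) → ℝ) → Fin (M k) → ℝ}
    (hg : ∀ a, Measurable (g a))
    (he : ∀ a, ∀ᵐ x ∂(covLaw (observedLaw Q) k), propensity (observedLaw Q) k a x = e a x)
    (hi : Integrable (clusterAipw (w k) e g) (typeLaw (observedLaw Q) k)) :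
    ∫ o, clusterAipw (w k) e g o ∂(typeLaw (observedLaw Q) k) = causalTheta w Q k := by
  have h := clusterAipw_congr (typeLaw (observedLaw Q) k) (w := w k)
    (e := clusterPropensity (typeLaw (observedLaw Q) k)) (e' := e) (g := g) (g' := g) he
    fun a => ae_of_all _ fun _ => rfl
  rw [← integral_congr_ae h, integral_clusterAipw_of_propensity _ (hw k)
    (condIntegrable_typeLaw hQ k) (propensity_pos hQ k)
    (integrable_and_integral_ipw_typeLaw hw hθ hQ k).1 hg (hi.congr h.symm)]
  exact (integrable_reg_and_sum_integral hw hθ hQ k).2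

theorem integral_clusterAipw_of_ae_eq_reg (hQ : CausalAssumptions Q) (k : Fin K)
    {e : Treat (M k) → (Fin (d k) → ℝ) → ℝ} {g : Treat (M k) → (Fin (d k) → ℝ) → Fin (M k) → ℝ}
    (he : ∀ a, Measurable (e a))
    (hg : ∀ a, ∀ᵐ x ∂(covLaw (observedLaw Q) k), outcomeReg (observedLaw Q) k a x = g a x)
    (hi : Integrable (clusterAipw (w k) e g) (typeLaw (observedLaw Q) k)) :
    ∫ o, clusterAipw (w k) e g o ∂(typeLaw (observedLaw Q) k) = causalTheta w Q k := by
  have h := clusterAipw_congr (typeLaw (observedLaw Q) k) (w := w k)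
    (e := e) (e' := e) (g := clusterReg (typeLaw (observedLaw Q) k)) (g' := g)
    (fun a => ae_of_all _ fun _ => rfl) hg
  rw [← integral_congr_ae h, integral_clusterAipw_of_reg _ (hw k)
    (condIntegrable_typeLaw hQ k) (integrable_reg_and_sum_integral hw hθ hQ k).1 he
    (hi.congr h.symm)]
  exact (integrable_reg_and_sum_integral hw hθ hQ k).2

variable {m : WorkingModel M d de dg}

/-- The estimating function of `θ` is unbiased at the causal parameter if one of the two working
models is correct. -/
theorem integral_psiTheta (hQ : CausalAssumptions Q) (hp : ∀ k, 0 < typeProb (observedLaw Q) k)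
    (θ : Fin K → ℝ) (β : Beta de dg) (k : Fin K)
    (hβ : IsTrueE (observedLaw Q) m β.1 ∨ IsTrueG (observedLaw Q) m β.2)
    (hi : Integrable (fun z => psiTheta w m z (θ, β) k)
      (observedLaw Q : Measure (Obs M d))) :
    ∫ z, psiTheta w m z (θ, β) k ∂(observedLaw Q : Measure (Obs M d))
      = typeProb (observedLaw Q) k * (causalTheta w Q k - θ k) := by
  have := isProbabilityMeasure_typeLaw (observedLaw Q) (hp k)
  have h1 := integrable_typeLaw (observedLaw Q) hi (hp k)
  have h2 : ∀ o, psiTheta w m ⟨k, o⟩ (θ, β) k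
      = clusterAipw (w k) (m.e β.1 k) (m.g β.2 k) o - θ k := by
    intro o; simp [psiTheta, clusterAipw, aipw]
  simp_rw [h2] at h1
  have h3 : Integrable (clusterAipw (w k) (m.e β.1 k) (m.g β.2 k)) (typeLaw (observedLaw Q) k) := by
    exact (h1.add (integrable_const (θ k))).congr (ae_of_all _ fun o => by simp)
  have h4 : ∫ o, clusterAipw (w k) (m.e β.1 k) (m.g β.2 k) o ∂(typeLaw (observedLaw Q) k)
      = causalTheta w Q k := by
    rcases hβ with hβ | hβ
    · exact integral_clusterAipw_of_ae_eq_propensity hw hθ hQ k (m.measurable_g _ k) (hβ.2 k) h3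
    · exact integral_clusterAipw_of_ae_eq_reg hw hθ hQ k (m.measurable_e _ k) (hβ.2 k) h3
  have h5 := integral_type (observedLaw Q)
    (fun z => aipw w (m.e β.1) (m.g β.2) z - θ k) k
  have h6 : ∀ o : TypeObs (M k) (d k), aipw w (m.e β.1) (m.g β.2) ⟨k, o⟩
    = clusterAipw (w k) (m.e β.1 k) (m.g β.2 k) o := fun o => rfl
  simp only [h6] at h5
  rw [integral_sub h3 (integrable_const _), h4, integral_const] at h5
  simp only [probReal_univ, one_smul] at h5
  exact h5

end CausalLaw

/-! ### Calculus of `O_P(1)` and `o_P(1)`. -/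

section StochasticOrder

variable {Ω : Type*} [MeasurableSpace Ω] {μ : Measure Ω}
variable {E F : Type*} [NormedAddCommGroup E] [NormedAddCommGroup F]

/-- `X_N = O_P(1)`. -/
def BddInProb (μ : Measure Ω) (X : ℕ → Ω → E) : Prop :=
  ∀ ε : ℝ≥0∞, 0 < ε → ∃ C : ℝ, ∀ᶠ N in atTop, μ {ω | C < ‖X N ω‖} ≤ ε

/-- `X_N = o_P(1)`. -/
def NegligibleInProb (μ : Measure Ω) (X : ℕ → Ω → E) : Prop :=
  ∀ ε : ℝ, 0 < ε → Tendsto (fun N => μ {ω | ε ≤ ‖X N ω‖}) atTop (𝓝 0)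

theorem negligibleInProb_iff {X : ℕ → Ω → E} {c : E} :
    NegligibleInProb μ (fun N ω => X N ω - c) ↔ TendstoInMeasure μ X atTop (fun _ => c) :=
  tendstoInMeasure_iff_norm.symm

theorem negligibleInProb_iff_zero {X : ℕ → Ω → E} :
    NegligibleInProb μ X ↔ TendstoInMeasure μ X atTop (fun _ => 0) := by
  rw [← negligibleInProb_iff]; simp

/-- The comparison may fail on events of vanishing probability. This is how equations that hold only
with probability tending to one are used. -/
theorem NegligibleInProb.of_le {X : ℕ → Ω → E} {Y : ℕ → Ω → F} (hY : NegligibleInProb μ Y)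
    (h : Tendsto (fun N => μ {ω | ¬ ‖X N ω‖ ≤ ‖Y N ω‖}) atTop (𝓝 0)) :
    NegligibleInProb μ X := by
  intro ε hε
  have h1 := h.add (hY ε hε)
  rw [add_zero] at h1
  refine tendsto_of_tendsto_of_tendsto_of_le_of_le tendsto_const_nhds h1 (fun _ => zero_le)
    fun N => ?_
  refine (measure_mono fun ω hω => ?_).trans (measure_union_le _ _)
  by_cases h2 : ‖X N ω‖ ≤ ‖Y N ω‖
  · exact Or.inr (le_trans hω h2)
  · exact Or.inl h2

theorem NegligibleInProb.of_forall_le {X : ℕ → Ω → E} {Y : ℕ → Ω → F} (hY : NegligibleInProb μ Y)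
    (h : ∀ N ω, ‖X N ω‖ ≤ ‖Y N ω‖) : NegligibleInProb μ X :=
  hY.of_le (by simp [h])

theorem NegligibleInProb.add {X Y : ℕ → Ω → E} (hX : NegligibleInProb μ X)
    (hY : NegligibleInProb μ Y) : NegligibleInProb μ (fun N ω => X N ω + Y N ω) := by
  intro ε hε
  have h1 := (hX (ε / 2) (half_pos hε)).add (hY (ε / 2) (half_pos hε))
  rw [add_zero] at h1
  refine tendsto_of_tendsto_of_tendsto_of_le_of_le tendsto_const_nhds h1 (fun _ => zero_le)
    fun N => ?_
  refine (measure_mono fun ω hω => ?_).trans (measure_union_le _ _)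
  by_contra hcon
  simp only [Set.mem_union, Set.mem_ofPred_eq, not_or, not_le] at hcon hω
  linarith [norm_add_le (X N ω) (Y N ω), hcon.1, hcon.2]

theorem NegligibleInProb.sum {ι : Type*} (s : Finset ι) {X : ι → ℕ → Ω → E}
    (hX : ∀ i ∈ s, NegligibleInProb μ (X i)) :
    NegligibleInProb μ (fun N ω => ∑ i ∈ s, X i N ω) := by
  classical
  induction s using Finset.induction_on with
  | empty =>
    intro ε hε
    simp [hε.not_ge]
  | insert i s hi ih =>
    simp only [Finset.sum_insert hi]
    exact (hX i (by simp)).add (ih fun j hj => hX j (by simp [hj]))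

theorem NegligibleInProb.mul {X : ℕ → Ω → E} {Y : ℕ → Ω → F} (hX : NegligibleInProb μ X)
    (hY : BddInProb μ Y) : NegligibleInProb μ (fun N ω => ‖X N ω‖ * ‖Y N ω‖) := by
  intro ε hε
  refine ENNReal.tendsto_nhds_zero.2 fun δ hδ => ?_
  obtain ⟨C, hC⟩ := hY (δ / 2) (ENNReal.half_pos hδ.ne')
  -- The constant of `BddInProb` may be zero or negative, hence `|C| + 1` as a divisor.
  have hC' : 0 < |C| + 1 := by positivity
  filter_upwards [hC, ENNReal.tendsto_nhds_zero.1 (hX (ε / (|C| + 1)) (by positivity)) (δ / 2)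
    (ENNReal.half_pos hδ.ne')] with N h1 h2
  calc μ {ω | ε ≤ ‖‖X N ω‖ * ‖Y N ω‖‖}
      ≤ μ ({ω | ε / (|C| + 1) ≤ ‖X N ω‖} ∪ {ω | C < ‖Y N ω‖}) := by
        refine measure_mono fun ω hω => ?_
        by_contra hcon
        simp only [Set.mem_union, Set.mem_ofPred_eq, not_or, not_le, not_lt] at hcon hω
        rw [Real.norm_of_nonneg (by positivity)] at hω
        have h3 : ‖Y N ω‖ ≤ |C| + 1 := by linarith [le_abs_self C, hcon.2]
        have h4 : ‖X N ω‖ * (|C| + 1) < ε := (lt_div_iff₀ hC').1 hcon.1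
        linarith [mul_le_mul_of_nonneg_left h3 (norm_nonneg (X N ω))]
    _ ≤ δ / 2 + δ / 2 := (measure_union_le _ _).trans (add_le_add h2 h1)
    _ = δ := ENNReal.add_halves δ

theorem BddInProb.of_le {X : ℕ → Ω → E} {Y : ℕ → Ω → F} (hY : BddInProb μ Y)
    (h : Tendsto (fun N => μ {ω | ¬ ‖X N ω‖ ≤ ‖Y N ω‖}) atTop (𝓝 0)) : BddInProb μ X := by
  intro ε hε
  obtain ⟨C, hC⟩ := hY (ε / 2) (ENNReal.half_pos hε.ne')
  refine ⟨C, ?_⟩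
  filter_upwards [hC, ENNReal.tendsto_nhds_zero.1 h (ε / 2) (ENNReal.half_pos hε.ne')] with N h1 h2
  calc μ {ω | C < ‖X N ω‖} ≤ μ ({ω | C < ‖Y N ω‖} ∪ {ω | ¬ ‖X N ω‖ ≤ ‖Y N ω‖}) := by
        refine measure_mono fun ω hω => ?_
        by_cases h3 : ‖X N ω‖ ≤ ‖Y N ω‖
        · exact Or.inl (lt_of_lt_of_le hω h3)
        · exact Or.inr h3
    _ ≤ ε / 2 + ε / 2 := (measure_union_le _ _).trans (add_le_add h1 h2)
    _ = ε := ENNReal.add_halves ε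

theorem BddInProb.of_forall_le {X : ℕ → Ω → E} {Y : ℕ → Ω → F} (hY : BddInProb μ Y)
    (h : ∀ N ω, ‖X N ω‖ ≤ ‖Y N ω‖) : BddInProb μ X :=
  hY.of_le (by simp [h])

theorem BddInProb.add {X Y : ℕ → Ω → E} (hX : BddInProb μ X) (hY : BddInProb μ Y) :
    BddInProb μ (fun N ω => X N ω + Y N ω) := by
  intro ε hε
  obtain ⟨C, hC⟩ := hX (ε / 2) (ENNReal.half_pos hε.ne')
  obtain ⟨D, hD⟩ := hY (ε / 2) (ENNReal.half_pos hε.ne')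
  refine ⟨C + D, ?_⟩
  filter_upwards [hC, hD] with N h1 h2
  calc μ {ω | C + D < ‖X N ω + Y N ω‖} ≤ μ ({ω | C < ‖X N ω‖} ∪ {ω | D < ‖Y N ω‖}) := by
        refine measure_mono fun ω hω => ?_
        by_contra hcon
        simp only [Set.mem_union, Set.mem_ofPred_eq, not_or, not_lt] at hcon hω
        linarith [norm_add_le (X N ω) (Y N ω), hcon.1, hcon.2]
    _ ≤ ε / 2 + ε / 2 := (measure_union_le _ _).trans (add_le_add h1 h2)
    _ = ε := ENNReal.add_halves ε

theorem bddInProb_const (c : E) : BddInProb μ (fun _ _ => c) := by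
  intro ε _
  exact ⟨‖c‖, by simp⟩

theorem NegligibleInProb.bddInProb {X : ℕ → Ω → E} (hX : NegligibleInProb μ X) :
    BddInProb μ X := by
  intro ε hε
  refine ⟨1, ?_⟩
  filter_upwards [ENNReal.tendsto_nhds_zero.1 (hX 1 one_pos) ε hε] with N h
  refine le_trans (measure_mono fun ω hω => ?_) h
  exact le_of_lt (show 1 < ‖X N ω‖ from hω)

theorem BddInProb.const_mul {X : ℕ → Ω → E} (hX : BddInProb μ X) (c : ℝ) :
    BddInProb μ (fun N ω => c * ‖X N ω‖) := by
  intro ε hε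
  obtain ⟨C, hC⟩ := hX ε hε
  refine ⟨|c| * C, ?_⟩
  filter_upwards [hC] with N h
  refine (measure_mono fun ω hω => ?_).trans h
  simp only [Set.mem_ofPred_eq, norm_mul, norm_norm] at hω ⊢
  rw [Real.norm_eq_abs] at hω
  exact lt_of_mul_lt_mul_left hω (abs_nonneg c)

theorem BddInProb.prodMk {X : ℕ → Ω → E} {Y : ℕ → Ω → F} (hX : BddInProb μ X)
    (hY : BddInProb μ Y) : BddInProb μ (fun N ω => (X N ω, Y N ω)) := by
  have h := (hX.const_mul 1).add (hY.const_mul 1)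
  refine h.of_forall_le fun N ω => ?_
  rw [Prod.norm_def, Real.norm_of_nonneg (by positivity)]
  exact max_le (by linarith [norm_nonneg (Y N ω)]) (by linarith [norm_nonneg (X N ω)])

theorem bddInProb_sum {ι : Type*} (s : Finset ι) {X : ι → ℕ → Ω → E}
    (hX : ∀ i ∈ s, BddInProb μ (X i)) :
    BddInProb μ (fun N ω => ∑ i ∈ s, X i N ω) := by
  classical
  induction s using Finset.induction_on with
  | empty => simpa using bddInProb_const (μ := μ) (0 : E)
  | insert i s hi ih =>
    simp only [Finset.sum_insert hi]
    exact (hX i (by simp)).add (ih fun j hj => hX j (by simp [hj]))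

theorem bddInProb_pi {n : ℕ} {X : ℕ → Ω → Fin n → ℝ}
    (hX : ∀ j, BddInProb μ (fun N ω => X N ω j)) : BddInProb μ X := by
  have h := bddInProb_sum Finset.univ fun j _ => (hX j).const_mul 1
  refine h.of_forall_le fun N ω => ?_
  rw [Real.norm_of_nonneg (Finset.sum_nonneg fun i _ => by positivity),
    pi_norm_le_iff_of_nonneg (Finset.sum_nonneg fun i _ => by positivity)]
  intro j
  refine le_trans ?_ (Finset.single_le_sum (f := fun j => 1 * ‖X N ω j‖)
    (fun i _ => by positivity) (Finset.mem_univ j))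
  simp

theorem NegligibleInProb.comp_clm [NormedSpace ℝ E] [NormedSpace ℝ F] (T : E →L[ℝ] F)
    {X : ℕ → Ω → E} (hX : NegligibleInProb μ X) :
    NegligibleInProb μ (fun N ω => T (X N ω)) := by
  have h := hX.mul (bddInProb_const (μ := μ) (‖T‖))
  refine h.of_forall_le fun N ω => ?_
  rw [norm_norm, Real.norm_of_nonneg (by positivity), mul_comm]
  exact T.le_opNorm _

end StochasticOrder

/-! ### Averages and normalised sums of independent clusters. -/

section LawOfLargeNumbers

variable {Ω : Type*} [MeasurableSpace Ω] {μ : Measure Ω} [IsProbabilityMeasure μ]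
variable {S : Type*} [MeasurableSpace S] {P : Measure S} {Z : ℕ → Ω → S}
  (hZ : ∀ i, HasLaw (Z i) P μ) (hind : iIndepFun Z μ)

include hZ hind

theorem tendstoInMeasure_average {E : Type*} [NormedAddCommGroup E] [NormedSpace ℝ E]
    [CompleteSpace E] [MeasurableSpace E] [BorelSpace E] {f : S → E}
    (hf : Integrable f P) :
    TendstoInMeasure μ (fun (N : ℕ) ω => (N : ℝ)⁻¹ • ∑ i ∈ Finset.range N, f (Z i ω)) atTop
      (fun _ => ∫ z, f z ∂P) := by
  -- Independence and equality in law pass through a measurable map, so `f` is replaced by a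
  -- measurable version; almost surely this changes no term of the sum.
  set g := hf.1.mk f with hg
  have hgm : StronglyMeasurable g := hf.1.stronglyMeasurable_mk
  have hfg : f =ᵐ[P] g := hf.1.ae_eq_mk
  have hgi : Integrable g P := hf.congr hfg
  have hae : ∀ᵐ ω ∂μ, ∀ i, f (Z i ω) = g (Z i ω) := ae_all_iff.2 fun i =>
    ae_of_ae_map (hZ i).aemeasurable (by rw [(hZ i).map_eq]; exact hfg)
  have hgZ : ∀ i, Integrable (fun ω => g (Z i ω)) μ := fun i => by
    have h := hgi
    rw [← (hZ i).map_eq] at h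
    exact h.comp_aemeasurable (hZ i).aemeasurable
  have hlaw := strong_law_ae (μ := μ) (fun i ω => g (Z i ω)) (hgZ 0)
    (fun i j hij => (hind.comp (fun _ => g) fun _ => hgm.measurable).indepFun hij)
    (fun i => ((hZ i).identDistrib (hZ 0)).comp hgm.measurable)
  have hint : ∫ ω, g (Z 0 ω) ∂μ = ∫ z, f z ∂P := by
    rw [integral_congr_ae hfg, ← (hZ 0).map_eq,
      integral_map (hZ 0).aemeasurable hgm.aestronglyMeasurable]
  rw [hint] at hlaw
  refine TendstoInMeasure.congr_left (f := fun (N : ℕ) ω =>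
    (N : ℝ)⁻¹ • ∑ i ∈ Finset.range N, g (Z i ω)) ?_ ?_
  · intro N
    filter_upwards [hae] with ω hω
    simp [hω]
  · refine tendstoInMeasure_of_tendsto_ae (fun N => ?_) hlaw
    exact (Finset.aestronglyMeasurable_fun_sum _ fun i _ => (hgZ i).1).const_smul _

/-- Chebyshev's inequality: by independence and centring the normalised sum has the same variance
for every `N > 0`. -/
theorem bddInProb_normalized_sum {f : S → ℝ} (hf : MemLp f 2 P)
    (h0 : ∫ z, f z ∂P = 0) :
    BddInProb μ (fun (N : ℕ) ω => (√(N : ℝ))⁻¹ * ∑ i ∈ Finset.range N, f (Z i ω)) := by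
  set g := hf.1.mk f with hg
  have hgm : StronglyMeasurable g := hf.1.stronglyMeasurable_mk
  have hfg : f =ᵐ[P] g := hf.1.ae_eq_mk
  have hgi : MemLp g 2 P := (memLp_congr_ae hfg).1 hf
  have hae : ∀ᵐ ω ∂μ, ∀ i, f (Z i ω) = g (Z i ω) := ae_all_iff.2 fun i =>
    ae_of_ae_map (hZ i).aemeasurable (by rw [(hZ i).map_eq]; exact hfg)
  have hgZ : ∀ i, MemLp (fun ω => g (Z i ω)) 2 μ := fun i => by
    have h := hgi
    rw [← (hZ i).map_eq] at h
    exact h.comp_of_map (hZ i).aemeasurable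
  have hid : ∀ i, IdentDistrib (fun ω => g (Z i ω)) (fun ω => g (Z 0 ω)) μ μ := fun i =>
    ((hZ i).identDistrib (hZ 0)).comp hgm.measurable
  have hint : ∀ i, ∫ ω, g (Z i ω) ∂μ = 0 := fun i => by
    rw [← h0, integral_congr_ae hfg, ← (hZ i).map_eq,
      integral_map (hZ i).aemeasurable hgm.aestronglyMeasurable]
  set V := Var[fun ω => g (Z 0 ω); μ] with hV
  have hvar : ∀ N : ℕ, Var[∑ i ∈ Finset.range N, fun ω => g (Z i ω); μ] = N * V := by
    intro N
    rw [IndepFun.variance_sum (fun i _ => hgZ i) fun i _ j _ hij =>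
      (hind.comp (fun _ => g) fun _ => hgm.measurable).indepFun hij]
    simp [(hid _).variance_eq, hV]
  have hmean : ∀ N : ℕ, ∫ ω, (∑ i ∈ Finset.range N, fun ω => g (Z i ω)) ω ∂μ = 0 := by
    intro N
    simp only [Finset.sum_apply]
    rw [integral_finsetSum _ fun i _ => (hgZ i).integrable (by norm_num)]
    simp [hint]
  intro ε hε
  have hVn : 0 ≤ V := variance_nonneg _ _
  obtain ⟨C, hC0, hC⟩ : ∃ C : ℝ, 0 < C ∧ ENNReal.ofReal (V / C ^ 2) ≤ ε := by
    have h1 : Tendsto (fun C : ℝ => ENNReal.ofReal (V / C ^ 2)) atTop (𝓝 0) := by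
      rw [← ENNReal.ofReal_zero]
      refine (ENNReal.continuous_ofReal.tendsto _).comp ?_
      exact tendsto_const_nhds.div_atTop (tendsto_pow_atTop two_ne_zero)
    exact ((eventually_gt_atTop 0).and (ENNReal.tendsto_nhds_zero.1 h1 ε hε)).exists
  refine ⟨C, ?_⟩
  filter_upwards [eventually_gt_atTop 0] with N hN
  have hN' : (0 : ℝ) < N := by exact_mod_cast hN
  -- At the threshold `√N * C` for the raw sum the bound `N V / (√N C)²` is `V / C²`, free of `N`.
  have hcheb := meas_ge_le_variance_div_sq (μ := μ) (X := ∑ i ∈ Finset.range N, fun ω => g (Z i ω))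
    (memLp_finsetSum' _ fun i _ => hgZ i) (c := √N * C) (by positivity)
  rw [hmean, hvar] at hcheb
  have h2 : (N : ℝ) * V / (√N * C) ^ 2 = V / C ^ 2 := by
    rw [mul_pow, Real.sq_sqrt hN'.le]
    field_simp
  rw [h2] at hcheb
  refine le_trans ?_ (hcheb.trans hC)
  refine measure_mono_ae ?_
  filter_upwards [hae] with ω hω h3
  change √N * C ≤ |(∑ i ∈ Finset.range N, fun ω => g (Z i ω)) ω - 0|
  change C < ‖(√(N : ℝ))⁻¹ * ∑ i ∈ Finset.range N, f (Z i ω)‖ at h3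
  rw [norm_mul, norm_inv, Real.norm_of_nonneg (Real.sqrt_nonneg _),
    lt_inv_mul_iff₀ (Real.sqrt_pos.2 hN')] at h3
  simpa [hω] using h3.le

end LawOfLargeNumbers

/-! ### A quadratic Taylor bound. -/

section Taylor

variable {E F : Type*} [NormedAddCommGroup E] [NormedSpace ℝ E] [NormedAddCommGroup F]
  [NormedSpace ℝ F]

/-- The mean value inequality is used twice: for the derivative on the ball, then for the function
on the segment from `x` to `y`. Bounding the derivative uniformly on the segment costs the usual
factor one half. -/
theorem norm_sub_sub_fderiv_le_of_norm_iteratedFDeriv_two_le {f : E → F} {x : E} {r C : ℝ}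
    (hf : ContDiffOn ℝ 2 f (Metric.ball x r))
    (hC : ∀ y ∈ Metric.ball x r, ‖iteratedFDeriv ℝ 2 f y‖ ≤ C) {y : E} (hy : y ∈ Metric.ball x r) :
    ‖f y - f x - fderiv ℝ f x (y - x)‖ ≤ C * ‖y - x‖ ^ 2 := by
  have hx : x ∈ Metric.ball x r := Metric.mem_ball_self (Metric.pos_of_mem_ball hy)
  have hat : ∀ z ∈ Metric.ball x r, ContDiffAt ℝ 2 f z := fun z hz =>
    hf.contDiffAt (Metric.isOpen_ball.mem_nhds hz)
  have hC0 : 0 ≤ C := (norm_nonneg _).trans (hC x hx)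
  have h1 : ∀ z ∈ Metric.ball x r, ‖fderiv ℝ f z - fderiv ℝ f x‖ ≤ C * ‖z - x‖ := fun z hz =>
    (convex_ball x r).norm_image_sub_le_of_norm_fderiv_le (𝕜 := ℝ)
      (fun u hu => ((hat u hu).fderiv_right (m := 1) (by norm_num)).differentiableAt (by norm_num))
      (fun u hu => by
        rw [← norm_iteratedFDeriv_one, norm_iteratedFDeriv_fderiv]
        exact hC u hu) hx hz
  have hseg : segment ℝ x y ⊆ Metric.ball x r := (convex_ball x r).segment_subset hx hy
  have h2 := (convex_segment x y).norm_image_sub_le_of_norm_fderiv_le' (𝕜 := ℝ)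
    (f := f) (φ := fderiv ℝ f x) (C := C * ‖y - x‖)
    (fun z hz => (hat z (hseg hz)).differentiableAt (by norm_num))
    (fun z hz => (h1 z (hseg hz)).trans
      (mul_le_mul_of_nonneg_left (norm_sub_le_of_mem_segment hz) hC0))
    (left_mem_segment ℝ x y) (right_mem_segment ℝ x y)
  calc _ ≤ _ := h2
    _ = _ := by ring

end Taylor

/-! ### Linearisation of an estimating equation at its population root. -/

section EstimatingEquation

variable {Ω : Type*} [MeasurableSpace Ω] {μ : Measure Ω} [IsProbabilityMeasure μ]
variable {S : Type*} [MeasurableSpace S] {P : Measure S} {Z : ℕ → Ω → S}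
variable {E : Type*} [NormedAddCommGroup E] [NormedSpace ℝ E] [CompleteSpace E]

/-- Linear expansion of the root of an estimating equation around the population root; `Δ` is the
estimation error, and `δ` a component of it that is known to be negligible and controls the
nonlinearity. -/
theorem negligible_estimating_equation (hZ : ∀ i, HasLaw (Z i) P μ) (hind : iIndepFun Z μ)
    {ψ : S → E} {J : S → E →L[ℝ] E} (hJ : Integrable J P)
    (hJinv : (∫ z, J z ∂P).IsInvertible) {G : S → ℝ} (hG : Integrable G P)
    {Δ : ℕ → Ω → E} {δ : ℕ → Ω → ℝ} (hδΔ : ∀ N ω, |δ N ω| ≤ ‖Δ N ω‖)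
    (hδ : NegligibleInProb μ δ)
    (hψ : BddInProb μ (fun (N : ℕ) ω => (√(N : ℝ))⁻¹ • ∑ i ∈ Finset.range N, ψ (Z i ω)))
    (heq : Tendsto (fun N => μ {ω | ¬ ‖∑ i ∈ Finset.range N, ψ (Z i ω)
      + ∑ i ∈ Finset.range N, J (Z i ω) (Δ N ω)‖
        ≤ (∑ i ∈ Finset.range N, G (Z i ω)) * δ N ω ^ 2}) atTop (𝓝 0)) :
    BddInProb μ (fun (N : ℕ) ω => √(N : ℝ) • Δ N ω) ∧
    NegligibleInProb μ (fun (N : ℕ) ω => √(N : ℝ) • Δ N ω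
      + (∫ z, J z ∂P).inverse ((√(N : ℝ))⁻¹ • ∑ i ∈ Finset.range N, ψ (Z i ω))) := by
  borelize (E →L[ℝ] E)
  set A := ∫ z, J z ∂P with hA
  set κ := ‖A.inverse‖ with hκ
  have hκ0 : 0 ≤ κ := norm_nonneg _
  have hJlim := negligibleInProb_iff.2 (tendstoInMeasure_average hZ hind hJ)
  have hGlim := negligibleInProb_iff.2 (tendstoInMeasure_average hZ hind hG)
  set Jb : ℕ → Ω → E →L[ℝ] E := fun N ω => (N : ℝ)⁻¹ • ∑ i ∈ Finset.range N, J (Z i ω) with hJb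
  set Gb : ℕ → Ω → ℝ := fun N ω => (N : ℝ)⁻¹ • ∑ i ∈ Finset.range N, G (Z i ω) with hGb
  set T : ℕ → Ω → E := fun N ω => (√(N : ℝ))⁻¹ • ∑ i ∈ Finset.range N, ψ (Z i ω) with hT
  have hGbdd : BddInProb μ Gb := by
    have := hGlim.bddInProb.add (bddInProb_const (∫ z, G z ∂P))
    simp only [sub_add_cancel] at this
    exact this
  have ha1 := hδ.mul hGbdd
  have ha2 : NegligibleInProb μ (fun N ω => ‖Jb N ω - A‖) :=
    NegligibleInProb.of_forall_le (Y := fun N ω => Jb N ω - A) hJlim fun N ω => by simp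
  -- `a` collects both errors of the linear equation `T + A D = 0` for `D = √N Δ`: the curvature,
  -- and the distance of the average Jacobian from its mean.
  set a : ℕ → Ω → ℝ := fun N ω => ‖δ N ω‖ * ‖Gb N ω‖ + ‖Jb N ω - A‖ with ha
  have hneg : NegligibleInProb μ a := ha1.add ha2
  have ha0 : ∀ N ω, 0 ≤ a N ω := fun N ω => by positivity
  have hκa : NegligibleInProb μ (fun N ω => κ * a N ω) :=
    (hneg.mul (bddInProb_const κ)).of_forall_le fun N ω => by
      simp [mul_comm]
  -- A deterministic statement on the event where the Taylor bound holds and `κ a < 1/2`; the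
  -- probability of its complement tends to zero.
  have key : ∀ N ω, 0 < N → ‖∑ i ∈ Finset.range N, ψ (Z i ω)
      + ∑ i ∈ Finset.range N, J (Z i ω) (Δ N ω)‖
        ≤ (∑ i ∈ Finset.range N, G (Z i ω)) * δ N ω ^ 2 → κ * a N ω < 1 / 2 →
      ‖√(N : ℝ) • Δ N ω‖ ≤ 2 * κ * ‖T N ω‖ ∧
        ‖√(N : ℝ) • Δ N ω + A.inverse (T N ω)‖ ≤ 2 * κ ^ 2 * (a N ω * ‖T N ω‖) := by
    intro N ω hN h1 h2
    have hN' : (0 : ℝ) < N := by exact_mod_cast hN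
    set s := √(N : ℝ) with hs
    have hs0 : 0 < s := Real.sqrt_pos.2 hN'
    have hss : (N : ℝ)⁻¹ = s⁻¹ * s⁻¹ := by
      rw [← mul_inv, hs, Real.mul_self_sqrt hN'.le]
    set D := s • Δ N ω with hD
    have h3 : T N ω + Jb N ω D = s⁻¹ • (∑ i ∈ Finset.range N, ψ (Z i ω)
      + ∑ i ∈ Finset.range N, J (Z i ω) (Δ N ω)) := by
      simp only [hT, hJb, hD, smul_add, hss, smul_apply,
        sum_apply, map_smul, smul_smul]
      congr 2
      field_simp
    have h4 : ‖T N ω + Jb N ω D‖ ≤ ‖δ N ω‖ * ‖Gb N ω‖ * ‖D‖ := by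
      rw [h3, norm_smul, norm_inv, Real.norm_of_nonneg hs0.le]
      calc s⁻¹ * ‖∑ i ∈ Finset.range N, ψ (Z i ω) + ∑ i ∈ Finset.range N, J (Z i ω) (Δ N ω)‖
          ≤ s⁻¹ * ((∑ i ∈ Finset.range N, G (Z i ω)) * δ N ω ^ 2) := by gcongr
        _ = s * Gb N ω * (|δ N ω| * |δ N ω|) := by
            rw [abs_mul_abs_self, hGb]
            simp only [smul_eq_mul, hss]
            field_simp
        -- One factor `|δ|` is kept because it is small; the other is enlarged to `‖Δ‖`, so that the
        -- error becomes a small multiple of `‖D‖`.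
        _ ≤ s * ‖Gb N ω‖ * (|δ N ω| * ‖Δ N ω‖) := by
            gcongr
            · exact Real.le_norm_self _
            · exact hδΔ N ω
        _ = ‖δ N ω‖ * ‖Gb N ω‖ * ‖D‖ := by
            rw [hD, norm_smul s (Δ N ω), Real.norm_of_nonneg hs0.le, Real.norm_eq_abs (δ N ω)]
            ring
    have h5 : ‖T N ω + A D‖ ≤ a N ω * ‖D‖ := by
      have h6 : T N ω + A D = (T N ω + Jb N ω D) - (Jb N ω - A) D := by
        rw [sub_apply]; abel
      rw [h6, ha]
      refine (norm_sub_le _ _).trans ?_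
      rw [add_mul]
      exact add_le_add h4 ((Jb N ω - A).le_opNorm D)
    have h7 : ‖D + A.inverse (T N ω)‖ ≤ κ * a N ω * ‖D‖ := by
      have h8 : D + A.inverse (T N ω) = A.inverse (T N ω + A D) := by
        rw [map_add, hJinv.inverse_apply_self]; abel
      rw [h8]
      refine (A.inverse.le_opNorm _).trans ?_
      rw [mul_assoc]
      gcongr
    have h9 : ‖D‖ ≤ 2 * κ * ‖T N ω‖ := by
      have h10 : ‖D‖ ≤ ‖D + A.inverse (T N ω)‖ + ‖A.inverse (T N ω)‖ := by
        have := norm_sub_le (D + A.inverse (T N ω)) (A.inverse (T N ω))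
        simpa using this
      have h11 := A.inverse.le_opNorm (T N ω)
      -- The error is at most half of `‖D‖` and is absorbed in the left side; this gives the rate
      -- without assuming it.
      have h12 : κ * a N ω * ‖D‖ ≤ 1 / 2 * ‖D‖ := by gcongr
      linarith
    refine ⟨h9, h7.trans ?_⟩
    have h13 : κ * a N ω * ‖D‖ ≤ κ * a N ω * (2 * κ * ‖T N ω‖) := by
      have := ha0 N ω
      gcongr
    linarith [h13]
  have hbad : Tendsto (fun N : ℕ => μ {ω | ¬ (‖√(N : ℝ) • Δ N ω‖ ≤ 2 * κ * ‖T N ω‖ ∧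
        ‖√(N : ℝ) • Δ N ω + A.inverse (T N ω)‖ ≤ 2 * κ ^ 2 * (a N ω * ‖T N ω‖))}) atTop (𝓝 0) := by
    have h1 := heq.add (hκa (1 / 2) (by norm_num))
    rw [add_zero] at h1
    refine tendsto_of_tendsto_of_tendsto_of_le_of_le' tendsto_const_nhds h1
      (Eventually.of_forall fun _ => zero_le) ?_
    filter_upwards [eventually_gt_atTop 0] with N hN
    refine (measure_mono fun ω hω => ?_).trans (measure_union_le _ _)
    by_contra hcon
    simp only [Set.mem_union, Set.mem_ofPred_eq, not_or, not_le] at hcon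
    refine hω (key N ω hN (not_lt.1 hcon.1) ?_)
    rw [Real.norm_of_nonneg (mul_nonneg hκ0 (ha0 N ω))] at hcon
    exact hcon.2
  constructor
  · refine (hψ.const_mul (2 * κ)).of_le ?_
    refine tendsto_of_tendsto_of_tendsto_of_le_of_le tendsto_const_nhds hbad
      (fun _ => zero_le) fun N => measure_mono fun ω hω hcon => hω ?_
    rw [Real.norm_of_nonneg (by positivity)]
    exact hcon.1
  · refine ((hneg.mul hψ).mul (bddInProb_const (2 * κ ^ 2))).of_le ?_
    refine tendsto_of_tendsto_of_tendsto_of_le_of_le tendsto_const_nhds hbad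
      (fun _ => zero_le) fun N => measure_mono fun ω hω hcon => hω ?_
    rw [norm_mul, norm_norm, norm_norm, norm_mul, norm_norm, norm_norm,
      Real.norm_of_nonneg (ha0 N ω), Real.norm_of_nonneg (by positivity : 0 ≤ 2 * κ ^ 2), mul_comm]
    exact hcon.2

end EstimatingEquation

/-! ### Delta method. -/

section DeltaMethod

variable {Ω : Type*} [MeasurableSpace Ω] {μ : Measure Ω}

theorem NegligibleInProb.comp_continuousAt {X : ℕ → Ω → ℝ} {c : ℝ}
    (hX : NegligibleInProb μ (fun N ω => X N ω - c)) {f : ℝ → ℝ} (hf : ContinuousAt f c) :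
    NegligibleInProb μ (fun N ω => f (X N ω) - f c) := by
  intro ε hε
  obtain ⟨δ, hδ, h⟩ := Metric.continuousAt_iff.1 hf ε hε
  refine tendsto_of_tendsto_of_tendsto_of_le_of_le tendsto_const_nhds (hX δ hδ)
      (fun _ => zero_le) fun N => measure_mono fun ω hω => ?_
  by_contra hcon
  have h1 : dist (X N ω) c < δ := by
    rw [dist_eq_norm]
    exact not_le.1 hcon
  have h2 := h h1
  rw [dist_eq_norm] at h2
  exact absurd h2 (not_lt.2 hω)

/-- Delta method for a product `v(p) θ`. -/
theorem negligible_delta_mul {v : ℝ → ℝ} {p θ : ℝ} (hv : DifferentiableAt ℝ v p)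
    {pHat θHat Sp Sθ : ℕ → Ω → ℝ}
    (hp : NegligibleInProb μ (fun N ω => √(N : ℝ) * (pHat N ω - p) - Sp N ω))
    (hSp : BddInProb μ Sp)
    (hpc : NegligibleInProb μ (fun N ω => pHat N ω - p))
    (hθ : NegligibleInProb μ (fun N ω => √(N : ℝ) * (θHat N ω - θ) - Sθ N ω))
    (hSθ : BddInProb μ Sθ) :
    NegligibleInProb μ (fun N ω => √(N : ℝ) * (v (pHat N ω) * θHat N ω - v p * θ)
      - (v p * Sθ N ω + Sp N ω * deriv v p * θ)) := by
  have hpb : BddInProb μ (fun N ω => √(N : ℝ) * (pHat N ω - p)) := by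
    simpa using hp.bddInProb.add hSp
  have hθb : BddInProb μ (fun N ω => √(N : ℝ) * (θHat N ω - θ)) := by
    simpa using hθ.bddInProb.add hSθ
  -- The difference quotient `dslope v p` is continuous at `p` with value `v'(p)`, and `v(pHat) -
  -- v(p)` is exactly this quotient times `pHat - p`. No remainder term of `v` has to be estimated.
  have h1 := (hpc.comp_continuousAt (continuousAt_dslope_same.2 hv)).mul hpb
  have h2 := (hpc.comp_continuousAt hv.continuousAt).mul hθb
  have h3 := (((hθ.mul (bddInProb_const (v p))).add (hp.mul (bddInProb_const (deriv v p * θ)))).add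
    (h1.mul (bddInProb_const θ))).add h2
  refine h3.of_forall_le fun N ω => ?_
  have h4 : v (pHat N ω) - v p = dslope v p (pHat N ω) * (pHat N ω - p) := by
    rw [mul_comm, ← smul_eq_mul, sub_smul_dslope]
  have h5 : √(N : ℝ) * (v (pHat N ω) * θHat N ω - v p * θ)
      - (v p * Sθ N ω + Sp N ω * deriv v p * θ)
      = (√(N : ℝ) * (θHat N ω - θ) - Sθ N ω) * v p
        + (√(N : ℝ) * (pHat N ω - p) - Sp N ω) * (deriv v p * θ)
        + ((dslope v p (pHat N ω) - dslope v p p) * (√(N : ℝ) * (pHat N ω - p))) * θ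
        + (v (pHat N ω) - v p) * (√(N : ℝ) * (θHat N ω - θ)) := by
    rw [dslope_same]
    linear_combination (√(N : ℝ) * θ) * h4
  rw [h5]
  refine le_trans ?_ (Real.le_norm_self _)
  refine (norm_add_le _ _).trans (add_le_add ((norm_add_le _ _).trans (add_le_add
    ((norm_add_le _ _).trans (add_le_add ?_ ?_)) ?_)) ?_)
  · rw [norm_mul]
  · rw [norm_mul]
  · rw [norm_mul, norm_mul, norm_mul ‖_‖, norm_norm, norm_norm]
  · rw [norm_mul]

end DeltaMethod

/-! ### The stacked estimating function, its Jacobian and its influence function. -/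

section EstimatingFunction

variable {K de dg : ℕ} {M d : Fin K → ℕ} {P : ProbabilityMeasure (Obs M d)} {w : Weights M d}
  {m : WorkingModel M d de dg} {psiBeta : Obs M d → Beta de dg → Beta de dg}
  {Ω₀ : Set (Param K de dg)} {θ₀ : Fin K → ℝ} {β₀ : Beta de dg}

/-- Restriction of a vector indexed by the cluster types to the type of the cluster. -/
def typeMask (z : Obs M d) (u : Fin K → ℝ) : Fin K → ℝ := fun k => if z.1 = k then u k else 0

/-- `psi` is affine in `θ` with a linear part free of `β`, so there is no curvature in any direction
that involves `θ`. -/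
theorem psi_sub_theta (z : Obs M d) (θ θ' : Fin K → ℝ) (β : Beta de dg) :
    psi w m psiBeta z (θ, β) = psi w m psiBeta z (θ', β) - (typeMask z (θ - θ'), 0) := by
  refine Prod.ext (funext fun k => ?_) ?_
  · simp only [psi, psiTheta, typeMask, Prod.fst_sub, Pi.sub_apply]
    split_ifs <;> ring
  · simp [psi]

theorem fderiv_psi_theta {z : Obs M d} (h : DifferentiableAt ℝ (psi w m psiBeta z) (θ₀, β₀))
    (u : Fin K → ℝ) :
    fderiv ℝ (psi w m psiBeta z) (θ₀, β₀) (u, 0) = -(typeMask z u, 0) := by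
  have h1 := h.hasFDerivAt.hasLineDerivAt (u, 0)
  refine h1.unique ?_
  unfold HasLineDerivAt
  have h2 : (fun t : ℝ => psi w m psiBeta z ((θ₀, β₀) + t • (u, 0)))
      = fun t => psi w m psiBeta z (θ₀, β₀) + t • (-(typeMask z u, 0)) := by
    ext1 t
    rw [show (θ₀, β₀) + t • ((u, 0) : Param K de dg) = (θ₀ + t • u, β₀) by simp,
      psi_sub_theta z (θ₀ + t • u) θ₀ β₀, sub_eq_add_neg]
    congr 1
    refine Prod.ext (funext fun k => ?_) (by simp)
    simp only [typeMask, Prod.fst_neg, Pi.neg_apply, Prod.smul_fst, Pi.smul_apply, smul_eq_mul,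
      add_sub_cancel_left]
    split_ifs <;> simp
  rw [h2]
  simpa using (((hasDerivAt_id (0 : ℝ)).smul_const
    (-(typeMask z u, (0 : Beta de dg)))).const_add (psi w m psiBeta z (θ₀, β₀)))

theorem fderiv_psi_beta {z : Obs M d} (h : DifferentiableAt ℝ (psi w m psiBeta z) (θ₀, β₀)) :
    (∀ k, fderiv ℝ (fun b => psiTheta w m z (θ₀, b) k) β₀
      = (ContinuousLinearMap.proj (R := ℝ) (φ := fun _ : Fin K => ℝ) k).comp
        ((ContinuousLinearMap.fst ℝ (Fin K → ℝ) (Beta de dg)).comp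
          ((fderiv ℝ (psi w m psiBeta z) (θ₀, β₀)).comp
            (ContinuousLinearMap.inr ℝ (Fin K → ℝ) (Beta de dg))))) ∧
    fderiv ℝ (psiBeta z) β₀ = (ContinuousLinearMap.snd ℝ (Fin K → ℝ) (Beta de dg)).comp
          ((fderiv ℝ (psi w m psiBeta z) (θ₀, β₀)).comp
            (ContinuousLinearMap.inr ℝ (Fin K → ℝ) (Beta de dg))) := by
  have h1 : HasFDerivAt (fun b : Beta de dg => psi w m psiBeta z (θ₀, b))
      ((fderiv ℝ (psi w m psiBeta z) (θ₀, β₀)).comp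
            (ContinuousLinearMap.inr ℝ (Fin K → ℝ) (Beta de dg))) β₀ :=
    h.hasFDerivAt.comp β₀ (hasFDerivAt_prodMk_right θ₀ β₀)
  refine ⟨fun k => ?_, ?_⟩
  · have h2 := (ContinuousLinearMap.proj (R := ℝ) (φ := fun _ : Fin K => ℝ) k).hasFDerivAt.comp β₀
      ((ContinuousLinearMap.fst ℝ (Fin K → ℝ) (Beta de dg)).hasFDerivAt.comp β₀ h1)
    exact h2.fderiv
  · have h2 := (ContinuousLinearMap.snd ℝ (Fin K → ℝ) (Beta de dg)).hasFDerivAt.comp β₀ h1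
    exact h2.fderiv

/-- The Taylor remainder at `(θ, β)` equals the one at `(θ₀, β)`, because `psi` is affine in `θ`. So
only `β` has to be near its limit and only its error enters the bound. -/
theorem norm_sum_taylor_psi_le {S : Finset ℕ} {z : ℕ → Obs M d} {r : ℝ} {G : Obs M d → ℝ}
    (hz : ∀ i, DifferentiableAt ℝ (psi w m psiBeta (z i)) (θ₀, β₀) ∧
      ∀ η ∈ Metric.ball (θ₀, β₀) r, ‖psi w m psiBeta (z i) η
        - psi w m psiBeta (z i) (θ₀, β₀)
        - fderiv ℝ (psi w m psiBeta (z i)) (θ₀, β₀) (η - (θ₀, β₀))‖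
          ≤ G (z i) * ‖η - (θ₀, β₀)‖ ^ 2)
    {θ : Fin K → ℝ} {β : Beta de dg} (hβ : ‖β - β₀‖ < r)
    (h0 : ∑ i ∈ S, psi w m psiBeta (z i) (θ, β) = 0) :
    ‖∑ i ∈ S, psi w m psiBeta (z i) (θ₀, β₀)
      + ∑ i ∈ S, fderiv ℝ (psi w m psiBeta (z i)) (θ₀, β₀) ((θ, β) - (θ₀, β₀))‖
        ≤ (∑ i ∈ S, G (z i)) * ‖β - β₀‖ ^ 2 := by
  have hn : ‖((θ₀, β) : Param K de dg) - (θ₀, β₀)‖ = ‖β - β₀‖ := by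
    simp [Prod.norm_def]
  have h3 : ∀ i, ‖psi w m psiBeta (z i) (θ, β) - psi w m psiBeta (z i) (θ₀, β₀)
      - fderiv ℝ (psi w m psiBeta (z i)) (θ₀, β₀) ((θ, β) - (θ₀, β₀))‖
        ≤ G (z i) * ‖β - β₀‖ ^ 2 := by
    intro i
    have h4 := (hz i).2 (θ₀, β) (by rw [Metric.mem_ball, dist_eq_norm, hn]; exact hβ)
    rw [hn] at h4
    refine le_trans (le_of_eq ?_) h4
    congr 1
    have h5 : ((θ, β) : Param K de dg) - (θ₀, β₀) = (θ - θ₀, 0) + ((θ₀, β) - (θ₀, β₀)) := by simp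
    rw [h5, map_add, fderiv_psi_theta (hz i).1, psi_sub_theta (z i) θ θ₀ β]
    abel
  have h6 : ∑ i ∈ S, psi w m psiBeta (z i) (θ₀, β₀)
      + ∑ i ∈ S, fderiv ℝ (psi w m psiBeta (z i)) (θ₀, β₀) ((θ, β) - (θ₀, β₀))
      = -∑ i ∈ S, (psi w m psiBeta (z i) (θ, β) - psi w m psiBeta (z i) (θ₀, β₀)
      - fderiv ℝ (psi w m psiBeta (z i)) (θ₀, β₀) ((θ, β) - (θ₀, β₀))) := by
    rw [Finset.sum_sub_distrib, Finset.sum_sub_distrib, h0]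
    abel
  rw [h6, norm_neg, Finset.sum_mul]
  exact norm_sum_le_of_le _ fun i _ => h3 i

variable (hR : RegularityConditions P w m psiBeta Ω₀ (θ₀, β₀))

include hR

theorem exists_taylor_psi : ∃ r > 0, Metric.ball (θ₀, β₀) r ⊆ Ω₀ ∧ ∃ G : Obs M d → ℝ,
    Integrable G (P : Measure (Obs M d)) ∧ ∀ᵐ z ∂(P : Measure (Obs M d)),
      DifferentiableAt ℝ (psi w m psiBeta z) (θ₀, β₀) ∧
      ∀ η ∈ Metric.ball (θ₀, β₀) r, ‖psi w m psiBeta z η - psi w m psiBeta z (θ₀, β₀)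
        - fderiv ℝ (psi w m psiBeta z) (θ₀, β₀) (η - (θ₀, β₀))‖ ≤ G z * ‖η - (θ₀, β₀)‖ ^ 2 := by
  obtain ⟨U, hU, G, hG, hdom⟩ := hR.dominated
  obtain ⟨r, hr, hball⟩ := Metric.mem_nhds_iff.1
    (inter_mem hU (hR.isOpen.mem_nhds hR.root_mem))
  refine ⟨r, hr, fun η hη => (hball hη).2, G, hG, ?_⟩
  filter_upwards [hdom, hR.contDiff] with z h1 h2
  refine ⟨(h2.contDiffAt (hR.isOpen.mem_nhds hR.root_mem)).differentiableAt (by norm_num),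
    fun η hη => ?_⟩
  exact norm_sub_sub_fderiv_le_of_norm_iteratedFDeriv_two_le
    (h2.mono fun η hη => (hball hη).2) (fun η hη => h1 η (hball hη).1) hη

theorem ae_differentiableAt_psi : ∀ᵐ z ∂(P : Measure (Obs M d)),
    DifferentiableAt ℝ (psi w m psiBeta z) (θ₀, β₀) := by
  obtain ⟨r, -, -, G, -, h⟩ := exists_taylor_psi hR
  filter_upwards [h] with z hz using hz.1

/-- Block form of the expected Jacobian. -/
theorem integral_jacobian_apply (u : Fin K → ℝ) (b : Beta de dg) :
    (∫ z, fderiv ℝ (psi w m psiBeta z) (θ₀, β₀) ∂(P : Measure (Obs M d))) (u, b)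
      = (fun k => -(typeProb P k * u k)
        + (∫ z, fderiv ℝ (fun b => psiTheta w m z (θ₀, b) k) β₀ ∂(P : Measure (Obs M d))) b,
        (∫ z, fderiv ℝ (psiBeta z) β₀ ∂(P : Measure (Obs M d))) b) := by
  have hJ := hR.integrable_jacobian
  have hd := ae_differentiableAt_psi hR
  rw [show ((u, b) : Param K de dg) = (u, 0) + (0, b) by simp, map_add]
  refine Prod.ext (funext fun k => ?_) ?_
  · rw [Prod.fst_add, Pi.add_apply]
    congr 1
    · let L : Param K de dg →L[ℝ] ℝ :=
        (ContinuousLinearMap.proj (R := ℝ) (φ := fun _ : Fin K => ℝ) k).comp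
          (ContinuousLinearMap.fst ℝ (Fin K → ℝ) (Beta de dg))
      change L ((∫ z, fderiv ℝ (psi w m psiBeta z) (θ₀, β₀) ∂(P : Measure (Obs M d))) (u, 0)) = _
      rw [ContinuousLinearMap.integral_apply hJ,
        ← L.integral_comp_comm (hJ.apply_continuousLinearMap _)]
      have h1 : ∀ᵐ z ∂(P : Measure (Obs M d)),
          L (fderiv ℝ (psi w m psiBeta z) (θ₀, β₀) (u, 0)) = -(if z.1 = k then u k else 0) := by
        filter_upwards [hd] with z hz
        rw [fderiv_psi_theta hz]
        rfl
      rw [integral_congr_ae h1, integral_neg, integral_type P (fun _ => u k) k]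
      by_cases hp : 0 < typeProb P k
      · have := isProbabilityMeasure_typeLaw P hp
        simp
      · simp [le_antisymm (not_lt.1 hp) (typeProb_nonneg P k)]
    · let L : Param K de dg →L[ℝ] ℝ :=
        (ContinuousLinearMap.proj (R := ℝ) (φ := fun _ : Fin K => ℝ) k).comp
          (ContinuousLinearMap.fst ℝ (Fin K → ℝ) (Beta de dg))
      -- Extraction of a block of the Jacobian, `J ↦ L ∘ J ∘ inr`, as a continuous linear map, so
      -- that it commutes with the integral.
      let T := (ContinuousLinearMap.compL ℝ (Beta de dg) (Param K de dg) ℝ L).comp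
        ((ContinuousLinearMap.compL ℝ (Beta de dg) (Param K de dg) (Param K de dg)).flip
          (ContinuousLinearMap.inr ℝ (Fin K → ℝ) (Beta de dg)))
      have h1 : ∀ᵐ z ∂(P : Measure (Obs M d)),
          fderiv ℝ (fun b => psiTheta w m z (θ₀, b) k) β₀
            = T (fderiv ℝ (psi w m psiBeta z) (θ₀, β₀)) := by
        filter_upwards [hd] with z hz
        exact (fderiv_psi_beta hz).1 k
      rw [integral_congr_ae h1, T.integral_comp_comm hJ]
      rfl
  · rw [Prod.snd_add]
    have h0 : ((∫ z, fderiv ℝ (psi w m psiBeta z) (θ₀, β₀) ∂(P : Measure (Obs M d))) (u, 0)).2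
        = 0 := by
      let L := ContinuousLinearMap.snd ℝ (Fin K → ℝ) (Beta de dg)
      change L ((∫ z, fderiv ℝ (psi w m psiBeta z) (θ₀, β₀) ∂(P : Measure (Obs M d))) (u, 0)) = _
      rw [ContinuousLinearMap.integral_apply hJ,
        ← L.integral_comp_comm (hJ.apply_continuousLinearMap _)]
      refine integral_eq_zero_of_ae ?_
      filter_upwards [hd] with z hz
      rw [fderiv_psi_theta hz]
      simp [L]
    rw [h0, zero_add]
    let T := (ContinuousLinearMap.compL ℝ (Beta de dg) (Param K de dg) (Beta de dg)
      (ContinuousLinearMap.snd ℝ (Fin K → ℝ) (Beta de dg))).comp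
        ((ContinuousLinearMap.compL ℝ (Beta de dg) (Param K de dg) (Param K de dg)).flip
          (ContinuousLinearMap.inr ℝ (Fin K → ℝ) (Beta de dg)))
    have h1 : ∀ᵐ z ∂(P : Measure (Obs M d)),
        fderiv ℝ (psiBeta z) β₀ = T (fderiv ℝ (psi w m psiBeta z) (θ₀, β₀)) := by
      filter_upwards [hd] with z hz
      exact (fderiv_psi_beta hz).2
    rw [integral_congr_ae h1, T.integral_comp_comm hJ]
    rfl

/-- The full Jacobian is block triangular with diagonal entries `-p_k` in the `θ` block. A kernel
vector of the `β` block would extend to one of the full Jacobian, and solvability is read off from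
the second component. -/
theorem isInvertible_jacobian_beta (hp : ∀ k, 0 < typeProb P k) :
    (∫ z, fderiv ℝ (psiBeta z) β₀ ∂(P : Measure (Obs M d))).IsInvertible := by
  set A := ∫ z, fderiv ℝ (psi w m psiBeta z) (θ₀, β₀) ∂(P : Measure (Obs M d)) with hA
  set D := ∫ z, fderiv ℝ (psiBeta z) β₀ ∂(P : Measure (Obs M d)) with hD
  have hinv : A.IsInvertible := hR.nonsingular
  have hinj : Function.Injective D := by
    rw [injective_iff_map_eq_zero]
    intro b hb
    -- The `θ` part is chosen to cancel the off-diagonal block applied to `b`; this requires `p_k >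
    -- 0`.
    have h := integral_jacobian_apply hR (fun k => (typeProb P k)⁻¹ *
      (∫ z, fderiv ℝ (fun b => psiTheta w m z (θ₀, b) k) β₀ ∂(P : Measure (Obs M d))) b) b
    rw [← hA, ← hD, hb] at h
    have h0 : A ((fun k => (typeProb P k)⁻¹ *
      (∫ z, fderiv ℝ (fun b => psiTheta w m z (θ₀, b) k) β₀ ∂(P : Measure (Obs M d))) b), b)
        = A 0 := by
      rw [h, map_zero]
      refine Prod.ext (funext fun k => ?_) rfl
      simp [mul_inv_cancel_left₀ (hp k).ne']
    exact congrArg Prod.snd (hinv.injective h0)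
  have hsurj : Function.Surjective D := by
    intro y
    obtain ⟨⟨u, b⟩, hx⟩ := hinv.surjective (0, y)
    refine ⟨b, ?_⟩
    rw [hA, integral_jacobian_apply hR u b] at hx
    exact congrArg Prod.snd hx
  refine ⟨(LinearEquiv.ofBijective D.toLinearMap ⟨hinj, hsurj⟩).toContinuousLinearEquiv, ?_⟩
  ext x <;> rfl

/-- Block elimination: in `A (u, b) = Ψ` the second row determines `b`, and then row `k` of the
first block determines `u k`. -/
theorem parInfluence_eq (hp : ∀ k, 0 < typeProb P k) (k : Fin K) (z : Obs M d) :
    parInfluence P w m psiBeta θ₀ β₀ k z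
      = -((∫ z, fderiv ℝ (psi w m psiBeta z) (θ₀, β₀) ∂(P : Measure (Obs M d))).inverse
        (psi w m psiBeta z (θ₀, β₀))).1 k := by
  set A := ∫ z, fderiv ℝ (psi w m psiBeta z) (θ₀, β₀) ∂(P : Measure (Obs M d)) with hA
  have hinv : A.IsInvertible := hR.nonsingular
  obtain ⟨⟨u, b⟩, hub⟩ : ∃ x, A.inverse (psi w m psiBeta z (θ₀, β₀)) = x := ⟨_, rfl⟩
  have h1 : A (u, b) = psi w m psiBeta z (θ₀, β₀) := by
    rw [← hub, hinv.self_apply_inverse]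
  rw [hA, integral_jacobian_apply hR u b] at h1
  have h2 : (∫ z, fderiv ℝ (psiBeta z) β₀ ∂(P : Measure (Obs M d))) b = psiBeta z β₀ :=
    congrArg Prod.snd h1
  have h3 := congrFun (congrArg Prod.fst h1) k
  simp only [psi] at h3
  rw [hub, parInfluence, ← h2, (isInvertible_jacobian_beta hR hp).inverse_apply_self, ← h3]
  have := (hp k).ne'
  field_simp
  ring

/-- `-(E ∂Ψ)⁻¹` followed by the `k`-th coordinate of `θ`. -/
theorem exists_clm_parInfluence (hp : ∀ k, 0 < typeProb P k) (k : Fin K) :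
    ∃ L : Param K de dg →L[ℝ] ℝ, ∀ z,
      parInfluence P w m psiBeta θ₀ β₀ k z = L (psi w m psiBeta z (θ₀, β₀)) :=
  ⟨-((ContinuousLinearMap.proj (R := ℝ) (φ := fun _ : Fin K => ℝ) k).comp
      ((ContinuousLinearMap.fst ℝ (Fin K → ℝ) (Beta de dg)).comp
        (∫ z, fderiv ℝ (psi w m psiBeta z) (θ₀, β₀) ∂(P : Measure (Obs M d))).inverse)),
    fun z => parInfluence_eq hR hp k z⟩

theorem memLp_clm_psi (L : Param K de dg →L[ℝ] ℝ) :
    MemLp (fun z => L (psi w m psiBeta z (θ₀, β₀))) 2 (P : Measure (Obs M d)) ∧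
      ∫ z, L (psi w m psiBeta z (θ₀, β₀)) ∂(P : Measure (Obs M d)) = 0 := by
  refine ⟨L.comp_memLp' hR.memLp, ?_⟩
  rw [L.integral_comp_comm (hR.memLp.integrable (by norm_num)), hR.root, map_zero]

theorem memLp_parInfluence (hp : ∀ k, 0 < typeProb P k) (k : Fin K) :
    MemLp (parInfluence P w m psiBeta θ₀ β₀ k) 2 (P : Measure (Obs M d)) ∧
      ∫ z, parInfluence P w m psiBeta θ₀ β₀ k z ∂(P : Measure (Obs M d)) = 0 := by
  obtain ⟨L, hL⟩ := exists_clm_parInfluence hR hp k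
  obtain ⟨h1, h2⟩ := memLp_clm_psi hR L
  simp_rw [← hL] at h1 h2
  exact ⟨h1, h2⟩

variable {Ω : Type*} [MeasurableSpace Ω] {μ : Measure Ω} [IsProbabilityMeasure μ]
    {Z : ℕ → Ω → Obs M d}
    (hZ : ∀ i, HasLaw (Z i) (P : Measure (Obs M d)) μ) (hind : iIndepFun Z μ)

include hZ hind

theorem bddInProb_normalized_sum_psi :
    BddInProb μ (fun (N : ℕ) ω =>
      (√(N : ℝ))⁻¹ • ∑ i ∈ Finset.range N, psi w m psiBeta (Z i ω) (θ₀, β₀)) := by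
  have key : ∀ L : Param K de dg →L[ℝ] ℝ, BddInProb μ (fun (N : ℕ) ω =>
      L ((√(N : ℝ))⁻¹ • ∑ i ∈ Finset.range N, psi w m psiBeta (Z i ω) (θ₀, β₀))) := by
    intro L
    obtain ⟨h1, h2⟩ := memLp_clm_psi hR L
    have h3 := bddInProb_normalized_sum hZ hind h1 h2
    refine h3.of_forall_le fun N ω => ?_
    rw [map_smul, map_sum, smul_eq_mul]
  have h1 := fun k => key ((ContinuousLinearMap.proj (R := ℝ) (φ := fun _ : Fin K => ℝ) k).comp
    (ContinuousLinearMap.fst ℝ (Fin K → ℝ) (Beta de dg)))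
  have h2 := fun j => key ((ContinuousLinearMap.proj (R := ℝ) (φ := fun _ : Fin de => ℝ) j).comp
    ((ContinuousLinearMap.fst ℝ (Fin de → ℝ) (Fin dg → ℝ)).comp
    (ContinuousLinearMap.snd ℝ (Fin K → ℝ) (Beta de dg))))
  have h3 := fun j => key ((ContinuousLinearMap.proj (R := ℝ) (φ := fun _ : Fin dg => ℝ) j).comp
    ((ContinuousLinearMap.snd ℝ (Fin de → ℝ) (Fin dg → ℝ)).comp
    (ContinuousLinearMap.snd ℝ (Fin K → ℝ) (Beta de dg))))
  exact (bddInProb_pi h1).prodMk ((bddInProb_pi h2).prodMk (bddInProb_pi h3))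

end EstimatingFunction

/-! ### Asymptotic linearity of the estimator of `θ`. -/

section EstimatingFunctionRoot

variable {K de dg : ℕ} {M d : Fin K → ℕ} {P : ProbabilityMeasure (Obs M d)} {w : Weights M d}
  {m : WorkingModel M d de dg} {psiBeta : Obs M d → Beta de dg → Beta de dg}
  {Ω₀ : Set (Param K de dg)} {θ₀ : Fin K → ℝ} {β₀ : Beta de dg}
  (hR : RegularityConditions P w m psiBeta Ω₀ (θ₀, β₀))
  {Ω : Type*} [MeasurableSpace Ω] {μ : Measure Ω} [IsProbabilityMeasure μ]
    {Z : ℕ → Ω → Obs M d}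
    (hZ : ∀ i, HasLaw (Z i) (P : Measure (Obs M d)) μ) (hind : iIndepFun Z μ)

include hR hZ hind

/-- Asymptotic linearity of the solution of the estimating equations; consistency is assumed for
the nuisance parameter only. -/
theorem negligible_theta_sub_parInfluence (hp : ∀ k, 0 < typeProb P k)
    {θHat : ℕ → Ω → Fin K → ℝ} {βHat : ℕ → Ω → Beta de dg}
    (hsol : Tendsto (fun N => μ {ω | ∑ i ∈ Finset.range N,
      psi w m psiBeta (Z i ω) (θHat N ω, βHat N ω) ≠ 0}) atTop (𝓝 0))
    (hlim : TendstoInMeasure μ βHat atTop (fun _ => β₀)) (k : Fin K) :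
    NegligibleInProb μ (fun (N : ℕ) ω => √(N : ℝ) * (θHat N ω k - θ₀ k)
      - (√(N : ℝ))⁻¹ * ∑ i ∈ Finset.range N, parInfluence P w m psiBeta θ₀ β₀ k (Z i ω)) := by
  obtain ⟨r, hr, -, G, hG, htaylor⟩ := exists_taylor_psi hR
  have hβ : NegligibleInProb μ (fun N ω => ‖βHat N ω - β₀‖) :=
    NegligibleInProb.of_forall_le (Y := fun N ω => βHat N ω - β₀)
      (negligibleInProb_iff.2 hlim) fun N ω => by simp
  have hae : ∀ᵐ ω ∂μ, ∀ i, DifferentiableAt ℝ (psi w m psiBeta (Z i ω)) (θ₀, β₀) ∧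
      ∀ η ∈ Metric.ball (θ₀, β₀) r, ‖psi w m psiBeta (Z i ω) η
        - psi w m psiBeta (Z i ω) (θ₀, β₀)
        - fderiv ℝ (psi w m psiBeta (Z i ω)) (θ₀, β₀) (η - (θ₀, β₀))‖
          ≤ G (Z i ω) * ‖η - (θ₀, β₀)‖ ^ 2 :=
    ae_all_iff.2 fun i => ae_of_ae_map (hZ i).aemeasurable (by rw [(hZ i).map_eq]; exact htaylor)
  have hδ : ∀ N ω, |‖βHat N ω - β₀‖| ≤ ‖((θHat N ω, βHat N ω) : Param K de dg) - (θ₀, β₀)‖ := by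
    intro N ω
    rw [abs_norm, Prod.norm_def]
    exact le_max_right _ _
  -- Almost surely the bound fails only if the equation is unsolved or `βHat` has left the ball of
  -- the Taylor expansion.
  have hev : Tendsto (fun N => μ {ω | ¬ ‖∑ i ∈ Finset.range N, psi w m psiBeta (Z i ω) (θ₀, β₀)
      + ∑ i ∈ Finset.range N, fderiv ℝ (psi w m psiBeta (Z i ω)) (θ₀, β₀)
        ((θHat N ω, βHat N ω) - (θ₀, β₀))‖
        ≤ (∑ i ∈ Finset.range N, G (Z i ω)) * ‖βHat N ω - β₀‖ ^ 2}) atTop (𝓝 0) := by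
    have h1 := hsol.add (hβ r hr)
    rw [add_zero] at h1
    refine tendsto_of_tendsto_of_tendsto_of_le_of_le tendsto_const_nhds h1 (fun _ => zero_le)
      fun N => ?_
    refine le_trans (measure_mono_ae ?_) (measure_union_le _ _)
    filter_upwards [hae] with ω hω hbad
    by_contra hcon
    have hcon' : ω ∉ {ω | ∑ i ∈ Finset.range N,
      psi w m psiBeta (Z i ω) (θHat N ω, βHat N ω) ≠ 0} ∧
      ω ∉ {ω | r ≤ ‖‖βHat N ω - β₀‖‖} := not_or.1 hcon
    have h7 : ‖βHat N ω - β₀‖ < r := by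
      have h8 : ¬ r ≤ ‖‖βHat N ω - β₀‖‖ := hcon'.2
      rwa [norm_norm, not_le] at h8
    exact hbad (norm_sum_taylor_psi_le (z := fun i => Z i ω) hω h7 (of_not_not hcon'.1))
  have h := negligible_estimating_equation hZ hind
    (ψ := fun z => psi w m psiBeta z (θ₀, β₀))
    (J := fun z => fderiv ℝ (psi w m psiBeta z) (θ₀, β₀))
    (Δ := fun N ω => ((θHat N ω, βHat N ω) : Param K de dg) - (θ₀, β₀))
    (δ := fun N ω => ‖βHat N ω - β₀‖)
    hR.integrable_jacobian hR.nonsingular hG hδ hβ (bddInProb_normalized_sum_psi hR hZ hind) hev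
  have h2 := h.2.comp_clm ((ContinuousLinearMap.proj (R := ℝ) (φ := fun _ : Fin K => ℝ) k).comp
    (ContinuousLinearMap.fst ℝ (Fin K → ℝ) (Beta de dg)))
  refine h2.of_forall_le fun N ω => le_of_eq ?_
  congr 1
  simp_rw [parInfluence_eq hR hp]
  rw [map_smul, map_sum]
  simp [Prod.fst_sum, Finset.sum_apply]

end EstimatingFunctionRoot

/-! ### Asymptotic linearity and asymptotic normality of the estimator of `τ`. -/

section AsymptoticLinearity

variable {K de dg : ℕ} {M d : Fin K → ℕ} {P : ProbabilityMeasure (Obs M d)} {w : Weights M d}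
  {m : WorkingModel M d de dg} {psiBeta : Obs M d → Beta de dg → Beta de dg}
  {Ω₀ : Set (Param K de dg)} {θ₀ : Fin K → ℝ} {β₀ : Beta de dg}
  {Ω : Type*} [MeasurableSpace Ω] {μ : Measure Ω} [IsProbabilityMeasure μ]
  {Z : ℕ → Ω → Obs M d}

/-- Centred indicator of the cluster type. -/
def typeResidual (P : ProbabilityMeasure (Obs M d)) (k : Fin K) (z : Obs M d) : ℝ :=
  (if z.1 = k then 1 else 0) - typeProb P k

theorem measurable_typeIndicator (k : Fin K) :
    Measurable (fun z : Obs M d => if z.1 = k then (1 : ℝ) else 0) :=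
  Measurable.ite (measurableSet_type k) measurable_const measurable_const

theorem integrable_typeIndicator (k : Fin K) :
    Integrable (fun z : Obs M d => if z.1 = k then (1 : ℝ) else 0) (P : Measure (Obs M d)) :=
  Integrable.of_bound (C := 1) (measurable_typeIndicator k).aestronglyMeasurable
    (ae_of_all _ fun z => by split_ifs <;> simp)

theorem integral_typeIndicator (k : Fin K) :
    ∫ z : Obs M d, (if z.1 = k then (1 : ℝ) else 0) ∂(P : Measure (Obs M d)) = typeProb P k := by
  have h2 : (fun z : Obs M d => if z.1 = k then (1 : ℝ) else 0) = {z | z.1 = k}.indicator 1 := by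
    ext z; simp [Set.indicator_apply]
  rw [h2, integral_indicator_one (measurableSet_type k)]
  rfl

theorem typeResidual_memLp (k : Fin K) :
    MemLp (typeResidual P k) 2 (P : Measure (Obs M d)) ∧
      ∫ z, typeResidual P k z ∂(P : Measure (Obs M d)) = 0 := by
  constructor
  · refine MemLp.of_bound (C := 1 + |typeProb P k|)
      ((measurable_typeIndicator k).sub_const _).aestronglyMeasurable (ae_of_all _ fun z => ?_)
    refine (norm_sub_le _ _).trans (add_le_add ?_ le_rfl)
    split_ifs <;> simp
  · unfold typeResidual
    rw [integral_sub (integrable_typeIndicator k) (integrable_const _), integral_typeIndicator]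
    simp

omit [MeasurableSpace Ω] in
theorem sqrt_mul_pHat_sub (N : ℕ) (ω : Ω) (k : Fin K) :
    √(N : ℝ) * (pHat Z N ω k - typeProb P k)
      = (√(N : ℝ))⁻¹ * ∑ i ∈ Finset.range N, typeResidual P k (Z i ω) := by
  -- For `N = 0` both sides are zero by the convention `0⁻¹ = 0`, so the identity is exact for all
  -- `N`.
  rcases Nat.eq_zero_or_pos N with rfl | hN
  · simp
  · have hN' : (0 : ℝ) < N := by exact_mod_cast hN
    have hs : 0 < √(N : ℝ) := Real.sqrt_pos.2 hN'
    have hss : (N : ℝ) = √(N : ℝ) * √(N : ℝ) := (Real.mul_self_sqrt hN'.le).symm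
    have h1 : ∑ i ∈ Finset.range N, typeResidual P k (Z i ω)
        = N * (pHat Z N ω k - typeProb P k) := by
      simp only [typeResidual, Finset.sum_sub_distrib, pHat, Finset.sum_boole, Finset.sum_const,
        Finset.card_range, nsmul_eq_mul]
      field_simp
    rw [h1, ← mul_assoc]
    congr 1
    rw [inv_mul_eq_div, eq_div_iff hs.ne', ← hss]

theorem memLp_tauInfluence (v : Fin K → ℝ → ℝ) {φ : Fin K → Obs M d → ℝ}
    (hφ : ∀ k, MemLp (φ k) 2 (P : Measure (Obs M d)) ∧ ∫ z, φ k z ∂(P : Measure (Obs M d)) = 0) :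
    MemLp (tauInfluence P v θ₀ φ) 2 (P : Measure (Obs M d)) ∧
      ∫ z, tauInfluence P v θ₀ φ z ∂(P : Measure (Obs M d)) = 0 := by
  have h1 : ∀ k, MemLp (fun z => v k (typeProb P k) * φ k z
      + typeResidual P k z * deriv (v k) (typeProb P k) * θ₀ k) 2 (P : Measure (Obs M d)) :=
    fun k => ((hφ k).1.const_mul _).add
      (((typeResidual_memLp k).1.mul_const (deriv (v k) (typeProb P k))).mul_const (θ₀ k))
  refine ⟨memLp_finsetSum _ fun k _ => h1 k, ?_⟩
  change ∫ z, ∑ k, (v k (typeProb P k) * φ k z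
      + typeResidual P k z * deriv (v k) (typeProb P k) * θ₀ k) ∂(P : Measure (Obs M d)) = 0
  rw [integral_finsetSum _ fun k _ => (h1 k).integrable (by norm_num)]
  refine Finset.sum_eq_zero fun k _ => ?_
  rw [integral_add, integral_const_mul, integral_mul_const, integral_mul_const, (hφ k).2,
    (typeResidual_memLp k).2]
  · simp
  · exact ((hφ k).1.const_mul _).integrable (by norm_num)
  · exact (((typeResidual_memLp k).1.mul_const _).mul_const _).integrable (by norm_num)

/-- Stated around the population root `θ₀`, with no working model assumed correct. Correctness
matters only for recognising `θ₀` as the causal parameter. -/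
theorem isAsymptoticallyLinear_tauHat (hR : RegularityConditions P w m psiBeta Ω₀ (θ₀, β₀))
    (hZ : ∀ i, HasLaw (Z i) (P : Measure (Obs M d)) μ) (hind : iIndepFun Z μ)
    (hp : ∀ k, 0 < typeProb P k) {v : Fin K → ℝ → ℝ} (hv : ∀ k, ContDiff ℝ 1 (v k))
    {θHat : ℕ → Ω → Fin K → ℝ} {βHat : ℕ → Ω → Beta de dg}
    (hsol : Tendsto (fun N => μ {ω | ∑ i ∈ Finset.range N,
      psi w m psiBeta (Z i ω) (θHat N ω, βHat N ω) ≠ 0}) atTop (𝓝 0))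
    (hlim : TendstoInMeasure μ βHat atTop (fun _ => β₀)) :
    IsAsymptoticallyLinear μ P Z (tauHat v Z θHat) (∑ k, v k (typeProb P k) * θ₀ k)
      (tauInfluence P v θ₀ (parInfluence P w m psiBeta θ₀ β₀)) := by
  have hφ := memLp_parInfluence hR hp
  obtain ⟨h1, h2⟩ := memLp_tauInfluence (θ₀ := θ₀) v hφ
  refine ⟨h1, h2, negligibleInProb_iff_zero.1 ?_⟩
  have key : ∀ k, NegligibleInProb μ (fun (N : ℕ) ω =>
      √(N : ℝ) * (v k (pHat Z N ω k) * θHat N ω k - v k (typeProb P k) * θ₀ k)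
      - (v k (typeProb P k) * ((√(N : ℝ))⁻¹ * ∑ i ∈ Finset.range N,
          parInfluence P w m psiBeta θ₀ β₀ k (Z i ω))
        + ((√(N : ℝ))⁻¹ * ∑ i ∈ Finset.range N, typeResidual P k (Z i ω))
          * deriv (v k) (typeProb P k) * θ₀ k)) := by
    intro k
    have hres := typeResidual_memLp (P := P) k
    refine negligible_delta_mul (((hv k).differentiable one_ne_zero) _) ?_
      (bddInProb_normalized_sum hZ hind hres.1 hres.2) ?_
      (negligible_theta_sub_parInfluence hR hZ hind hp hsol hlim k)
      (bddInProb_normalized_sum hZ hind (hφ k).1 (hφ k).2)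
    -- The sample fraction is itself an average, so its expansion has no remainder.
    · intro ε hε
      simp_rw [sqrt_mul_pHat_sub]
      simp [hε.not_ge]
    · have h3 := negligibleInProb_iff.2 (tendstoInMeasure_average hZ hind
        (integrable_typeIndicator (P := P) k))
      rw [integral_typeIndicator] at h3
      refine h3.of_forall_le fun N ω => le_of_eq ?_
      rw [pHat, Finset.sum_boole, smul_eq_mul, div_eq_inv_mul]
  refine (NegligibleInProb.sum Finset.univ fun k _ => key k).of_forall_le fun N ω => le_of_eq ?_
  congr 1
  have h4 : ∑ i ∈ Finset.range N, tauInfluence P v θ₀ (parInfluence P w m psiBeta θ₀ β₀) (Z i ω)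
      = ∑ k, (v k (typeProb P k) * ∑ i ∈ Finset.range N,
          parInfluence P w m psiBeta θ₀ β₀ k (Z i ω)
        + (∑ i ∈ Finset.range N, typeResidual P k (Z i ω))
          * deriv (v k) (typeProb P k) * θ₀ k) := by
    simp only [tauInfluence]
    rw [Finset.sum_comm]
    refine Finset.sum_congr rfl fun k _ => ?_
    rw [Finset.sum_add_distrib, Finset.mul_sum, Finset.sum_mul, Finset.sum_mul]
    rfl
  rw [h4, tauHat, ← Finset.sum_sub_distrib, Finset.mul_sum, Finset.mul_sum,
    ← Finset.sum_sub_distrib]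
  refine Finset.sum_congr rfl fun k _ => ?_
  ring

omit [IsProbabilityMeasure μ] in
theorem IsAsymptoticallyLinear.congr {φ φ' : Obs M d → ℝ} {T : ℕ → Ω → ℝ} {τ : ℝ}
    (h : IsAsymptoticallyLinear μ P Z T τ φ) (hφ : φ =ᵐ[(P : Measure (Obs M d))] φ')
    (hZ : ∀ i, HasLaw (Z i) (P : Measure (Obs M d)) μ) :
    IsAsymptoticallyLinear μ P Z T τ φ' := by
  obtain ⟨h1, h2, h3⟩ := h
  refine ⟨(memLp_congr_ae hφ).1 h1, (integral_congr_ae hφ).symm.trans h2, ?_⟩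
  refine h3.congr_left fun N => ?_
  have hae : ∀ᵐ ω ∂μ, ∀ i, φ (Z i ω) = φ' (Z i ω) := ae_all_iff.2 fun i =>
    ae_of_ae_map (hZ i).aemeasurable (by rw [(hZ i).map_eq]; exact hφ)
  filter_upwards [hae] with ω hω
  simp [hω]

/-- The central limit theorem for the linear term, then Slutsky's lemma for the remainder. -/
theorem IsAsymptoticallyLinear.tendstoInDistribution {φ : Obs M d → ℝ} {T : ℕ → Ω → ℝ} {τ : ℝ}
    (h : IsAsymptoticallyLinear μ P Z T τ φ)
    (hZ : ∀ i, HasLaw (Z i) (P : Measure (Obs M d)) μ) (hind : iIndepFun Z μ)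
    (hT : ∀ N, AEMeasurable (T N) μ) :
    TendstoInDistribution (fun (N : ℕ) ω => √(N : ℝ) * (T N ω - τ)) atTop id (fun _ => μ)
      (gaussianReal 0 (Var[φ; (P : Measure (Obs M d))]).toNNReal) := by
  set g := h.1.1.mk φ with hg
  have hgm : StronglyMeasurable g := h.1.1.stronglyMeasurable_mk
  have hφg : φ =ᵐ[(P : Measure (Obs M d))] g := h.1.1.ae_eq_mk
  rw [variance_congr hφg]
  obtain ⟨h1, h2, h3⟩ := h.congr hφg hZ
  have hid : ∀ i, IdentDistrib (fun ω => g (Z i ω)) (fun ω => g (Z 0 ω)) μ μ := fun i =>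
    ((hZ i).identDistrib (hZ 0)).comp hgm.measurable
  have hvar : Var[fun ω => g (Z 0 ω); μ] = Var[g; (P : Measure (Obs M d))] := by
    rw [← (hZ 0).map_eq, variance_map hgm.aestronglyMeasurable.aemeasurable (hZ 0).aemeasurable]
    rfl
  have hmean : μ[fun ω => g (Z 0 ω)] = 0 := by
    rw [← h2, ← (hZ 0).map_eq, integral_map (hZ 0).aemeasurable hgm.aestronglyMeasurable]
  have hmem : MemLp (fun ω => g (Z 0 ω)) 2 μ := by
    have h4 := h1
    rw [← (hZ 0).map_eq] at h4
    exact h4.comp_of_map (hZ 0).aemeasurable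
  have hclt := tendstoInDistribution_inv_sqrt_mul_sum_sub (P := μ)
    (P' := gaussianReal 0 (Var[g; (P : Measure (Obs M d))]).toNNReal) (Y := id)
    (X := fun i ω => g (Z i ω)) (by rw [hvar]; exact ⟨aemeasurable_id, Measure.map_id⟩) hmem
    (hind.comp (fun _ => g) fun _ => hgm.measurable) hid
  rw [hmean] at hclt
  have hgZ : ∀ i, AEMeasurable (fun ω => g (Z i ω)) μ := fun i =>
    hgm.measurable.comp_aemeasurable (hZ i).aemeasurable
  have hsum := hclt.add_of_tendstoInMeasure_const h3 fun N =>
    (((hT N).sub_const τ).const_mul _).sub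
      ((Finset.aemeasurable_fun_sum _ fun i _ => hgZ i).const_mul _)
  refine TendstoInDistribution.congr (fun N => ?_) ?_ hsum
  · refine ae_of_all _ fun ω => ?_
    simp
  · refine ae_of_all _ fun ω => ?_
    simp

end AsymptoticLinearity

/-! ### The causal parameter as the root, and the influence function when both models are correct.
-/

section LocalEfficiency

variable {K de dg : ℕ} {M d : Fin K → ℕ} {Q : ProbabilityMeasure (Full M d)} {w : Weights M d}
  {m : WorkingModel M d de dg} {psiBeta : Obs M d → Beta de dg → Beta de dg}
  {Ω₀ : Set (Param K de dg)} {θ₀ : Fin K → ℝ} {β₀ : Beta de dg}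

theorem measurable_psiTheta (hw : ∀ k a, Measurable (w k a)) (η : Param K de dg) (k : Fin K) :
    Measurable (fun z : Obs M d => psiTheta w m z η k) := by
  refine measurable_of_measurable_comp_mk fun j => ?_
  unfold psiTheta
  by_cases h : j = k
  · simp only [h, if_true]
    exact (measurable_clusterAipw (hw j) (m.measurable_e _ j) (m.measurable_g _ j)).sub_const _
  · simp only [h, if_false]
    exact measurable_const

/-- The causal parameter is the population root of the estimating equation. -/
theorem root_eq_causalTheta (hQ : CausalAssumptions Q) (hp : ∀ k, 0 < typeProb (observedLaw Q) k)
    (hw : ∀ k a, Measurable (w k a))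
    (hθ : ∀ k a, Integrable (fun u : TypeFull (M k) (d k) => w k a u.2.2 ⬝ᵥ u.1 a) (typeLaw Q k))
    (hR : RegularityConditions (observedLaw Q) w m psiBeta Ω₀ (θ₀, β₀))
    (hβ : IsTrueE (observedLaw Q) m β₀.1 ∨ IsTrueG (observedLaw Q) m β₀.2) :
    θ₀ = causalTheta w Q := by
  ext k
  have h1 := memLp_clm_psi hR
    ((ContinuousLinearMap.proj (R := ℝ) (φ := fun _ : Fin K => ℝ) k).comp
      (ContinuousLinearMap.fst ℝ (Fin K → ℝ) (Beta de dg)))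
  have h2 := integral_psiTheta hw hθ hQ hp θ₀ β₀ k hβ (h1.1.integrable (by norm_num))
  have h3 : ∫ z, psiTheta w m z (θ₀, β₀) k ∂(observedLaw Q : Measure (Obs M d)) = 0 := h1.2
  rw [h3] at h2
  rcases mul_eq_zero.1 h2.symm with h4 | h4
  · exact absurd h4 (hp k).ne'
  · linarith

/-- If the mean is zero along a line through `β₀`, its derivative there is zero. No interchange of
limits is needed: the integrated Taylor bound reads `t |c| ≤ C t²` for the expected derivative `c`,
and `t` tends to zero from the right. -/
theorem integral_fderiv_apply_eq_zero {P : ProbabilityMeasure (Obs M d)}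
    (hw : ∀ k a, Measurable (w k a))
    (hR : RegularityConditions P w m psiBeta Ω₀ (θ₀, β₀)) (k : Fin K) (b : Beta de dg)
    (h : ∀ t : ℝ, Integrable (fun z => psiTheta w m z (θ₀, β₀ + t • b) k)
        (P : Measure (Obs M d)) →
      ∫ z, psiTheta w m z (θ₀, β₀ + t • b) k ∂(P : Measure (Obs M d)) = 0) :
    (∫ z, fderiv ℝ (fun b => psiTheta w m z (θ₀, b) k) β₀ ∂(P : Measure (Obs M d))) b = 0 := by
  obtain ⟨r, hr, -, G, hG, htaylor⟩ := exists_taylor_psi hR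
  let L : Param K de dg →L[ℝ] ℝ :=
    (ContinuousLinearMap.proj (R := ℝ) (φ := fun _ : Fin K => ℝ) k).comp
      (ContinuousLinearMap.fst ℝ (Fin K → ℝ) (Beta de dg))
  have hL : ∀ x : Param K de dg, |L x| ≤ ‖x‖ := fun x =>
    (norm_le_pi_norm x.1 k).trans (le_max_left _ _)
  set J := fun z => fderiv ℝ (psi w m psiBeta z) (θ₀, β₀) with hJ
  have hJi : Integrable (fun z => L (J z (0, b))) (P : Measure (Obs M d)) :=
    L.integrable_comp (hR.integrable_jacobian.apply_continuousLinearMap _)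
  have hψ := memLp_clm_psi hR L
  have hval : (∫ z, fderiv ℝ (fun b => psiTheta w m z (θ₀, b) k) β₀ ∂(P : Measure (Obs M d))) b
      = ∫ z, L (J z (0, b)) ∂(P : Measure (Obs M d)) := by
    rw [L.integral_comp_comm (hR.integrable_jacobian.apply_continuousLinearMap _),
      ← ContinuousLinearMap.integral_apply hR.integrable_jacobian, integral_jacobian_apply hR]
    simp [L]
  rw [hval]
  set c := ∫ z, L (J z (0, b)) ∂(P : Measure (Obs M d)) with hc
  set C := (∫ z, G z ∂(P : Measure (Obs M d))) * ‖b‖ ^ 2 with hC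
  have key : ∀ᶠ t : ℝ in 𝓝[>] 0, |c| ≤ t * C := by
    have hsmall : ∀ᶠ t : ℝ in 𝓝[>] 0, t * ‖b‖ < r := by
      have h1 : Tendsto (fun t : ℝ => t * ‖b‖) (𝓝[>] 0) (𝓝 (0 * ‖b‖)) :=
        (tendsto_id.mul_const _).mono_left nhdsWithin_le_nhds
      rw [zero_mul] at h1
      exact h1.eventually_lt_const hr
    filter_upwards [hsmall, self_mem_nhdsWithin] with t ht ht0
    have ht0' : 0 < t := ht0
    have hnorm : ‖((θ₀, β₀ + t • b) : Param K de dg) - (θ₀, β₀)‖ = t * ‖b‖ := by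
      have h0 : ((θ₀, β₀ + t • b) : Param K de dg) - (θ₀, β₀) = t • (0, b) := by simp
      rw [h0, norm_smul, Real.norm_of_nonneg ht0'.le, Prod.norm_def, norm_zero,
        max_eq_right (norm_nonneg _)]
    have hR' : ∀ᵐ z ∂(P : Measure (Obs M d)), |psiTheta w m z (θ₀, β₀ + t • b) k
        - L (psi w m psiBeta z (θ₀, β₀)) - t * L (J z (0, b))| ≤ G z * (t * ‖b‖) ^ 2 := by
      filter_upwards [htaylor] with z hz
      have h1 := hz.2 (θ₀, β₀ + t • b) (by rw [Metric.mem_ball, dist_eq_norm, hnorm]; exact ht)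
      rw [hnorm] at h1
      refine le_trans ?_ h1
      refine le_trans (le_of_eq ?_) (hL _)
      congr 1
      have h2 : ((θ₀, β₀ + t • b) : Param K de dg) - (θ₀, β₀) = t • (0, b) := by simp
      rw [h2, map_smul, map_sub, map_sub, map_smul]
      rfl
    have hmeas : AEStronglyMeasurable (fun z => psiTheta w m z (θ₀, β₀ + t • b) k
        - L (psi w m psiBeta z (θ₀, β₀)) - t * L (J z (0, b))) (P : Measure (Obs M d)) :=
      ((measurable_psiTheta hw _ k).aestronglyMeasurable.sub hψ.1.1).sub (hJi.const_mul t).1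
    have hRi := (hG.mul_const ((t * ‖b‖) ^ 2)).mono' hmeas hR'
    -- Integrability at `β₀ + t • b` is not given. It follows from the Taylor bound, and only then
    -- may `h` be applied.
    have hpi : Integrable (fun z => psiTheta w m z (θ₀, β₀ + t • b) k)
        (P : Measure (Obs M d)) := by
      refine ((hRi.add (hJi.const_mul t)).add (hψ.1.integrable (by norm_num))).congr
        (ae_of_all _ fun z => ?_)
      simp only [Pi.add_apply]
      ring
    have h3 : ∫ z, (psiTheta w m z (θ₀, β₀ + t • b) k
        - L (psi w m psiBeta z (θ₀, β₀)) - t * L (J z (0, b))) ∂(P : Measure (Obs M d))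
          = -(t * c) := by
      rw [integral_sub, integral_sub hpi (hψ.1.integrable (by norm_num)), h t hpi, hψ.2,
        integral_const_mul]
      · ring
      · exact hpi.sub (hψ.1.integrable (by norm_num))
      · exact hJi.const_mul t
    have h4 : |t * c| ≤ (∫ z, G z ∂(P : Measure (Obs M d))) * (t * ‖b‖) ^ 2 := by
      rw [← abs_neg, ← h3, ← integral_mul_const]
      exact norm_integral_le_of_norm_le (hG.mul_const ((t * ‖b‖) ^ 2))
        (f := fun z => psiTheta w m z (θ₀, β₀ + t • b) k
          - L (psi w m psiBeta z (θ₀, β₀)) - t * L (J z (0, b))) hR'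
    rw [abs_mul, abs_of_pos ht0'] at h4
    have h5 : t * |c| ≤ t * (t * C) := by
      refine h4.trans (le_of_eq ?_)
      rw [hC]
      ring
    exact le_of_mul_le_mul_left h5 ht0'
  have hlim : Tendsto (fun t : ℝ => t * C) (𝓝[>] 0) (𝓝 (0 * C)) :=
    (tendsto_id.mul_const _).mono_left nhdsWithin_le_nhds
  rw [zero_mul] at hlim
  exact abs_nonpos_iff.1 (ge_of_tendsto hlim key)

/-- Double robustness in infinitesimal form: the estimating function of `θ` stays unbiased when one
of `β_e`, `β_g` is moved and the other kept true. Such directions span, so the expected gradient in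
`β` is zero. -/
theorem parInfluence_eq_plugInfluence (hQ : CausalAssumptions Q)
    (hp : ∀ k, 0 < typeProb (observedLaw Q) k) (hw : ∀ k a, Measurable (w k a))
    (hθ : ∀ k a, Integrable (fun u : TypeFull (M k) (d k) => w k a u.2.2 ⬝ᵥ u.1 a) (typeLaw Q k))
    (hR : RegularityConditions (observedLaw Q) w m psiBeta Ω₀ (θ₀, β₀))
    (hE : IsTrueE (observedLaw Q) m β₀.1) (hG : IsTrueG (observedLaw Q) m β₀.2) :
    parInfluence (observedLaw Q) w m psiBeta θ₀ β₀
      = plugInfluence (observedLaw Q) w θ₀ (m.e β₀.1) (m.g β₀.2) := by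
  ext k z
  have hroot := root_eq_causalTheta hQ hp hw hθ hR (Or.inl hE)
  have h1 : ∀ b : Beta de dg, (∫ z, fderiv ℝ (fun b => psiTheta w m z (θ₀, b) k) β₀
      ∂(observedLaw Q : Measure (Obs M d))) b = 0 := by
    intro b
    have hb : b = (b.1, 0) + (0, b.2) := by simp
    rw [hb, map_add]
    rw [integral_fderiv_apply_eq_zero hw hR k (b.1, 0), integral_fderiv_apply_eq_zero hw hR k
      (0, b.2), add_zero]
    · intro t hi
      rw [integral_psiTheta hw hθ hQ hp _ _ k (Or.inl (by simpa using hE)) hi, hroot]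
      simp
    · intro t hi
      rw [integral_psiTheta hw hθ hQ hp _ _ k (Or.inr (by simpa using hG)) hi, hroot]
      simp
  rw [parInfluence, h1, sub_zero]
  rfl

theorem aipw_congr {P : ProbabilityMeasure (Obs M d)}
    {e e' : ∀ k : Fin K, Treat (M k) → (Fin (d k) → ℝ) → ℝ}
    {g g' : ∀ k : Fin K, Treat (M k) → (Fin (d k) → ℝ) → (Fin (M k) → ℝ)}
    (he : ∀ k a, ∀ᵐ x ∂(covLaw P k), e k a x = e' k a x)
    (hg : ∀ k a, ∀ᵐ x ∂(covLaw P k), g k a x = g' k a x) :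
    aipw w e g =ᵐ[(P : Measure (Obs M d))] aipw w e' g' :=
  ae_of_forall_ae_typeLaw P fun k => by
    filter_upwards [clusterAipw_congr (typeLaw P k) (w := w k) (he k) (hg k)] with o ho
    exact ho

theorem plugInfluence_congr {P : ProbabilityMeasure (Obs M d)} (θ : Fin K → ℝ)
    {e e' : ∀ k : Fin K, Treat (M k) → (Fin (d k) → ℝ) → ℝ}
    {g g' : ∀ k : Fin K, Treat (M k) → (Fin (d k) → ℝ) → (Fin (M k) → ℝ)}
    (he : ∀ k a, ∀ᵐ x ∂(covLaw P k), e k a x = e' k a x)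
    (hg : ∀ k a, ∀ᵐ x ∂(covLaw P k), g k a x = g' k a x) :
    ∀ᵐ z ∂(P : Measure (Obs M d)), ∀ k,
      plugInfluence P w θ e g k z = plugInfluence P w θ e' g' k z := by
  filter_upwards [aipw_congr (w := w) he hg] with z hz k
  simp only [plugInfluence, hz]

theorem tauInfluence_congr {P : ProbabilityMeasure (Obs M d)} (v : Fin K → ℝ → ℝ) (θ : Fin K → ℝ)
    {φ φ' : Fin K → Obs M d → ℝ} (h : ∀ᵐ z ∂(P : Measure (Obs M d)), ∀ k, φ k z = φ' k z) :
    tauInfluence P v θ φ =ᵐ[(P : Measure (Obs M d))] tauInfluence P v θ φ' := by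
  filter_upwards [h] with z hz
  simp only [tauInfluence, hz]

end LocalEfficiency

/-! ### Inequalities and limits for square-integrable functions. -/

section SquareIntegrable

variable {E : Type*} [MeasurableSpace E] {μ : Measure E}

theorem sq_integral_mul_le {f g : E → ℝ} (hf : MemLp f 2 μ) (hg : MemLp g 2 μ) :
    (∫ z, f z * g z ∂μ) ^ 2 ≤ (∫ z, f z ^ 2 ∂μ) * ∫ z, g z ^ 2 ∂μ := by
  have hfg : Integrable (fun z => f z * g z) μ := hf.integrable_mul hg
  have h : ∀ x : ℝ, 0 ≤ (∫ z, f z ^ 2 ∂μ) * (x * x) + (2 * ∫ z, f z * g z ∂μ) * x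
      + ∫ z, g z ^ 2 ∂μ := by
    intro x
    have h1 : ∫ z, (x * f z + g z) ^ 2 ∂μ = (∫ z, f z ^ 2 ∂μ) * (x * x)
        + (2 * ∫ z, f z * g z ∂μ) * x + ∫ z, g z ^ 2 ∂μ := by
      have h2 : ∀ z, (x * f z + g z) ^ 2 = (x * x) * f z ^ 2 + (2 * x) * (f z * g z) + g z ^ 2 :=
        fun z => by ring
      simp_rw [h2]
      rw [integral_add, integral_add, integral_const_mul, integral_const_mul]
      · ring
      · exact hf.integrable_sq.const_mul _
      · exact hfg.const_mul _
      · exact (hf.integrable_sq.const_mul _).add (hfg.const_mul _)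
      · exact hg.integrable_sq
    rw [← h1]
    exact integral_nonneg fun z => sq_nonneg _
  have h3 := discrim_le_zero h
  rw [discrim] at h3
  linarith [h3]

theorem integral_sq_eq_toReal_eLpNorm {f : E → ℝ} (hf : MemLp f 2 μ) :
    ∫ z, f z ^ 2 ∂μ = (eLpNorm f 2 μ).toReal ^ 2 := by
  rw [hf.eLpNorm_eq_integral_rpow_norm two_ne_zero ENNReal.ofNat_ne_top,
    ENNReal.toReal_ofReal (by positivity)]
  simp only [ENNReal.toReal_ofNat, Real.rpow_two, Real.norm_eq_abs, sq_abs]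
  rw [← Real.rpow_natCast, ← Real.rpow_mul (integral_nonneg fun z => sq_nonneg _)]
  norm_num

theorem integral_sq_add_le {f g : E → ℝ} (hf : MemLp f 2 μ) (hg : MemLp g 2 μ) :
    ∫ z, (f z + g z) ^ 2 ∂μ ≤ 2 * ∫ z, f z ^ 2 ∂μ + 2 * ∫ z, g z ^ 2 ∂μ := by
  rw [← integral_const_mul, ← integral_const_mul,
    ← integral_add (hf.integrable_sq.const_mul 2) (hg.integrable_sq.const_mul 2)]
  refine integral_mono (hf.add hg).integrable_sq
    ((hf.integrable_sq.const_mul 2).add (hg.integrable_sq.const_mul 2)) fun z => ?_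
  change (f z + g z) ^ 2 ≤ 2 * f z ^ 2 + 2 * g z ^ 2
  nlinarith [sq_nonneg (f z - g z)]

/-- Dominated convergence for a fixed integrable function multiplied by uniformly bounded
functions that tend to zero in `L¹`. -/
theorem tendsto_integral_mul_of_bdd [IsFiniteMeasure μ] {ι : Type*} {l : Filter ι} {F : E → ℝ}
    (hF : Integrable F μ) {b : ι → E → ℝ} {B : ℝ}
    (hb : ∀ᶠ t in l, AEStronglyMeasurable (b t) μ ∧ ∀ z, |b t z| ≤ B)
    (hlim : Tendsto (fun t => ∫ z, |b t z| ∂μ) l (𝓝 0)) :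
    Tendsto (fun t => ∫ z, |F z| * |b t z| ∂μ) l (𝓝 0) := by
  refine squeeze_zero_norm' (a := fun t => ∫ z, |F z| * |b t z| ∂μ) ?_ ?_
  · refine Eventually.of_forall fun t => ?_
    rw [Real.norm_of_nonneg (integral_nonneg fun z => by positivity)]
  refine (tendsto_order.2 ⟨fun a ha => ?_, fun ε hε => ?_⟩)
  · exact Eventually.of_forall fun t => lt_of_lt_of_le ha (integral_nonneg fun z => by positivity)
  · have hB : 0 < |B| + 1 := by positivity
    -- `F` is split into a bounded simple function and a part small in `L¹`: against the first, `b
    -- t` is small in `L¹`; against the second, it is uniformly bounded.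
    obtain ⟨G, hG, -⟩ := (memLp_one_iff_integrable.2 hF).exists_simpleFunc_eLpNorm_sub_lt
      ENNReal.one_ne_top (ε := ENNReal.ofReal (ε / 2 / (|B| + 1)))
      (by rw [ne_eq, ENNReal.ofReal_eq_zero, not_le]; positivity)
    obtain ⟨C, hC⟩ := G.exists_forall_norm_le
    have hGi : Integrable G μ :=
      Integrable.of_bound (C := C) G.measurable.aestronglyMeasurable (ae_of_all _ hC)
    have hFG : ∫ z, |F z - G z| ∂μ < ε / 2 / (|B| + 1) := by
      have h1 : ∫ z, ‖(F - G) z‖ ∂μ = (eLpNorm (F - ⇑G) 1 μ).toReal := by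
        rw [integral_norm_eq_lintegral_enorm (hF.sub hGi).1, eLpNorm_one_eq_lintegral_enorm]
      have h2 : (eLpNorm (F - ⇑G) 1 μ).toReal < ε / 2 / (|B| + 1) := by
        refine (ENNReal.toReal_lt_toReal (ne_top_of_lt hG) ENNReal.ofReal_ne_top).2 hG |>.trans_eq ?_
        exact ENNReal.toReal_ofReal (by positivity)
      exact h1.trans_lt h2
    have hC0 : 0 < |C| + 1 := by positivity
    have hev : ∀ᶠ t in l, ∫ z, |b t z| ∂μ < ε / 2 / (|C| + 1) :=
      hlim.eventually_lt_const (by positivity)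
    filter_upwards [hb, hev] with t ht1 ht2
    have hbi : Integrable (b t) μ := Integrable.of_bound (C := B) ht1.1 (ae_of_all _ ht1.2)
    have hi1 : Integrable (fun z => |F z - G z| * (|B| + 1)) μ := (hF.sub hGi).abs.mul_const _
    have hi2 : Integrable (fun z => (|C| + 1) * |b t z|) μ := hbi.abs.const_mul _
    have hi3 : Integrable (fun z => |F z| * |b t z|) μ :=
      hF.abs.mul_bdd (c := B) (hbi.abs.1) (ae_of_all _ fun z => by simpa using ht1.2 z)
    calc ∫ z, |F z| * |b t z| ∂μ
        ≤ ∫ z, (|F z - G z| * (|B| + 1) + (|C| + 1) * |b t z|) ∂μ := by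
          refine integral_mono hi3 (hi1.add hi2) fun z => ?_
          have h1 : |F z| ≤ |F z - G z| + |G z| := by
            have := abs_add_le (F z - G z) (G z)
            simpa using this
          have h2 : |G z| ≤ |C| + 1 := (hC z).trans (by linarith [le_abs_self C])
          have h3 : |b t z| ≤ |B| + 1 := (ht1.2 z).trans (by linarith [le_abs_self B])
          calc |F z| * |b t z| ≤ (|F z - G z| + |G z|) * |b t z| := by gcongr
            _ = |F z - G z| * |b t z| + |G z| * |b t z| := by ring
            _ ≤ |F z - G z| * (|B| + 1) + (|C| + 1) * |b t z| := by gcongr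
      _ = (∫ z, |F z - G z| ∂μ) * (|B| + 1) + (|C| + 1) * ∫ z, |b t z| ∂μ := by
          rw [integral_add hi1 hi2, integral_mul_const, integral_const_mul]
      _ < ε / 2 + ε / 2 := by
          refine add_lt_add ?_ ?_
          · exact (lt_div_iff₀ hB).1 hFG
          · rw [mul_comm]
            exact (lt_div_iff₀ hC0).1 ht2
      _ = ε := add_halves ε

end SquareIntegrable

/-! ### Regular submodels: differentiation of likelihood ratios and of means. -/

section RegularSubmodel

variable {E : Type} [MeasurableSpace E] {P : ProbabilityMeasure E}
  {path : ℝ → ProbabilityMeasure E} {s : E → ℝ}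

/-- Along a regular submodel the likelihood ratio itself is differentiable in `L²`. -/
theorem IsRegularSubmodel.exists_density (h : IsRegularSubmodel P path s) :
    ∃ (f : ℝ → E → ℝ) (C : ℝ), (∀ t, Measurable (f t)) ∧ 0 < C ∧
      (∀ᶠ t in 𝓝 (0 : ℝ), ∀ z, C⁻¹ ≤ f t z ∧ f t z ≤ C) ∧
      (∀ᶠ t in 𝓝 (0 : ℝ), (path t : Measure E)
        = (P : Measure E).withDensity (fun z => ENNReal.ofReal (f t z))) ∧
      Tendsto (fun t : ℝ => ∫ z, ((f t z - 1) / t - s z) ^ 2 ∂(P : Measure E)) (𝓝[≠] 0) (𝓝 0) := by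
  obtain ⟨f, hfm, ⟨C, hC, hbd⟩, hpath, hdqm⟩ := h.differentiable
  refine ⟨f, C, hfm, hC, hbd, hpath, ?_⟩
  have hs := h.score_memLp
  set R : ℝ → E → ℝ := fun t z => (√(f t z) - 1) / t - s z / 2 with hR
  set b : ℝ → E → ℝ := fun t z => √(f t z) - 1 with hb
  have hbm : ∀ t, Measurable (b t) := fun t => ((hfm t).sqrt).sub_const 1
  have hRm : ∀ t, AEStronglyMeasurable (R t) (P : Measure E) := fun t =>
    ((hbm t).div_const t).aestronglyMeasurable.sub
      (hs.1.mul_const (2⁻¹)|>.congr (ae_of_all _ fun z => (div_eq_mul_inv _ _).symm))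
  have hRL : ∀ᶠ t in 𝓝[≠] (0 : ℝ), MemLp (R t) 2 (P : Measure E) := by
    filter_upwards [hdqm.eventually_lt_const ENNReal.zero_lt_top] with t ht
    exact ⟨hRm t, ht⟩
  have hRint : Tendsto (fun t => ∫ z, R t z ^ 2 ∂(P : Measure E)) (𝓝[≠] 0) (𝓝 0) := by
    have h1 := (ENNReal.tendsto_toReal ENNReal.zero_ne_top).comp hdqm
    have h2 := h1.pow 2
    rw [ENNReal.toReal_zero, zero_pow two_ne_zero] at h2
    refine h2.congr' ?_
    filter_upwards [hRL] with t ht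
    rw [integral_sq_eq_toReal_eLpNorm ht]
    rfl
  set B := √C + 1 with hB
  have hB0 : 0 < B := by positivity
  have hbb : ∀ᶠ t in 𝓝[≠] (0 : ℝ), ∀ z, |b t z| ≤ B ∧ √(f t z) + 1 ≤ B ∧ 0 ≤ f t z := by
    filter_upwards [hbd.filter_mono nhdsWithin_le_nhds] with t ht z
    have h1 : √(f t z) ≤ √C := Real.sqrt_le_sqrt (ht z).2
    have h2 := Real.sqrt_nonneg (f t z)
    refine ⟨abs_le.2 ⟨?_, ?_⟩, by linarith, (inv_pos.2 hC).le.trans (ht z).1⟩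
    · change -B ≤ √(f t z) - 1
      linarith [Real.sqrt_nonneg C]
    · change √(f t z) - 1 ≤ B
      linarith
  have hs2 : MemLp (fun z => s z / 2) 2 (P : Measure E) := by
    simpa [div_eq_inv_mul] using hs.const_mul (2⁻¹)
  -- `√f - 1` equals `t (R + s / 2)` with a bracket bounded in `L²`, so its square has integral
  -- `O(t²)`.
  have hbsq : Tendsto (fun t => ∫ z, |b t z ^ 2| ∂(P : Measure E)) (𝓝[≠] 0) (𝓝 0) := by
    have h1 : Tendsto (fun t : ℝ => t ^ 2 * (2 * ∫ z, R t z ^ 2 ∂(P : Measure E)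
        + 2 * ∫ z, (s z / 2) ^ 2 ∂(P : Measure E))) (𝓝[≠] 0) (𝓝 (0 ^ 2 * (2 * 0
        + 2 * ∫ z, (s z / 2) ^ 2 ∂(P : Measure E)))) :=
      ((tendsto_id.mono_left nhdsWithin_le_nhds).pow 2).mul
        ((hRint.const_mul 2).add tendsto_const_nhds)
    rw [zero_pow two_ne_zero, zero_mul] at h1
    refine tendsto_of_tendsto_of_tendsto_of_le_of_le' tendsto_const_nhds h1
      (Eventually.of_forall fun t => integral_nonneg fun z => abs_nonneg _) ?_
    filter_upwards [hRL, self_mem_nhdsWithin] with t ht ht0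
    have ht0' : t ≠ 0 := ht0
    calc ∫ z, |b t z ^ 2| ∂(P : Measure E)
        = t ^ 2 * ∫ z, (R t z + s z / 2) ^ 2 ∂(P : Measure E) := by
          rw [← integral_const_mul]
          refine integral_congr_ae (ae_of_all _ fun z => ?_)
          change |b t z ^ 2| = t ^ 2 * (R t z + s z / 2) ^ 2
          rw [abs_of_nonneg (sq_nonneg _), hR, ← mul_pow]
          congr 1
          change b t z = t * (b t z / t - s z / 2 + s z / 2)
          field_simp
          ring
      _ ≤ _ := by
          gcongr
          exact integral_sq_add_le ht hs2
  have hsb := tendsto_integral_mul_of_bdd (μ := (P : Measure E)) (l := 𝓝[≠] (0 : ℝ))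
    (F := fun z => (s z / 2) ^ 2)
    (b := fun t z => b t z ^ 2) (B := B ^ 2) hs2.integrable_sq (by
      filter_upwards [hbb] with t ht
      refine ⟨((hbm t).pow_const 2).aestronglyMeasurable, fun z => ?_⟩
      rw [abs_pow]
      exact pow_le_pow_left₀ (abs_nonneg _) (ht z).1 2) hbsq
  have hfin : Tendsto (fun t => 2 * (B ^ 2 * ∫ z, R t z ^ 2 ∂(P : Measure E))
      + 2 * ∫ z, |(s z / 2) ^ 2| * |b t z ^ 2| ∂(P : Measure E)) (𝓝[≠] 0)
      (𝓝 (2 * (B ^ 2 * 0) + 2 * 0)) :=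
    ((hRint.const_mul (B ^ 2)).const_mul 2).add (hsb.const_mul 2)
  rw [mul_zero, mul_zero, add_zero] at hfin
  refine tendsto_of_tendsto_of_tendsto_of_le_of_le' tendsto_const_nhds hfin
      (Eventually.of_forall fun t => integral_nonneg fun z => sq_nonneg _) ?_
  filter_upwards [hRL, hbb] with t ht hbt
  have hbb' : ∀ᵐ z ∂(P : Measure E), ‖√(f t z) + 1‖ ≤ B := ae_of_all _ fun z => by
    rw [Real.norm_of_nonneg (by positivity)]
    exact (hbt z).2.1
  have hi1 : MemLp (fun z => R t z * (√(f t z) + 1)) 2 (P : Measure E) := by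
    refine MemLp.of_le_mul (c := B) ht
      (ht.1.mul ((hfm t).sqrt.add_const 1).aestronglyMeasurable) ?_
    filter_upwards [hbb'] with z hz
    rw [norm_mul, mul_comm]
    gcongr
  have hi2 : MemLp (fun z => s z / 2 * b t z) 2 (P : Measure E) := by
    refine MemLp.of_le_mul (c := B) hs2 (hs2.1.mul (hbm t).aestronglyMeasurable) ?_
    refine ae_of_all _ fun z => ?_
    rw [norm_mul, mul_comm]
    gcongr
    exact (hbt z).1
  -- From `f - 1 = (√f - 1)(√f + 1)` the error splits into `R (√f + 1)`, small because `√f` is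
  -- bounded, and `(s / 2)(√f - 1)`, small by dominated convergence against the fixed function `s²`.
  calc ∫ z, ((f t z - 1) / t - s z) ^ 2 ∂(P : Measure E)
      = ∫ z, (R t z * (√(f t z) + 1) + s z / 2 * b t z) ^ 2 ∂(P : Measure E) := by
        refine integral_congr_ae (ae_of_all _ fun z => ?_)
        have h1 : f t z = √(f t z) ^ 2 := (Real.sq_sqrt (hbt z).2.2).symm
        change ((f t z - 1) / t - s z) ^ 2 = (((√(f t z) - 1) / t - s z / 2) * (√(f t z) + 1)
          + s z / 2 * (√(f t z) - 1)) ^ 2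
        congr 1
        rw [h1, Real.sqrt_sq (Real.sqrt_nonneg _)]
        ring
    _ ≤ 2 * ∫ z, (R t z * (√(f t z) + 1)) ^ 2 ∂(P : Measure E)
        + 2 * ∫ z, (s z / 2 * b t z) ^ 2 ∂(P : Measure E) := integral_sq_add_le hi1 hi2
    _ ≤ _ := by
        refine add_le_add (mul_le_mul_of_nonneg_left ?_ zero_le_two)
          (mul_le_mul_of_nonneg_left ?_ zero_le_two)
        · rw [← integral_const_mul]
          refine integral_mono hi1.integrable_sq (ht.integrable_sq.const_mul _) fun z => ?_
          change (R t z * (√(f t z) + 1)) ^ 2 ≤ B ^ 2 * R t z ^ 2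
          rw [mul_pow, mul_comm]
          gcongr
          exact (hbt z).2.1
        · refine le_of_eq (integral_congr_ae (ae_of_all _ fun z => ?_))
          change (s z / 2 * b t z) ^ 2 = |(s z / 2) ^ 2| * |b t z ^ 2|
          rw [abs_of_nonneg (sq_nonneg _), abs_of_nonneg (sq_nonneg _), mul_pow]

theorem integral_withDensity_ofReal {μ : Measure E} {f : E → ℝ} (hf : Measurable f)
    (h0 : ∀ z, 0 ≤ f z) (h : E → ℝ) :
    ∫ z, h z ∂(μ.withDensity fun z => ENNReal.ofReal (f z)) = ∫ z, f z * h z ∂μ := by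
  rw [integral_withDensity_eq_integral_toReal_smul hf.ennreal_ofReal (by simp)]
  refine integral_congr_ae (ae_of_all _ fun z => ?_)
  simp [ENNReal.toReal_ofReal (h0 z)]

theorem memLp_of_le_bdd {μ : Measure E} [IsFiniteMeasure μ] {f : E → ℝ} (hf : Measurable f) {C : ℝ}
    (h : ∀ z, |f z| ≤ C) (p : ℝ≥0∞) : MemLp f p μ :=
  MemLp.of_bound hf.aestronglyMeasurable C (ae_of_all _ h)

/-- Pathwise derivative of a linear functional. -/
theorem IsRegularSubmodel.hasDerivAt_integral (h : IsRegularSubmodel P path s) {g : E → ℝ}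
    (hg : MemLp g 2 (P : Measure E)) :
    HasDerivAt (fun t => ∫ z, g z ∂(path t : Measure E)) (∫ z, g z * s z ∂(P : Measure E)) 0 := by
  obtain ⟨f, C, hfm, hC, hbd, hpath, hlim⟩ := h.exists_density
  rw [hasDerivAt_iff_tendsto_slope_zero]
  have hs := h.score_memLp
  have h1 : ∀ᶠ t in 𝓝[≠] (0 : ℝ),
      |t⁻¹ • ((∫ z, g z ∂(path (0 + t) : Measure E)) - ∫ z, g z ∂(path 0 : Measure E))
        - ∫ z, g z * s z ∂(P : Measure E)|
      ≤ √((∫ z, g z ^ 2 ∂(P : Measure E))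
        * ∫ z, ((f t z - 1) / t - s z) ^ 2 ∂(P : Measure E)) := by
    filter_upwards [hbd.filter_mono nhdsWithin_le_nhds, hpath.filter_mono nhdsWithin_le_nhds,
      self_mem_nhdsWithin] with t hb hp ht0
    have ht0' : t ≠ 0 := ht0
    have hf0 : ∀ z, 0 ≤ f t z := fun z => (inv_pos.2 hC).le.trans (hb z).1
    have hfL : MemLp (f t) 2 (P : Measure E) := memLp_of_le_bdd (hfm t) (C := C)
      (fun z => by rw [abs_of_nonneg (hf0 z)]; exact (hb z).2) 2
    have hD : MemLp (fun z => (f t z - 1) / t - s z) 2 (P : Measure E) := by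
      refine MemLp.sub ?_ hs
      simpa [div_eq_inv_mul] using (hfL.sub (memLp_const 1)).const_mul t⁻¹
    have hgf : Integrable (fun z => f t z * g z) (P : Measure E) := hfL.integrable_mul hg
    have hgs : Integrable (fun z => g z * s z) (P : Measure E) := hg.integrable_mul hs
    have hgi : Integrable g (P : Measure E) := hg.integrable (by norm_num)
    have hA : Integrable (fun z => t⁻¹ * (f t z * g z - g z)) (P : Measure E) :=
      (hgf.sub hgi).const_mul _
    have h2 : t⁻¹ • ((∫ z, g z ∂(path (0 + t) : Measure E)) - ∫ z, g z ∂(path 0 : Measure E))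
        - ∫ z, g z * s z ∂(P : Measure E)
        = ∫ z, g z * ((f t z - 1) / t - s z) ∂(P : Measure E) := by
      rw [zero_add, h.base, hp, integral_withDensity_ofReal (hfm t) hf0, ← integral_sub hgf hgi,
        smul_eq_mul, ← integral_const_mul, ← integral_sub hA hgs]
      refine integral_congr_ae (ae_of_all _ fun z => ?_)
      change t⁻¹ * (f t z * g z - g z) - g z * s z = g z * ((f t z - 1) / t - s z)
      field_simp
    rw [h2, ← Real.sqrt_sq_eq_abs]
    exact Real.sqrt_le_sqrt (sq_integral_mul_le hg hD)
  rw [← tendsto_sub_nhds_zero_iff]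
  refine squeeze_zero_norm' h1 ?_
  have h3 := ((hlim.const_mul (∫ z, g z ^ 2 ∂(P : Measure E))).sqrt)
  simpa using h3

/-- The total mass is constant along the path, so its pathwise derivative is zero. -/
theorem IsRegularSubmodel.integral_score (h : IsRegularSubmodel P path s) :
    ∫ z, s z ∂(P : Measure E) = 0 := by
  have h1 := h.hasDerivAt_integral (g := fun _ => 1) (memLp_const 1)
  simp only [integral_const, probReal_univ, smul_eq_mul, mul_one, one_mul] at h1
  exact h1.unique (hasDerivAt_const _ _)

end RegularSubmodel

/-! ### Square integrability of the parts of the score. -/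

section ClusterResidual

variable {m d : ℕ} (ν : Measure (TypeObs m d)) [IsFiniteMeasure ν]

/-- The weighted residual `w(A, X)ᵀ {Y - g(A, X)}` of a single cluster. -/
def clusterResidual (w g : Treat m → (Fin d → ℝ) → Fin m → ℝ) (o : TypeObs m d) : ℝ :=
  w o.2.1 o.2.2 ⬝ᵥ (o.1 - g o.2.1 o.2.2)

variable {w : Treat m → (Fin d → ℝ) → Fin m → ℝ}

theorem measurable_clusterResidual {g : Treat m → (Fin d → ℝ) → Fin m → ℝ}
    (hw : ∀ a, Measurable (w a)) (hg : ∀ a, Measurable (g a)) :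
    Measurable (clusterResidual w g) := by
  have h := (measurable_dot hw).comp (f := fun o : TypeObs m d => (o.2, o.1 - g o.2.1 o.2.2))
    (measurable_snd.prodMk (measurable_fst.sub ((measurable_uncurry_treat hg).comp measurable_snd)))
  exact h

theorem measurable_sum_dot {g : Treat m → (Fin d → ℝ) → Fin m → ℝ}
    (hw : ∀ a, Measurable (w a)) (hg : ∀ a, Measurable (g a)) :
    Measurable (fun x => ∑ a, w a x ⬝ᵥ g a x) :=
  Finset.measurable_sum _ fun a _ => Finset.measurable_sum _ fun j _ =>
    ((measurable_pi_apply j).comp (hw a)).mul ((measurable_pi_apply j).comp (hg a))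

theorem ae_propensity_treat {c : ℝ} (he : ∀ a, ∀ᵐ x ∂(clusterCov ν), c ≤ clusterPropensity ν a x) :
    ∀ᵐ o ∂ν, c ≤ clusterPropensity ν o.2.1 o.2.2 := by
  filter_upwards [ae_treat_cov ν he] with o ho using ho _

/-- The regression part of a square-integrable score is square-integrable. -/
theorem memLp_sum_dot_reg (hw : ∀ a, Measurable (w a)) (hν : CondIntegrable ν)
    {e : Treat m → (Fin d → ℝ) → ℝ} (he : ∀ a, Measurable (e a))
    (hφ : MemLp (clusterAipw w e (clusterReg ν)) 2 ν) :
    MemLp (fun o : TypeObs m d => ∑ a, w a o.2.2 ⬝ᵥ clusterReg ν a o.2.2) 2 ν := by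
  have hSm := (measurable_sum_dot hw (measurable_clusterReg ν)).comp
    (measurable_cov : Measurable (fun o : TypeObs m d => o.2.2))
  have hφm := measurable_clusterAipw hw he (measurable_clusterReg ν)
  have hF : Measurable (fun p : (Treat m × (Fin d → ℝ)) × (Fin m → ℝ) =>
      clusterAipw w e (clusterReg ν) (p.2, p.1)) :=
    hφm.comp (measurable_snd.prodMk measurable_fst)
  have hF2 := hF.pow_const 2
  have hi := hφ.integrable_sq
  obtain ⟨h1, -⟩ := integral_eq_integral_outcome ν
    (f := fun p y => clusterAipw w e (clusterReg ν) (y, p) ^ 2) hF2 hi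
  have h2 : Integrable (fun p : (Treat m × (Fin d → ℝ)) × (Fin m → ℝ) =>
      clusterAipw w e (clusterReg ν) (p.2, p.1) ^ 2) (ν.map fun o => (o.2, o.1)) := by
    rw [integrable_map_measure hF2.aestronglyMeasurable (by fun_prop)]
    exact hi
  have h3 : ∀ᵐ p ∂(ν.map (fun o => o.2)),
      Integrable (fun y => clusterAipw w e (clusterReg ν) (y, p) ^ 2) (clusterOutcome ν p.1 p.2) :=
    h2.condDistrib_ae_map measurable_fst.aemeasurable
  refine (memLp_two_iff_integrable_sq hSm.aestronglyMeasurable).2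
    (h1.mono' (hSm.pow_const 2).aestronglyMeasurable ?_)
  filter_upwards [ae_of_ae_map (by fun_prop) hν, ae_of_ae_map (by fun_prop) h3] with o ho ho2
  rw [Real.norm_of_nonneg (sq_nonneg _)]
  have hL : MemLp (fun y => clusterAipw w e (clusterReg ν) (y, o.2)) 2
      (clusterOutcome ν o.2.1 o.2.2) :=
    (memLp_two_iff_integrable_sq
      (hφm.comp (measurable_id.prodMk measurable_const)).aestronglyMeasurable).2 ho2
  -- Given `(A, X)` the residual term averages out, so the regression part is the conditional mean
  -- of the score.
  have h4 : ∫ y, clusterAipw w e (clusterReg ν) (y, o.2) ∂(clusterOutcome ν o.2.1 o.2.2)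
      = ∑ a, w a o.2.2 ⬝ᵥ clusterReg ν a o.2.2 := by
    have h5 : ∀ y, clusterAipw w e (clusterReg ν) (y, o.2)
        = (w o.2.1 o.2.2 ⬝ᵥ y - w o.2.1 o.2.2 ⬝ᵥ clusterReg ν o.2.1 o.2.2) / e o.2.1 o.2.2
          + ∑ a, w a o.2.2 ⬝ᵥ clusterReg ν a o.2.2 := fun y => by
      rw [clusterAipw, dotProduct_sub]
    have h6 : Integrable (fun y => w o.2.1 o.2.2 ⬝ᵥ y) (clusterOutcome ν o.2.1 o.2.2) :=
      integrable_finsetSum _ fun j _ => (ho j).const_mul _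
    simp_rw [h5]
    rw [integral_add, integral_div, integral_sub, integral_dot_outcome ν o.2 _ ho]
    · simp
    · exact h6
    · exact integrable_const _
    · exact (h6.sub (integrable_const _)).div_const _
    · exact integrable_const _
  -- Jensen's inequality, as Cauchy-Schwarz against the constant `1`.
  have h7 := sq_integral_mul_le hL (memLp_const 1)
  simp only [mul_one, one_pow, integral_const, probReal_univ, smul_eq_mul] at h7
  rw [h4] at h7
  exact h7

/-- The residual is the propensity score times the difference of the score and its regression part,
and a propensity score is at most one. -/
theorem memLp_clusterResidual (hw : ∀ a, Measurable (w a)) (hν : CondIntegrable ν) {c : ℝ}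
    (hc : 0 < c) (he : ∀ a, ∀ᵐ x ∂(clusterCov ν), c ≤ clusterPropensity ν a x)
    (hφ : MemLp (clusterAipw w (clusterPropensity ν) (clusterReg ν)) 2 ν) :
    MemLp (clusterResidual w (clusterReg ν)) 2 ν := by
  have hS := memLp_sum_dot_reg ν hw hν (measurable_clusterPropensity ν) hφ
  refine MemLp.of_le (hφ.sub hS)
    (measurable_clusterResidual hw (measurable_clusterReg ν)).aestronglyMeasurable ?_
  filter_upwards [ae_propensity_treat ν he] with o ho
  have h0 : 0 < clusterPropensity ν o.2.1 o.2.2 := hc.trans_le ho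
  have h1 : (clusterAipw w (clusterPropensity ν) (clusterReg ν)
      - fun o : TypeObs m d => ∑ a, w a o.2.2 ⬝ᵥ clusterReg ν a o.2.2) o
      = clusterResidual w (clusterReg ν) o / clusterPropensity ν o.2.1 o.2.2 := by
    simp [clusterAipw, clusterResidual]
  rw [h1, norm_div, Real.norm_of_nonneg h0.le]
  exact le_div_self (norm_nonneg _) h0 (clusterPropensity_le_one ν _ _)

end ClusterResidual

/-! ### Perturbing the law of a cluster: stability of overlap and the second-order remainder. -/

section DensityPerturbation

variable {m d : ℕ} {ν ν' : Measure (TypeObs m d)} [IsFiniteMeasure ν] [IsFiniteMeasure ν']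
  {σ : TypeObs m d → ℝ} {A : ℝ}

theorem withDensity_le_smul {E : Type*} [MeasurableSpace E] {μ : Measure E} {f : E → ℝ}
    (h : ∀ z, f z ≤ A) :
    μ.withDensity (fun z => ENNReal.ofReal (f z)) ≤ ENNReal.ofReal A • μ := by
  rw [← withDensity_const]
  exact withDensity_mono (ae_of_all _ fun z => ENNReal.ofReal_le_ofReal (h z))

theorem le_smul_withDensity {E : Type*} [MeasurableSpace E] {μ : Measure E} {f : E → ℝ}
    (hf : Measurable f) (hA : 0 < A) (h : ∀ z, A⁻¹ ≤ f z) :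
    μ ≤ ENNReal.ofReal A • μ.withDensity (fun z => ENNReal.ofReal (f z)) := by
  rw [← withDensity_smul _ hf.ennreal_ofReal]
  conv_lhs => rw [← withDensity_one (μ := μ)]
  refine withDensity_mono (ae_of_all _ fun z => ?_)
  simp only [Pi.one_apply, Pi.smul_apply, smul_eq_mul]
  rw [← ENNReal.ofReal_mul hA.le, ← ENNReal.ofReal_one]
  refine ENNReal.ofReal_le_ofReal ?_
  calc (1 : ℝ) = A * A⁻¹ := (mul_inv_cancel₀ hA.ne').symm
    _ ≤ A * f z := by gcongr; exact h z

omit [IsFiniteMeasure ν] [IsFiniteMeasure ν'] in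
theorem clusterCov_le_smul (h : ν' ≤ ENNReal.ofReal A • ν) :
    clusterCov ν' ≤ ENNReal.ofReal A • clusterCov ν := by
  unfold clusterCov
  rw [← Measure.map_smul]
  exact Measure.map_mono h measurable_cov

/-- Overlap persists under a density bounded away from `0` and `∞`. -/
theorem le_clusterPropensity_of_le (hA : 0 < A) (h1 : ν' ≤ ENNReal.ofReal A • ν)
    (h2 : ν ≤ ENNReal.ofReal A • ν') {c : ℝ} {a : Treat m}
    (he : ∀ᵐ x ∂(clusterCov ν), c ≤ clusterPropensity ν a x) :
    ∀ᵐ x ∂(clusterCov ν'), c / A ^ 2 ≤ clusterPropensity ν' a x := by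
  -- The inequality is tested on covariate sets: passing from the covariate law of `ν'` to that of
  -- `ν`, and back on the event `A = a`, costs a factor `A` each time.
  have key : ∀ s, MeasurableSet s → (clusterCov ν') s < ∞ →
      ∫⁻ x in s, ENNReal.ofReal c ∂(clusterCov ν')
        ≤ ∫⁻ x in s, ENNReal.ofReal (A ^ 2 * clusterPropensity ν' a x) ∂(clusterCov ν') := by
    intro s hs _
    have hm : ∀ (ξ : Measure (TypeObs m d)) [IsFiniteMeasure ξ],
        ∫⁻ x in s, ENNReal.ofReal (clusterPropensity ξ a x) ∂(clusterCov ξ)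
          = ξ ((fun o => o.2.2) ⁻¹' s ∩ {o | o.2.1 = a}) := by
      intro ξ _
      rw [← withDensity_apply _ hs, ← map_cov_restrict_treat, Measure.map_apply measurable_cov hs,
        Measure.restrict_apply (measurable_cov hs)]
    calc ∫⁻ x in s, ENNReal.ofReal c ∂(clusterCov ν')
        = ENNReal.ofReal c * clusterCov ν' s := by simp
      _ ≤ ENNReal.ofReal c * (ENNReal.ofReal A * clusterCov ν s) := by
          gcongr
          exact clusterCov_le_smul h1 s
      _ = ENNReal.ofReal A * ∫⁻ x in s, ENNReal.ofReal c ∂(clusterCov ν) := by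
          rw [setLIntegral_const]; ring
      _ ≤ ENNReal.ofReal A * ∫⁻ x in s, ENNReal.ofReal (clusterPropensity ν a x)
            ∂(clusterCov ν) := by
          refine mul_le_mul_right (lintegral_mono_ae (ae_restrict_of_ae (he.mono fun x hx =>
            ENNReal.ofReal_le_ofReal hx))) _
      _ ≤ ENNReal.ofReal A * (ENNReal.ofReal A
            * ν' ((fun o => o.2.2) ⁻¹' s ∩ {o | o.2.1 = a})) := by
          rw [hm ν]
          gcongr
          exact h2 _
      _ = _ := by
          rw [← hm ν', ← mul_assoc, ← ENNReal.ofReal_mul hA.le, ← lintegral_const_mul _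
            (measurable_clusterPropensity ν' a).ennreal_ofReal]
          refine lintegral_congr fun x => ?_
          rw [← ENNReal.ofReal_mul (by positivity), sq]
  have h3 := ae_le_of_forall_setLIntegral_le_of_sigmaFinite measurable_const key
  filter_upwards [h3] with x hx
  rw [div_le_iff₀ (by positivity), mul_comm]
  exact (ENNReal.ofReal_le_ofReal_iff
    (mul_nonneg (sq_nonneg _) (clusterPropensity_nonneg ν' a x))).1 hx

/-- `1(A = a) - e(a | X)` is orthogonal to functions of `X`. -/
theorem integral_mul_treat_sub_propensity (ξ : Measure (TypeObs m d)) [IsFiniteMeasure ξ]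
    (a : Treat m) {h : (Fin d → ℝ) → ℝ} (hh : Measurable h) {B : ℝ} (hB : ∀ x, |h x| ≤ B) :
    ∫ o, h o.2.2 * ((if o.2.1 = a then 1 else 0) - clusterPropensity ξ a o.2.2) ∂ξ = 0 := by
  have hb : ∀ x, |clusterPropensity ξ a x * h x| ≤ B := fun x => by
    rw [abs_mul, abs_of_nonneg (clusterPropensity_nonneg ξ a x)]
    exact (mul_le_of_le_one_left (abs_nonneg _) (clusterPropensity_le_one ξ a x)).trans (hB x)
  have hm : Measurable (fun x => clusterPropensity ξ a x * h x) :=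
    (measurable_clusterPropensity ξ a).mul hh
  have hi : Integrable (fun x => clusterPropensity ξ a x * h x) (clusterCov ξ) :=
    Integrable.of_bound hm.aestronglyMeasurable B (ae_of_all _ hb)
  have h1 : (fun o : TypeObs m d => h o.2.2 * ((if o.2.1 = a then 1 else 0)
      - clusterPropensity ξ a o.2.2)) = fun o => (if o.2.1 = a then h o.2.2 else 0)
        - clusterPropensity ξ a o.2.2 * h o.2.2 := by
    ext o
    split_ifs <;> ring
  have hi2 : Integrable (fun o : TypeObs m d => clusterPropensity ξ a o.2.2 * h o.2.2) ξ :=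
    hi.comp_measurable measurable_cov
  rw [h1, integral_sub ((integrable_treat_iff ξ hh a).2 hi) hi2,
    integral_treat ξ hh, clusterCov, integral_map measurable_cov.aemeasurable
      (hm.aestronglyMeasurable), sub_self]

/-- The propensity score depends Lipschitz-continuously in `L²` on the density. -/
theorem integral_sq_propensity_sub_le (hσ : Measurable σ) (hA : 0 < A)
    (hb : ∀ o, A⁻¹ ≤ σ o ∧ σ o ≤ A)
    (hν' : ν' = ν.withDensity (fun o => ENNReal.ofReal (σ o))) (κ : ℝ) (a : Treat m) :
    ∫ o, (clusterPropensity ν' a o.2.2 - clusterPropensity ν a o.2.2) ^ 2 ∂ν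
      ≤ A ^ 2 * ∫ o, (σ o - κ) ^ 2 ∂ν := by
  set D : (Fin d → ℝ) → ℝ := fun x => clusterPropensity ν' a x - clusterPropensity ν a x with hD
  have hDm : Measurable D :=
    (measurable_clusterPropensity ν' a).sub (measurable_clusterPropensity ν a)
  have hD1 : ∀ x, |D x| ≤ 1 := fun x => abs_le.2
    ⟨by linarith [clusterPropensity_nonneg ν' a x, clusterPropensity_le_one ν a x],
      by linarith [clusterPropensity_nonneg ν a x, clusterPropensity_le_one ν' a x]⟩
  have h0 : ∀ o, 0 ≤ σ o := fun o => (inv_pos.2 hA).le.trans (hb o).1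
  -- `G` tests the propensity difference `D` against the treatment: it has mean zero under `ν` and
  -- mean `∫ D²` under `ν'`.
  set G : TypeObs m d → ℝ := fun o =>
    D o.2.2 * ((if o.2.1 = a then 1 else 0) - clusterPropensity ν a o.2.2) with hG
  have hind : Measurable (fun o : TypeObs m d => if o.2.1 = a then (1 : ℝ) else 0) :=
    Measurable.ite (measurableSet_treat a) measurable_const measurable_const
  have hGm : Measurable G := (hDm.comp measurable_cov).mul
    (hind.sub ((measurable_clusterPropensity ν a).comp measurable_cov))
  have hi01 : ∀ (o : TypeObs m d) (p : ℝ), 0 ≤ p → p ≤ 1 →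
      |(if o.2.1 = a then (1 : ℝ) else 0) - p| ≤ 1 := by
    intro o p hp hp1
    split_ifs <;> rw [abs_le] <;> constructor <;> linarith
  have hGD : ∀ o, |G o| ≤ |D o.2.2| := fun o => by
    rw [hG, abs_mul]
    exact mul_le_of_le_one_right (abs_nonneg _)
      (hi01 o _ (clusterPropensity_nonneg ν a _) (clusterPropensity_le_one ν a _))
  have hG1 : ∀ o, |G o| ≤ 1 := fun o => (hGD o).trans (hD1 _)
  have hGL : ∀ (ξ : Measure (TypeObs m d)) [IsFiniteMeasure ξ], MemLp G 2 ξ := fun ξ _ =>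
    memLp_of_le_bdd hGm hG1 2
  have hDL : ∀ (ξ : Measure (TypeObs m d)) [IsFiniteMeasure ξ],
      MemLp (fun o : TypeObs m d => D o.2.2) 2 ξ := fun ξ _ =>
    memLp_of_le_bdd (hDm.comp measurable_cov) (fun o => hD1 _) 2
  have hr : MemLp (fun o => σ o - κ) 2 ν := (memLp_of_le_bdd hσ (C := A)
    (fun o => by rw [abs_of_nonneg (h0 o)]; exact (hb o).2) 2).sub (memLp_const κ)
  -- Since `G` is centred under `ν`, any constant `κ` may be subtracted from the density.
  have h1 : ∫ o, D o.2.2 ^ 2 ∂ν' = ∫ o, (σ o - κ) * G o ∂ν := by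
    have h2 : ∫ o, D o.2.2 * ((if o.2.1 = a then 1 else 0) - clusterPropensity ν' a o.2.2) ∂ν' = 0 :=
      integral_mul_treat_sub_propensity ν' a hDm hD1
    have h3 : ∫ o, G o ∂ν = 0 := integral_mul_treat_sub_propensity ν a hDm hD1
    have h4 : ∫ o, D o.2.2 ^ 2 ∂ν' = ∫ o, G o ∂ν' := by
      have h5 : ∀ o : TypeObs m d, D o.2.2 * ((if o.2.1 = a then 1 else 0)
          - clusterPropensity ν' a o.2.2) = G o - D o.2.2 ^ 2 := fun o => by
        simp only [hG, hD]; ring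
      simp_rw [h5] at h2
      rw [integral_sub ((hGL ν').integrable (by norm_num)) (hDL ν').integrable_sq] at h2
      linarith
    have h6 : ∀ o, (σ o - κ) * G o = σ o * G o - κ * G o := fun o => by ring
    have h7 : Integrable (fun o => σ o * G o) ν :=
      (((hGL ν).integrable (by norm_num)).bdd_mul (c := A) hσ.aestronglyMeasurable
        (ae_of_all _ fun o => by rw [Real.norm_of_nonneg (h0 o)]; exact (hb o).2))
    rw [h4, hν', integral_withDensity_ofReal hσ h0]
    simp_rw [h6]
    rw [integral_sub h7 (((hGL ν).integrable (by norm_num)).const_mul κ), integral_const_mul, h3,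
      mul_zero, sub_zero]
  have h2 : ∫ o, D o.2.2 ^ 2 ∂ν ≤ A * ∫ o, (σ o - κ) * G o ∂ν := by
    rw [← h1, hν', integral_withDensity_ofReal hσ h0, ← integral_const_mul]
    have h7 : Integrable (fun o => σ o * D o.2.2 ^ 2) ν :=
      ((hDL ν).integrable_sq.bdd_mul (c := A) hσ.aestronglyMeasurable
        (ae_of_all _ fun o => by rw [Real.norm_of_nonneg (h0 o)]; exact (hb o).2))
    refine integral_mono (hDL ν).integrable_sq (h7.const_mul A) fun o => ?_
    change D o.2.2 ^ 2 ≤ A * (σ o * D o.2.2 ^ 2)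
    rw [← mul_assoc]
    refine le_mul_of_one_le_left (sq_nonneg _) ?_
    calc (1 : ℝ) = A * A⁻¹ := (mul_inv_cancel₀ hA.ne').symm
      _ ≤ A * σ o := by gcongr; exact (hb o).1
  have h3 := sq_integral_mul_le hr (hGL ν)
  have h4 : ∫ o, G o ^ 2 ∂ν ≤ ∫ o, D o.2.2 ^ 2 ∂ν :=
    integral_mono (hGL ν).integrable_sq (hDL ν).integrable_sq fun o => sq_le_sq.2 (hGD o)
  have hI0 : 0 ≤ ∫ o, D o.2.2 ^ 2 ∂ν := integral_nonneg fun o => sq_nonneg _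
  have hr0 : 0 ≤ ∫ o, (σ o - κ) ^ 2 ∂ν := integral_nonneg fun o => sq_nonneg _
  change ∫ o, D o.2.2 ^ 2 ∂ν ≤ _
  -- Cauchy-Schwarz bounds `(∫ D²)²` by a multiple of `∫ D²` itself, because `|G| ≤ |D|`; one factor
  -- is cancelled unless it is zero.
  rcases hI0.eq_or_lt with h | h
  · rw [← h]; positivity
  · refine le_of_mul_le_mul_right ?_ h
    calc (∫ o, D o.2.2 ^ 2 ∂ν) * ∫ o, D o.2.2 ^ 2 ∂ν = (∫ o, D o.2.2 ^ 2 ∂ν) ^ 2 := by ring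
      _ ≤ (A * ∫ o, (σ o - κ) * G o ∂ν) ^ 2 := by gcongr
      _ = A ^ 2 * (∫ o, (σ o - κ) * G o ∂ν) ^ 2 := by ring
      _ ≤ A ^ 2 * ((∫ o, (σ o - κ) ^ 2 ∂ν) * ∫ o, D o.2.2 ^ 2 ∂ν) := by
          gcongr
          exact h3.trans (mul_le_mul_of_nonneg_left h4 hr0)
      _ = _ := by ring

/-- Second-order remainder of the identifying functional: it is bounded by the product of the `L²`
distance of the density to a constant and its distance weighted by the residual. -/
theorem sq_integral_clusterAipw_sub_le {w : Treat m → (Fin d → ℝ) → Fin m → ℝ}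
    (hw : ∀ a, Measurable (w a)) (hσ : Measurable σ) (hA : 0 < A)
    (hb : ∀ o, A⁻¹ ≤ σ o ∧ σ o ≤ A)
    (hν' : ν' = ν.withDensity (fun o => ENNReal.ofReal (σ o))) (κ : ℝ)
    (hY : ∀ j, Integrable (fun o : TypeObs m d => o.1 j) ν) {c : ℝ} (hc : 0 < c)
    (he : ∀ a, ∀ᵐ x ∂(clusterCov ν), c ≤ clusterPropensity ν a x)
    (hreg : ∀ a, Integrable (fun x => w a x ⬝ᵥ clusterReg ν a x) (clusterCov ν))
    (hu : MemLp (clusterResidual w (clusterReg ν)) 2 ν) :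
    (∫ o, clusterAipw w (clusterPropensity ν) (clusterReg ν) o ∂ν'
        - ∑ a, ∫ x, w a x ⬝ᵥ clusterReg ν' a x ∂(clusterCov ν')) ^ 2
      ≤ ((A ^ 2 / c ^ 2) ^ 2 * Fintype.card (Treat m) * A ^ 2) * (∫ o, (σ o - κ) ^ 2 ∂ν)
        * ∫ o, ((σ o - κ) * clusterResidual w (clusterReg ν) o) ^ 2 ∂ν := by
  set u := clusterResidual w (clusterReg ν) with hu_def
  have hum : Measurable u := measurable_clusterResidual hw (measurable_clusterReg ν)
  have h0 : ∀ o, 0 ≤ σ o := fun o => (inv_pos.2 hA).le.trans (hb o).1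
  have hle1 : ν' ≤ ENNReal.ofReal A • ν := by
    rw [hν']; exact withDensity_le_smul fun o => (hb o).2
  have hle2 : ν ≤ ENNReal.ofReal A • ν' := by
    rw [hν']; exact le_smul_withDensity hσ hA fun o => (hb o).1
  have hac : ν ≪ ν' := Measure.absolutelyContinuous_of_le_smul hle2
  have hac' : ν' ≪ ν := Measure.absolutelyContinuous_of_le_smul hle1
  have hint : ∀ {h : TypeObs m d → ℝ}, Integrable h ν → Integrable h ν' := fun hh =>
    (hh.smul_measure ENNReal.ofReal_ne_top).mono_measure hle1
  have he' : ∀ a, ∀ᵐ x ∂(clusterCov ν'), c / A ^ 2 ≤ clusterPropensity ν' a x := fun a =>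
    le_clusterPropensity_of_le hA hle1 hle2 (he a)
  have hcA : 0 < c / A ^ 2 := by positivity
  have hae' : ∀ᵐ o ∂ν', c / A ^ 2 ≤ clusterPropensity ν' o.2.1 o.2.2 := ae_propensity_treat ν' he'
  have hae : ∀ᵐ o ∂ν, c ≤ clusterPropensity ν o.2.1 o.2.2 := ae_propensity_treat ν he
  have hem : ∀ (ξ : Measure (TypeObs m d)) [IsFiniteMeasure ξ],
      Measurable (fun o : TypeObs m d => clusterPropensity ξ o.2.1 o.2.2) := fun ξ _ =>
    (measurable_uncurry_treat (measurable_clusterPropensity ξ)).comp measurable_snd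
  have hS : Integrable (fun o : TypeObs m d => ∑ a, w a o.2.2 ⬝ᵥ clusterReg ν a o.2.2) ν :=
    integrable_finsetSum _ fun a _ => (hreg a).comp_measurable measurable_cov
  have hui : Integrable u ν := hu.integrable (by norm_num)
  have hdiv : ∀ (ξ : Measure (TypeObs m d)) [IsFiniteMeasure ξ] {b : ℝ}, 0 < b →
      (∀ᵐ o ∂ξ, b ≤ clusterPropensity ξ o.2.1 o.2.2) → ∀ {h : TypeObs m d → ℝ}, Integrable h ξ →
      Integrable (fun o => h o / clusterPropensity ξ o.2.1 o.2.2) ξ := by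
    intro ξ _ b hb0 hbe h hh
    simp_rw [div_eq_mul_inv]
    refine hh.mul_bdd (c := b⁻¹) (hem ξ).inv.aestronglyMeasurable ?_
    filter_upwards [hbe] with o ho
    rw [norm_inv, Real.norm_of_nonneg (hb0.le.trans ho)]
    exact inv_anti₀ hb0 ho
  have hwg : Integrable (fun o : TypeObs m d => w o.2.1 o.2.2 ⬝ᵥ clusterReg ν o.2.1 o.2.2) ν := by
    have h1 : Integrable (fun o : TypeObs m d => ∑ a, |w a o.2.2 ⬝ᵥ clusterReg ν a o.2.2|) ν :=
      integrable_finsetSum _ fun a _ => ((hreg a).comp_measurable measurable_cov).abs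
    refine h1.mono' ?_ (ae_of_all _ fun o => ?_)
    · have h2 : ∀ a, Measurable (fun x => w a x ⬝ᵥ clusterReg ν a x) := fun a =>
        Finset.measurable_sum _ fun j _ => ((measurable_pi_apply j).comp (hw a)).mul
          ((measurable_pi_apply j).comp (measurable_clusterReg ν a))
      exact ((measurable_uncurry_treat h2).comp measurable_snd).aestronglyMeasurable
    · exact Finset.single_le_sum (f := fun a => |w a o.2.2 ⬝ᵥ clusterReg ν a o.2.2|)
        (fun a _ => abs_nonneg _) (Finset.mem_univ o.2.1)
  have hwY : Integrable (fun o : TypeObs m d => w o.2.1 o.2.2 ⬝ᵥ o.1) ν := by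
    refine (hui.add hwg).congr (ae_of_all _ fun o => ?_)
    simp [hu_def, clusterResidual, dotProduct_sub]
  have haipw : ∀ e : Treat m → (Fin d → ℝ) → ℝ, ∀ o, clusterAipw w e (clusterReg ν) o
      = u o / e o.2.1 o.2.2 + ∑ a, w a o.2.2 ⬝ᵥ clusterReg ν a o.2.2 := fun e o => rfl
  have hi1 : Integrable (clusterAipw w (clusterPropensity ν) (clusterReg ν)) ν' :=
    hint ((hdiv ν hc hae hui).add hS)
  have hi2 : Integrable (clusterAipw w (clusterPropensity ν') (clusterReg ν)) ν' :=
    (hdiv ν' hcA hae' (hint hui)).add (hint hS)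
  -- Double robustness under `ν'`: with the propensity score of `ν'` the regression of `ν` may be
  -- kept, although it is wrong there. The remainder then involves only the difference of inverse
  -- propensities.
  have hval := integral_clusterAipw_of_propensity ν' hw
    (condIntegrable_of_integrable ν' fun j => hint (hY j))
    (fun a => (he' a).mono fun x hx => hcA.trans_le hx) (hdiv ν' hcA hae' (hint hwY))
    (measurable_clusterReg ν) hi2
  set q : TypeObs m d → ℝ := fun o =>
    (clusterPropensity ν o.2.1 o.2.2)⁻¹ - (clusterPropensity ν' o.2.1 o.2.2)⁻¹ with hq
  have hqm : Measurable q := (hem ν).inv.sub (hem ν').inv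
  -- The two propensity scores are at least `c` and `c / A²`, so the inverse of their product is at
  -- most `A² / c²`.
  set B := A ^ 2 / c ^ 2 with hB
  have hB0 : 0 ≤ B := by positivity
  set D : Treat m → TypeObs m d → ℝ := fun a o =>
    clusterPropensity ν' a o.2.2 - clusterPropensity ν a o.2.2 with hD
  have hDm : ∀ a, Measurable (D a) := fun a =>
    ((measurable_clusterPropensity ν' a).sub (measurable_clusterPropensity ν a)).comp measurable_cov
  have hD1 : ∀ a o, |D a o| ≤ 1 := fun a o => abs_le.2
    ⟨by linarith [clusterPropensity_nonneg ν' a o.2.2, clusterPropensity_le_one ν a o.2.2],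
      by linarith [clusterPropensity_nonneg ν a o.2.2, clusterPropensity_le_one ν' a o.2.2]⟩
  have hqD : ∀ᵐ o ∂ν, |q o| ≤ B * |D o.2.1 o| := by
    filter_upwards [hae, hac.ae_le hae'] with o h1 h2
    have h3 : 0 < clusterPropensity ν o.2.1 o.2.2 := hc.trans_le h1
    have h4 : 0 < clusterPropensity ν' o.2.1 o.2.2 := hcA.trans_le h2
    rw [hq]
    change |(clusterPropensity ν o.2.1 o.2.2)⁻¹ - (clusterPropensity ν' o.2.1 o.2.2)⁻¹|
      ≤ B * |clusterPropensity ν' o.2.1 o.2.2 - clusterPropensity ν o.2.1 o.2.2|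
    rw [inv_sub_inv h3.ne' h4.ne', abs_div, abs_of_pos (mul_pos h3 h4), div_eq_inv_mul]
    refine mul_le_mul_of_nonneg_right ?_ (abs_nonneg _)
    calc _ ≤ (c * (c / A ^ 2))⁻¹ := inv_anti₀ (by positivity) (by gcongr)
      _ = B := by rw [hB]; field_simp
  have hqb : ∀ᵐ o ∂ν, ‖q o‖ ≤ B := hqD.mono fun o ho =>
    ho.trans (mul_le_of_le_one_right hB0 (hD1 _ _))
  have hquL : MemLp (fun o => q o * u o) 2 ν := by
    refine MemLp.of_le_mul (c := B) hu (hqm.mul hum).aestronglyMeasurable ?_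
    filter_upwards [hqb] with o ho
    rw [norm_mul]
    gcongr
  have hqui : Integrable (fun o => q o * u o) ν := hquL.integrable (by norm_num)
  -- `q` depends on `(A, X)` only and the residual is centred under `ν`; hence `σ` may be replaced
  -- by `σ - κ`, which makes the remainder a product of two small factors.
  have hzero : ∫ o, q o * u o ∂ν = 0 := by
    set b : Treat m → (Fin d → ℝ) → Fin m → ℝ := fun a x =>
      ((clusterPropensity ν a x)⁻¹ - (clusterPropensity ν' a x)⁻¹) • w a x with hb_def
    have hbm : ∀ a, Measurable (b a) := fun a =>
      ((measurable_clusterPropensity ν a).inv.sub (measurable_clusterPropensity ν' a).inv).smul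
        (hw a)
    have hbd : ∀ o : TypeObs m d, b o.2.1 o.2.2 ⬝ᵥ (o.1 - clusterReg ν o.2.1 o.2.2)
        = q o * u o := fun o => by
      rw [hb_def, smul_dotProduct, smul_eq_mul]
      rfl
    have h1 := integral_dot_residual ν hbm (condIntegrable_of_integrable ν hY)
      (hqui.congr (ae_of_all _ fun o => (hbd o).symm))
    simpa only [hbd] using h1
  have hR : ∫ o, clusterAipw w (clusterPropensity ν) (clusterReg ν) o ∂ν'
      - ∑ a, ∫ x, w a x ⬝ᵥ clusterReg ν' a x ∂(clusterCov ν')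
      = ∫ o, ((σ o - κ) * u o) * q o ∂ν := by
    have h1 : ∀ o, clusterAipw w (clusterPropensity ν) (clusterReg ν) o
        - clusterAipw w (clusterPropensity ν') (clusterReg ν) o = q o * u o := fun o => by
      rw [haipw, haipw, hq]
      ring
    have h2 : Integrable (fun o => σ o * (q o * u o)) ν :=
      hqui.bdd_mul (c := A) hσ.aestronglyMeasurable
        (ae_of_all _ fun o => by rw [Real.norm_of_nonneg (h0 o)]; exact (hb o).2)
    have h3 : ∀ o, ((σ o - κ) * u o) * q o = σ o * (q o * u o) - κ * (q o * u o) := fun o => by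
      ring
    rw [← hval, ← integral_sub hi1 hi2]
    simp_rw [h1, h3]
    rw [integral_sub h2 (hqui.const_mul κ), integral_const_mul, hzero, mul_zero, sub_zero]
    conv_lhs => rw [hν']
    rw [integral_withDensity_ofReal hσ h0]
  have hru : MemLp (fun o => (σ o - κ) * u o) 2 ν := by
    refine MemLp.of_le_mul (c := A + |κ|) hu
      ((hσ.sub_const κ).mul hum).aestronglyMeasurable (ae_of_all _ fun o => ?_)
    rw [norm_mul]
    refine mul_le_mul_of_nonneg_right ((abs_sub _ _).trans ?_) (norm_nonneg _)
    rw [abs_of_nonneg (h0 o)]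
    exact add_le_add_left (hb o).2 _
  have hqL : MemLp q 2 ν := MemLp.of_bound hqm.aestronglyMeasurable B hqb
  have hDL : ∀ a, MemLp (D a) 2 ν := fun a => memLp_of_le_bdd (hDm a) (hD1 a) 2
  have hq2 : ∫ o, q o ^ 2 ∂ν ≤ B ^ 2 * Fintype.card (Treat m) * A ^ 2 * ∫ o, (σ o - κ) ^ 2 ∂ν := by
    calc ∫ o, q o ^ 2 ∂ν ≤ ∫ o, B ^ 2 * ∑ a, D a o ^ 2 ∂ν := by
          refine integral_mono_ae hqL.integrable_sq
            ((integrable_finsetSum _ fun a _ => (hDL a).integrable_sq).const_mul _) ?_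
          filter_upwards [hqD] with o ho
          calc q o ^ 2 ≤ (B * |D o.2.1 o|) ^ 2 := sq_le_sq.2 (ho.trans (le_abs_self _))
            _ = B ^ 2 * D o.2.1 o ^ 2 := by rw [mul_pow, sq_abs]
            _ ≤ B ^ 2 * ∑ a, D a o ^ 2 := by
              gcongr
              exact Finset.single_le_sum (f := fun a => D a o ^ 2) (fun a _ => sq_nonneg _)
                (Finset.mem_univ o.2.1)
      _ = B ^ 2 * ∑ a, ∫ o, D a o ^ 2 ∂ν := by
          rw [integral_const_mul, integral_finsetSum _ fun a _ => (hDL a).integrable_sq]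
      _ ≤ B ^ 2 * ∑ _a : Treat m, A ^ 2 * ∫ o, (σ o - κ) ^ 2 ∂ν := by
          refine mul_le_mul_of_nonneg_left (Finset.sum_le_sum fun a _ => ?_) (sq_nonneg _)
          exact integral_sq_propensity_sub_le hσ hA hb hν' κ a
      _ = _ := by
          rw [Finset.sum_const, Finset.card_univ, nsmul_eq_mul]
          ring
  rw [hR]
  refine (sq_integral_mul_le hru hqL).trans ?_
  rw [mul_comm]
  exact mul_le_mul_of_nonneg_right hq2 (integral_nonneg fun o => sq_nonneg _)

end DensityPerturbation

/-! ### Pathwise derivatives of `θ_k` and `τ`. -/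

section PathwiseDerivative

variable {K : ℕ} {M d : Fin K → ℕ} {P : ProbabilityMeasure (Obs M d)}

/-- The observed-data functional `P ↦ ∑_a E{w_k(a, X)ᵀ g(a, X, k) | L = k}`. -/
def thetaFunctional (w : Weights M d) (P : ProbabilityMeasure (Obs M d)) (k : Fin K) : ℝ :=
  ∑ a : Treat (M k), ∫ x, w k a x ⬝ᵥ outcomeReg P k a x ∂(covLaw P k)

theorem typeProb_withDensity_bounds {P' : ProbabilityMeasure (Obs M d)} {f : Obs M d → ℝ}
    (hf : Measurable f) {C : ℝ} (hC : 0 < C) (hb : ∀ z, C⁻¹ ≤ f z ∧ f z ≤ C)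
    (h : (P' : Measure (Obs M d))
      = (P : Measure (Obs M d)).withDensity (fun z => ENNReal.ofReal (f z))) (k : Fin K) :
    C⁻¹ * typeProb P k ≤ typeProb P' k ∧ typeProb P' k ≤ C * typeProb P k := by
  have h0 : ∀ z, 0 ≤ f z := fun z => (inv_pos.2 hC).le.trans (hb z).1
  have hi := integrable_typeIndicator (P := P) k
  have hif : Integrable (fun z => f z * (if z.1 = k then (1 : ℝ) else 0))
      (P : Measure (Obs M d)) := hi.bdd_mul (c := C) hf.aestronglyMeasurable
        (ae_of_all _ fun z => by rw [Real.norm_of_nonneg (h0 z)]; exact (hb z).2)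
  have h01 : ∀ z : Obs M d, (0 : ℝ) ≤ if z.1 = k then (1 : ℝ) else 0 := fun z => by
    split_ifs <;> norm_num
  rw [← integral_typeIndicator k, ← integral_typeIndicator (P := P') k, h,
    integral_withDensity_ofReal hf h0, ← integral_const_mul, ← integral_const_mul]
  exact ⟨integral_mono (hi.const_mul _) hif fun z => mul_le_mul_of_nonneg_right (hb z).1 (h01 z),
    integral_mono hif (hi.const_mul _) fun z => mul_le_mul_of_nonneg_right (hb z).2 (h01 z)⟩

theorem typeLaw_withDensity_ofReal {P' : ProbabilityMeasure (Obs M d)} {f : Obs M d → ℝ}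
    (hf : Measurable f)
    (h : (P' : Measure (Obs M d))
      = (P : Measure (Obs M d)).withDensity (fun z => ENNReal.ofReal (f z))) {k : Fin K}
    (hk : 0 < typeProb P' k) :
    typeLaw P' k = (typeLaw P k).withDensity
      (fun o => ENNReal.ofReal (typeProb P k / typeProb P' k * f ⟨k, o⟩)) := by
  have hfm : Measurable (fun o : TypeObs (M k) (d k) => ENNReal.ofReal (f ⟨k, o⟩)) :=
    (hf.comp (measurable_mk_type k)).ennreal_ofReal
  rw [typeLaw_withDensity P P' h k, smul_smul, ← withDensity_smul _ hfm]
  congr 1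
  ext o
  rw [Pi.smul_apply, smul_eq_mul, ENNReal.ofReal_mul (div_nonneg (typeProb_nonneg _ _) hk.le),
    ENNReal.ofReal_div_of_pos hk, div_eq_mul_inv, mul_comm (ENNReal.ofReal (typeProb P k))]

variable {w : Weights M d} (hw : ∀ k a, Measurable (w k a))
  (hp : ∀ k, 0 < typeProb P k)
  (hY : ∀ k j, Integrable (fun o : TypeObs (M k) (d k) => o.1 j) (typeLaw P k))
  {c : ℝ} (hc : 0 < c) (he : ∀ k a, ∀ᵐ x ∂(covLaw P k), c ≤ propensity P k a x)
  (hreg : ∀ k a, Integrable (fun x => w k a x ⬝ᵥ outcomeReg P k a x) (covLaw P k))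
  (hφ : ∀ k, MemLp (fun z => if z.1 = k then aipw w (propensity P) (outcomeReg P) z else 0) 2
    (P : Measure (Obs M d)))

include hp hφ in
theorem memLp_clusterAipw_typeLaw (k : Fin K) :
    MemLp (clusterAipw (w k) (clusterPropensity (typeLaw P k)) (clusterReg (typeLaw P k))) 2
      (typeLaw P k) := by
  have h := memLp_typeLaw P (hφ k) (hp k)
  simp only [if_true] at h
  exact h

include hp hw hY hreg hφ in
theorem integral_clusterAipw_eq_thetaFunctional (k : Fin K) :
    ∫ o, clusterAipw (w k) (clusterPropensity (typeLaw P k)) (clusterReg (typeLaw P k)) o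
      ∂(typeLaw P k) = thetaFunctional w P k :=
  integral_clusterAipw_of_reg (typeLaw P k) (hw k) (condIntegrable_of_integrable _ (hY k))
    (hreg k) (measurable_clusterPropensity _)
    ((memLp_clusterAipw_typeLaw hp hφ k).integrable (by norm_num))

include hw hp hY hc he hreg hφ in
-- Within type `k` the density is `κ f`, where `κ` is the ratio of the type probabilities. Measuring
-- it against the constant `κ` instead of `1` leaves `κ (f - 1)`, so the bound involves `f - 1`
-- alone; both `κ` and `f` lie in `[C⁻¹, C]`, hence the powers of `C²`.
theorem sq_integral_clusterAipw_typeLaw_sub_le {P' : ProbabilityMeasure (Obs M d)}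
    {f : Obs M d → ℝ} (hf : Measurable f) {C : ℝ} (hC : 0 < C) (hb : ∀ z, C⁻¹ ≤ f z ∧ f z ≤ C)
    (h : (P' : Measure (Obs M d))
      = (P : Measure (Obs M d)).withDensity (fun z => ENNReal.ofReal (f z))) (k : Fin K) :
    (∫ o, clusterAipw (w k) (clusterPropensity (typeLaw P k)) (clusterReg (typeLaw P k)) o
        ∂(typeLaw P' k) - thetaFunctional w P' k) ^ 2
      ≤ (((C ^ 2) ^ 2 / c ^ 2) ^ 2 * Fintype.card (Treat (M k)) * (C ^ 2) ^ 2
          * (C ^ 2 / typeProb P k) ^ 2) * (∫ z, (f z - 1) ^ 2 ∂(P : Measure (Obs M d)))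
        * ∫ z, |if z.1 = k then clusterResidual (w z.1) (clusterReg (typeLaw P z.1)) z.2 ^ 2 else 0|
            * |(f z - 1) ^ 2| ∂(P : Measure (Obs M d)) := by
  have := isProbabilityMeasure_typeLaw P (hp k)
  obtain ⟨hb1, hb2⟩ := typeProb_withDensity_bounds hf hC hb h k
  have hk : 0 < typeProb P k := hp k
  have hk' : 0 < typeProb P' k := (mul_pos (inv_pos.2 hC) hk).trans_le hb1
  set κ := typeProb P k / typeProb P' k with hκ
  have hκ0 : 0 < κ := div_pos hk hk'
  have hκ1 : C⁻¹ ≤ κ := by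
    rw [hκ, le_div_iff₀ hk', inv_mul_le_iff₀ hC]; exact hb2
  have hκ2 : κ ≤ C := by
    rw [hκ, div_le_iff₀ hk', ← inv_mul_le_iff₀ hC]; exact hb1
  have hfk : Measurable (fun o : TypeObs (M k) (d k) => f ⟨k, o⟩) :=
    hf.comp (measurable_mk_type k)
  have hbσ : ∀ o : TypeObs (M k) (d k), (C ^ 2)⁻¹ ≤ κ * f ⟨k, o⟩ ∧ κ * f ⟨k, o⟩ ≤ C ^ 2 := by
    intro o
    have hf0 : 0 ≤ f ⟨k, o⟩ := (inv_pos.2 hC).le.trans (hb _).1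
    constructor
    · rw [sq, mul_inv]
      exact mul_le_mul hκ1 (hb _).1 (inv_pos.2 hC).le hκ0.le
    · rw [sq]
      exact mul_le_mul hκ2 (hb _).2 hf0 hC.le
  have hu := memLp_clusterResidual (typeLaw P k) (hw k) (condIntegrable_of_integrable _ (hY k)) hc
    (he k) (memLp_clusterAipw_typeLaw hp hφ k)
  have hmain := sq_integral_clusterAipw_sub_le (hw k) (hfk.const_mul κ) (pow_pos hC 2) hbσ
    (typeLaw_withDensity_ofReal hf h hk') κ (hY k) hc (he k) (hreg k) hu
  refine hmain.trans ?_
  have hX0 : 0 ≤ ∫ z, (f z - 1) ^ 2 ∂(P : Measure (Obs M d)) := integral_nonneg fun z => sq_nonneg _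
  have hf1 : Integrable (fun z => (f z - 1) ^ 2) (P : Measure (Obs M d)) :=
    ((memLp_of_le_bdd hf (C := C) (fun z => by
      rw [abs_of_nonneg ((inv_pos.2 hC).le.trans (hb z).1)]; exact (hb z).2) 2).sub
        (memLp_const 1)).integrable_sq
  have hκC : κ ^ 2 ≤ C ^ 2 := by gcongr
  have hX : ∫ o, (κ * f ⟨k, o⟩ - κ) ^ 2 ∂(typeLaw P k)
      ≤ C ^ 2 / typeProb P k * ∫ z, (f z - 1) ^ 2 ∂(P : Measure (Obs M d)) := by
    have h1 := integral_type P (fun z => (f z - 1) ^ 2) k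
    have h2 : ∫ z : Obs M d, (if z.1 = k then (f z - 1) ^ 2 else 0) ∂(P : Measure (Obs M d))
        ≤ ∫ z, (f z - 1) ^ 2 ∂(P : Measure (Obs M d)) := by
      refine integral_mono ?_ hf1 fun z => ?_
      · refine (hf1.indicator (measurableSet_type k)).congr (ae_of_all _ fun z => ?_)
        simp [Set.indicator_apply]
      · change (if z.1 = k then (f z - 1) ^ 2 else 0) ≤ (f z - 1) ^ 2
        split_ifs
        · exact le_rfl
        · exact sq_nonneg _
    have h3 : ∀ o : TypeObs (M k) (d k), (κ * f ⟨k, o⟩ - κ) ^ 2 = κ ^ 2 * (f ⟨k, o⟩ - 1) ^ 2 :=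
      fun o => by ring
    simp_rw [h3]
    rw [integral_const_mul]
    calc κ ^ 2 * ∫ o, (f ⟨k, o⟩ - 1) ^ 2 ∂(typeLaw P k)
        ≤ C ^ 2 * ∫ o, (f ⟨k, o⟩ - 1) ^ 2 ∂(typeLaw P k) :=
          mul_le_mul_of_nonneg_right hκC (integral_nonneg fun o => sq_nonneg _)
      _ = C ^ 2 / typeProb P k
          * ∫ z : Obs M d, (if z.1 = k then (f z - 1) ^ 2 else 0) ∂(P : Measure (Obs M d)) := by
          rw [h1]; field_simp
      _ ≤ _ := mul_le_mul_of_nonneg_left h2 (by positivity)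
  have hYb : ∫ o, ((κ * f ⟨k, o⟩ - κ) * clusterResidual (w k) (clusterReg (typeLaw P k)) o) ^ 2
        ∂(typeLaw P k)
      ≤ C ^ 2 / typeProb P k * ∫ z, |if z.1 = k then
          clusterResidual (w z.1) (clusterReg (typeLaw P z.1)) z.2 ^ 2 else 0|
            * |(f z - 1) ^ 2| ∂(P : Measure (Obs M d)) := by
    have h1 := integral_type P (fun z => clusterResidual (w z.1) (clusterReg (typeLaw P z.1)) z.2 ^ 2
      * (f z - 1) ^ 2) k
    have h2 : ∀ z : Obs M d, |if z.1 = k then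
          clusterResidual (w z.1) (clusterReg (typeLaw P z.1)) z.2 ^ 2 else 0| * |(f z - 1) ^ 2|
        = if z.1 = k then clusterResidual (w z.1) (clusterReg (typeLaw P z.1)) z.2 ^ 2
          * (f z - 1) ^ 2 else 0 := fun z => by
      split_ifs
      · rw [abs_of_nonneg (sq_nonneg _), abs_of_nonneg (sq_nonneg _)]
      · simp
    simp_rw [h2]
    rw [h1]
    have h3 : ∀ o : TypeObs (M k) (d k),
        ((κ * f ⟨k, o⟩ - κ) * clusterResidual (w k) (clusterReg (typeLaw P k)) o) ^ 2
        = κ ^ 2 * (clusterResidual (w k) (clusterReg (typeLaw P k)) o ^ 2 * (f ⟨k, o⟩ - 1) ^ 2) :=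
      fun o => by ring
    simp_rw [h3]
    rw [integral_const_mul]
    calc _ ≤ C ^ 2 * ∫ o, clusterResidual (w k) (clusterReg (typeLaw P k)) o ^ 2
            * (f ⟨k, o⟩ - 1) ^ 2 ∂(typeLaw P k) :=
          mul_le_mul_of_nonneg_right hκC (integral_nonneg fun o => by positivity)
      _ = _ := by field_simp
  have hYb0 : 0 ≤ ∫ o, ((κ * f ⟨k, o⟩ - κ)
      * clusterResidual (w k) (clusterReg (typeLaw P k)) o) ^ 2 ∂(typeLaw P k) :=
    integral_nonneg fun o => sq_nonneg _
  calc _ = (((C ^ 2) ^ 2 / c ^ 2) ^ 2 * Fintype.card (Treat (M k)) * (C ^ 2) ^ 2)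
        * ((∫ o, (κ * f ⟨k, o⟩ - κ) ^ 2 ∂(typeLaw P k)) * ∫ o, ((κ * f ⟨k, o⟩ - κ)
          * clusterResidual (w k) (clusterReg (typeLaw P k)) o) ^ 2 ∂(typeLaw P k)) := by ring
    _ ≤ (((C ^ 2) ^ 2 / c ^ 2) ^ 2 * Fintype.card (Treat (M k)) * (C ^ 2) ^ 2)
        * ((C ^ 2 / typeProb P k * ∫ z, (f z - 1) ^ 2 ∂(P : Measure (Obs M d)))
          * (C ^ 2 / typeProb P k * ∫ z, |if z.1 = k then
          clusterResidual (w z.1) (clusterReg (typeLaw P z.1)) z.2 ^ 2 else 0|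
            * |(f z - 1) ^ 2| ∂(P : Measure (Obs M d)))) := by
        refine mul_le_mul_of_nonneg_left ?_ (by positivity)
        exact mul_le_mul hX hYb hYb0 (by positivity)
    _ = _ := by ring

variable {path : ℝ → ProbabilityMeasure (Obs M d)} {s : Obs M d → ℝ}

include hw hp hY hc he hreg hφ in
/-- The remainder of the one-step expansion is of second order. -/
theorem IsRegularSubmodel.hasDerivAt_remainder (h : IsRegularSubmodel P path s) (k : Fin K) :
    HasDerivAt (fun t => ∫ o, clusterAipw (w k) (clusterPropensity (typeLaw P k))
        (clusterReg (typeLaw P k)) o ∂(typeLaw (path t) k) - thetaFunctional w (path t) k) 0 0 := by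
  obtain ⟨f, C, hfm, hC, hbd, hpath, hlim⟩ := h.exists_density
  have hbd' := hbd.filter_mono (nhdsWithin_le_nhds (s := ({0}ᶜ : Set ℝ)))
  have hpath' := hpath.filter_mono (nhdsWithin_le_nhds (s := ({0}ᶜ : Set ℝ)))
  have := isProbabilityMeasure_typeLaw P (hp k)
  set U : Obs M d → ℝ := fun z => if z.1 = k then
    clusterResidual (w z.1) (clusterReg (typeLaw P z.1)) z.2 ^ 2 else 0 with hU
  set X : ℝ → ℝ := fun t => ∫ z, (f t z - 1) ^ 2 ∂(P : Measure (Obs M d)) with hX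
  have hs := h.score_memLp
  -- Eventually the difference quotient of the likelihood ratio is within `L²` distance one of the
  -- score, whence `∫ (f - 1)² ≤ t² B`.
  set B : ℝ := 2 * 1 + 2 * ∫ z, s z ^ 2 ∂(P : Measure (Obs M d)) with hB
  have hB0 : 0 ≤ B := by
    have : 0 ≤ ∫ z, s z ^ 2 ∂(P : Measure (Obs M d)) := integral_nonneg fun z => sq_nonneg _
    positivity
  have hfL : ∀ᶠ t in 𝓝[≠] (0 : ℝ), MemLp (fun z => f t z - 1) 2 (P : Measure (Obs M d)) := by
    filter_upwards [hbd'] with t ht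
    exact (memLp_of_le_bdd (hfm t) (C := C) (fun z => by
      rw [abs_of_nonneg ((inv_pos.2 hC).le.trans (ht z).1)]; exact (ht z).2) 2).sub
        (memLp_const 1)
  have hXB : ∀ᶠ t in 𝓝[≠] (0 : ℝ), X t ≤ t ^ 2 * B := by
    filter_upwards [hfL, hlim.eventually_lt_const one_pos, self_mem_nhdsWithin] with t ht h1 ht0
    have ht0' : t ≠ 0 := ht0
    have hD : MemLp (fun z => (f t z - 1) / t - s z) 2 (P : Measure (Obs M d)) := by
      refine MemLp.sub ?_ hs
      simpa [div_eq_inv_mul] using ht.const_mul t⁻¹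
    calc X t = t ^ 2 * ∫ z, (((f t z - 1) / t - s z) + s z) ^ 2 ∂(P : Measure (Obs M d)) := by
          rw [← integral_const_mul]
          refine integral_congr_ae (ae_of_all _ fun z => ?_)
          change (f t z - 1) ^ 2 = t ^ 2 * (((f t z - 1) / t - s z) + s z) ^ 2
          rw [sub_add_cancel]
          field_simp
      _ ≤ t ^ 2 * B := by
          refine mul_le_mul_of_nonneg_left ((integral_sq_add_le hD hs).trans ?_) (sq_nonneg _)
          rw [hB]
          gcongr
  have hX0 : Tendsto (fun t => ∫ z, |(f t z - 1) ^ 2| ∂(P : Measure (Obs M d))) (𝓝[≠] 0)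
      (𝓝 0) := by
    have h1 : Tendsto (fun t : ℝ => t ^ 2 * B) (𝓝[≠] 0) (𝓝 (0 ^ 2 * B)) :=
      ((tendsto_id.mono_left nhdsWithin_le_nhds).pow 2).mul_const B
    rw [zero_pow two_ne_zero, zero_mul] at h1
    refine tendsto_of_tendsto_of_tendsto_of_le_of_le' tendsto_const_nhds h1
      (Eventually.of_forall fun t => integral_nonneg fun z => abs_nonneg _) ?_
    filter_upwards [hXB] with t ht
    simpa only [abs_sq] using ht
  have hUi : Integrable U (P : Measure (Obs M d)) := by
    have hu := fun j => memLp_clusterResidual (typeLaw P j) (hw j)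
      (condIntegrable_of_integrable _ (hY j)) hc (he j) (memLp_clusterAipw_typeLaw hp hφ j)
    have h1 : Integrable (fun z : Obs M d =>
        clusterResidual (w z.1) (clusterReg (typeLaw P z.1)) z.2 ^ 2)
        ((P : Measure (Obs M d)).restrict {z | z.1 = k}) := by
      rw [restrict_type]
      refine Integrable.smul_measure ?_ ENNReal.ofReal_ne_top
      rw [(measurableEmbedding_mk k).integrable_map_iff]
      exact (hu k).integrable_sq
    refine ((integrable_indicator_iff (measurableSet_type k)).2 h1).congr (ae_of_all _ fun z => ?_)
    simp [hU, Set.indicator_apply]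
  have hY0 := tendsto_integral_mul_of_bdd (μ := (P : Measure (Obs M d))) (l := 𝓝[≠] (0 : ℝ))
    (F := U) (b := fun t z => (f t z - 1) ^ 2) (B := (C + 1) ^ 2) hUi (by
      filter_upwards [hbd'] with t ht
      refine ⟨(((hfm t).sub_const 1).pow_const 2).aestronglyMeasurable, fun z => ?_⟩
      rw [abs_pow]
      refine pow_le_pow_left₀ (abs_nonneg _) ((abs_sub _ _).trans ?_) 2
      rw [abs_of_nonneg ((inv_pos.2 hC).le.trans (ht z).1), abs_one]
      linarith [(ht z).2]) hX0
  rw [hasDerivAt_iff_tendsto_slope_zero]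
  set Kc := ((C ^ 2) ^ 2 / c ^ 2) ^ 2 * Fintype.card (Treat (M k)) * (C ^ 2) ^ 2
          * (C ^ 2 / typeProb P k) ^ 2 with hKc
  have hKc0 : 0 ≤ Kc := by positivity
  -- The factor `t² B` cancels the `t²` of the squared difference quotient. The integral weighted by
  -- the squared residual supplies convergence to zero, without a rate.
  refine squeeze_zero_norm' (a := fun t => √(Kc * B * ∫ z, |U z| * |(f t z - 1) ^ 2|
    ∂(P : Measure (Obs M d)))) ?_ ?_
  · filter_upwards [hbd', hpath', hXB, self_mem_nhdsWithin] with t hb hP hXt ht0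
    have ht0' : t ≠ 0 := ht0
    have h1 := sq_integral_clusterAipw_typeLaw_sub_le hw hp hY hc he hreg hφ (hfm t) hC hb hP k
    rw [zero_add, h.base, integral_clusterAipw_eq_thetaFunctional hw hp hY hreg hφ k, sub_self,
      sub_zero, smul_eq_mul, Real.norm_eq_abs]
    refine Real.abs_le_sqrt ?_
    rw [mul_pow, inv_pow, inv_mul_le_iff₀ (by positivity)]
    refine h1.trans ?_
    have hI0 : 0 ≤ ∫ z, |U z| * |(f t z - 1) ^ 2| ∂(P : Measure (Obs M d)) :=
      integral_nonneg fun z => by positivity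
    calc Kc * X t * ∫ z, |U z| * |(f t z - 1) ^ 2| ∂(P : Measure (Obs M d))
        ≤ Kc * (t ^ 2 * B) * ∫ z, |U z| * |(f t z - 1) ^ 2| ∂(P : Measure (Obs M d)) :=
          mul_le_mul_of_nonneg_right (mul_le_mul_of_nonneg_left hXt hKc0) hI0
      _ = _ := by ring
  · have h3 := (hY0.const_mul (Kc * B)).sqrt
    simpa using h3

theorem IsRegularSubmodel.hasDerivAt_typeProb (h : IsRegularSubmodel P path s) (k : Fin K) :
    HasDerivAt (fun t => typeProb (path t) k)
      (∫ z, (if z.1 = k then 1 else 0) * s z ∂(P : Measure (Obs M d))) 0 := by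
  have h1 := h.hasDerivAt_integral (g := fun z => if z.1 = k then 1 else 0)
    (memLp_of_le_bdd (measurable_typeIndicator k) (C := 1) (fun z => by split_ifs <;> simp) 2)
  simpa only [integral_typeIndicator] using h1

include hw hp hY hc he hreg hφ in
-- Up to the remainder, which has derivative zero, `θ_k(P_t)` is the mean of a fixed function
-- divided by the type probability. The quotient rule then yields the centred score over `p_k`.
theorem IsRegularSubmodel.hasDerivAt_thetaFunctional (h : IsRegularSubmodel P path s)
    (k : Fin K) :
    HasDerivAt (fun t => thetaFunctional w (path t) k)
      (∫ z, plugInfluence P w (thetaFunctional w P) (propensity P) (outcomeReg P) k z * s z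
        ∂(P : Measure (Obs M d))) 0 := by
  set S : Obs M d → ℝ := fun z => if z.1 = k then aipw w (propensity P) (outcomeReg P) z else 0
    with hS
  have hm := h.hasDerivAt_integral (hφ k)
  have hq := h.hasDerivAt_typeProb k
  have hR := h.hasDerivAt_remainder hw hp hY hc he hreg hφ k
  have hq0 : typeProb (path 0) k ≠ 0 := by rw [h.base]; exact (hp k).ne'
  have hm0 : ∀ t, ∫ z, S z ∂(path t : Measure (Obs M d)) = typeProb (path t) k *
      ∫ o, clusterAipw (w k) (clusterPropensity (typeLaw P k)) (clusterReg (typeLaw P k)) o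
        ∂(typeLaw (path t) k) := fun t =>
    integral_type (path t) (aipw w (propensity P) (outcomeReg P)) k
  have hev : (fun t => thetaFunctional w (path t) k) =ᶠ[𝓝 0] fun t =>
      (∫ z, S z ∂(path t : Measure (Obs M d))) / typeProb (path t) k
        - (∫ o, clusterAipw (w k) (clusterPropensity (typeLaw P k)) (clusterReg (typeLaw P k)) o
          ∂(typeLaw (path t) k) - thetaFunctional w (path t) k) := by
    filter_upwards [hq.continuousAt.eventually_ne hq0] with t ht
    rw [hm0, mul_div_cancel_left₀ _ ht]
    ring
  refine (((hm.div hq hq0).sub hR).congr_of_eventuallyEq hev).congr_deriv ?_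
  have hpk := (hp k).ne'
  have hs := h.score_memLp
  have h1 : ∀ z, plugInfluence P w (thetaFunctional w P) (propensity P) (outcomeReg P) k z * s z
      = (typeProb P k)⁻¹ * (S z * s z)
        - (typeProb P k)⁻¹ * thetaFunctional w P k * ((if z.1 = k then 1 else 0) * s z) := by
    intro z
    simp only [plugInfluence, hS]
    split_ifs <;> ring
  have hi1 : Integrable (fun z => S z * s z) (P : Measure (Obs M d)) := (hφ k).integrable_mul hs
  have hi2 : Integrable (fun z : Obs M d => (if z.1 = k then 1 else 0) * s z)
      (P : Measure (Obs M d)) := (memLp_of_le_bdd (measurable_typeIndicator k) (C := 1)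
        (fun z => by split_ifs <;> simp) 2).integrable_mul hs
  have h2 : ∫ z, plugInfluence P w (thetaFunctional w P) (propensity P) (outcomeReg P) k z * s z
        ∂(P : Measure (Obs M d))
      = (typeProb P k)⁻¹ * ∫ z, S z * s z ∂(P : Measure (Obs M d))
        - (typeProb P k)⁻¹ * thetaFunctional w P k
          * ∫ z, (if z.1 = k then 1 else 0) * s z ∂(P : Measure (Obs M d)) := by
    simp_rw [h1]
    rw [integral_sub (hi1.const_mul _) (hi2.const_mul _), integral_const_mul, integral_const_mul]
  rw [h2, hm0, h.base, integral_clusterAipw_eq_thetaFunctional hw hp hY hreg hφ k]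
  field_simp
  ring

include hw hp hY hc he hreg hφ in
/-- The influence function represents the pathwise derivative of the functional `τ`. -/
theorem IsRegularSubmodel.hasDerivAt_tauFunctional (h : IsRegularSubmodel P path s)
    {v : Fin K → ℝ → ℝ} (hv : ∀ k, ContDiff ℝ 1 (v k)) :
    HasDerivAt (fun t => tauFunctional w v (path t))
      (∫ z, tauInfluence P v (thetaFunctional w P)
        (plugInfluence P w (thetaFunctional w P) (propensity P) (outcomeReg P)) z * s z
        ∂(P : Measure (Obs M d))) 0 := by
  have hs := h.score_memLp
  have hd : ∀ k, HasDerivAt (fun t => v k (typeProb (path t) k) * thetaFunctional w (path t) k)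
      ((deriv (v k) (typeProb P k) * ∫ z, (if z.1 = k then 1 else 0) * s z
        ∂(P : Measure (Obs M d))) * thetaFunctional w P k + v k (typeProb P k)
        * ∫ z, plugInfluence P w (thetaFunctional w P) (propensity P) (outcomeReg P) k z * s z
        ∂(P : Measure (Obs M d))) 0 := by
    intro k
    have h1 : HasDerivAt (v k) (deriv (v k) (typeProb (path 0) k)) (typeProb (path 0) k) :=
      ((hv k).differentiable one_ne_zero _).hasDerivAt
    have h2 := (HasDerivAt.comp (0 : ℝ) h1 (h.hasDerivAt_typeProb k)).mul
      (h.hasDerivAt_thetaFunctional hw hp hY hc he hreg hφ k)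
    simp only [Function.comp_apply, h.base] at h2
    exact h2
  refine (HasDerivAt.fun_sum fun k _ => hd k).congr_deriv ?_
  have hpl : ∀ k, MemLp (plugInfluence P w (thetaFunctional w P) (propensity P) (outcomeReg P) k) 2
      (P : Measure (Obs M d)) := by
    intro k
    have h1 := ((hφ k).sub ((memLp_of_le_bdd (measurable_typeIndicator k) (C := 1)
      (fun z => by split_ifs <;> simp) 2).const_mul (thetaFunctional w P k))).const_mul
        (typeProb P k)⁻¹
    refine (memLp_congr_ae (ae_of_all _ fun z => ?_)).1 h1
    simp only [Pi.sub_apply, plugInfluence]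
    split_ifs <;> ring
  have hi1 : ∀ k, Integrable (fun z => plugInfluence P w (thetaFunctional w P) (propensity P)
      (outcomeReg P) k z * s z) (P : Measure (Obs M d)) := fun k => (hpl k).integrable_mul hs
  have hi2 : ∀ k, Integrable (fun z => typeResidual P k z * s z) (P : Measure (Obs M d)) :=
    fun k => (typeResidual_memLp k).1.integrable_mul hs
  have hi3 : ∀ k, Integrable (fun z : Obs M d => (if z.1 = k then 1 else 0) * s z)
      (P : Measure (Obs M d)) := fun k => (memLp_of_le_bdd (measurable_typeIndicator k) (C := 1)
        (fun z => by split_ifs <;> simp) 2).integrable_mul hs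
  -- Scores have mean zero, so centring the type indicator does not change its inner product with
  -- them.
  have h1 : ∀ k, ∫ z, typeResidual P k z * s z ∂(P : Measure (Obs M d))
      = ∫ z, (if z.1 = k then 1 else 0) * s z ∂(P : Measure (Obs M d)) := by
    intro k
    have h2 : ∀ z, typeResidual P k z * s z
        = (if z.1 = k then 1 else 0) * s z - typeProb P k * s z := fun z => by
      rw [typeResidual]; ring
    simp_rw [h2]
    rw [integral_sub (hi3 k) ((hs.integrable (by norm_num)).const_mul _), integral_const_mul,
      h.integral_score, mul_zero, sub_zero]
  have h2 : ∀ z, tauInfluence P v (thetaFunctional w P)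
      (plugInfluence P w (thetaFunctional w P) (propensity P) (outcomeReg P)) z * s z
      = ∑ k, (v k (typeProb P k) * (plugInfluence P w (thetaFunctional w P) (propensity P)
          (outcomeReg P) k z * s z) + deriv (v k) (typeProb P k) * thetaFunctional w P k
          * (typeResidual P k z * s z)) := by
    intro z
    rw [tauInfluence, Finset.sum_mul]
    refine Finset.sum_congr rfl fun k _ => ?_
    rw [typeResidual]
    ring
  simp_rw [h2]
  rw [integral_finsetSum]
  swap
  · exact fun k _ => ((hi1 k).const_mul _).add ((hi2 k).const_mul _)
  refine Finset.sum_congr rfl fun k _ => ?_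
  rw [integral_add, integral_const_mul, integral_const_mul, h1]
  · ring
  · exact (hi1 k).const_mul _
  · exact (hi2 k).const_mul _

end PathwiseDerivative

/-! ### Submodels with prescribed score, the tangent space and the efficiency bound. -/

section TangentSpace

variable {E : Type} [MeasurableSpace E] {P : ProbabilityMeasure E}

/-- With `r = √(1 + t x)` the difference is exactly `-t x² / (2 (r + 1)²)`. This makes the linear
path with density `1 + t h` differentiable in quadratic mean. -/
theorem abs_sqrt_one_add_sub_le {t x : ℝ} (ht : t ≠ 0) (hx : -1 ≤ t * x) :
    |(√(1 + t * x) - 1) / t - x / 2| ≤ |t| * x ^ 2 := by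
  set r := √(1 + t * x) with hr
  have hr0 : 0 ≤ r := Real.sqrt_nonneg _
  have hr2 : r ^ 2 = 1 + t * x := Real.sq_sqrt (by linarith)
  have hx' : x = (r ^ 2 - 1) / t := by rw [hr2]; field_simp; ring
  have h1 : (r - 1) / t - x / 2 = -(t * x ^ 2) / (2 * (r + 1) ^ 2) := by
    rw [hx']
    field_simp
    ring
  rw [h1, abs_div, abs_neg, abs_mul, abs_of_nonneg (sq_nonneg x), abs_of_pos (by positivity :
    0 < 2 * (r + 1) ^ 2)]
  refine div_le_self (by positivity) ?_
  nlinarith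

/-- Every bounded function with mean zero is the score of a regular submodel. -/
theorem exists_isRegularSubmodel {h : E → ℝ} (hm : Measurable h) {B : ℝ} (hB : ∀ z, |h z| ≤ B)
    (h0 : ∫ z, h z ∂(P : Measure E) = 0) : ∃ path, IsRegularSubmodel P path h := by
  -- The density `1 + t h` is used only while `|t h| ≤ 1/2` is guaranteed, and replaced by `1`
  -- otherwise. The path is thus defined for every `t`, with density between `1/2` and `2`.
  set f : ℝ → E → ℝ := fun t z => if |t| * (|B| + 1) ≤ 1 / 2 then 1 + t * h z else 1 with hf
  have hfm : ∀ t, Measurable (f t) := by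
    intro t
    by_cases ht : |t| * (|B| + 1) ≤ 1 / 2
    · simp only [hf, ht, if_true]
      exact (hm.const_mul t).const_add 1
    · simp only [hf, ht, if_false]
      exact measurable_const
  have hth : ∀ t z, |t| * (|B| + 1) ≤ 1 / 2 → |t * h z| ≤ 1 / 2 := by
    intro t z ht
    rw [abs_mul]
    refine le_trans (mul_le_mul_of_nonneg_left ?_ (abs_nonneg _)) ht
    exact (hB z).trans (by linarith [le_abs_self B])
  have hfb : ∀ t z, (2 : ℝ)⁻¹ ≤ f t z ∧ f t z ≤ 2 := by
    intro t z
    by_cases ht : |t| * (|B| + 1) ≤ 1 / 2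
    · simp only [hf, ht, if_true]
      have := abs_le.1 (hth t z ht)
      constructor <;> linarith [this.1, this.2]
    · simp only [hf, ht, if_false]
      norm_num
  have hf0 : ∀ t z, 0 ≤ f t z := fun t z => le_trans (by norm_num) (hfb t z).1
  have hhi : Integrable h (P : Measure E) :=
    Integrable.of_bound hm.aestronglyMeasurable B (ae_of_all _ hB)
  have hf1 : ∀ t, ∫ z, f t z ∂(P : Measure E) = 1 := by
    intro t
    by_cases ht : |t| * (|B| + 1) ≤ 1 / 2
    · simp only [hf, ht, if_true]
      rw [integral_add (integrable_const _) (hhi.const_mul t), integral_const_mul, h0]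
      simp
    · simp only [hf, ht, if_false]
      simp
  have hprob : ∀ t, IsProbabilityMeasure
      ((P : Measure E).withDensity fun z => ENNReal.ofReal (f t z)) := by
    intro t
    refine ⟨?_⟩
    rw [withDensity_apply _ MeasurableSet.univ, Measure.restrict_univ,
      ← ofReal_integral_eq_lintegral_ofReal
        (Integrable.of_bound (C := 2) (hfm t).aestronglyMeasurable (ae_of_all _ fun z => by
          rw [Real.norm_of_nonneg (hf0 t z)]; exact (hfb t z).2)) (ae_of_all _ (hf0 t)),
      hf1, ENNReal.ofReal_one]
  refine ⟨fun t => ⟨(P : Measure E).withDensity fun z => ENNReal.ofReal (f t z), hprob t⟩, ?_,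
    memLp_of_le_bdd hm hB 2, f, hfm, ⟨2, two_pos, Eventually.of_forall hfb⟩,
    Eventually.of_forall fun t => rfl, ?_⟩
  · refine Subtype.ext ?_
    change (P : Measure E).withDensity (fun z => ENNReal.ofReal (f 0 z)) = P
    have h1 : (fun z => ENNReal.ofReal (f 0 z)) = 1 := by
      ext z
      simp [hf]
    rw [h1, withDensity_one]
  · have hlim : Tendsto (fun t : ℝ => ENNReal.ofReal (|t| * B ^ 2)) (𝓝[≠] 0) (𝓝 0) := by
      have h1 : Tendsto (fun t : ℝ => |t| * B ^ 2) (𝓝 0) (𝓝 (|0| * B ^ 2)) :=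
        (continuous_abs.mul continuous_const).tendsto 0
      have h2 := ENNReal.tendsto_ofReal
        (h1.mono_left (nhdsWithin_le_nhds (s := ({0}ᶜ : Set ℝ))))
      simpa using h2
    have hev : ∀ᶠ t in 𝓝[≠] (0 : ℝ), |t| * (|B| + 1) ≤ 1 / 2 := by
      have h1 : Tendsto (fun t : ℝ => |t| * (|B| + 1)) (𝓝 0) (𝓝 (|0| * (|B| + 1))) :=
        (continuous_abs.mul continuous_const).tendsto 0
      rw [abs_zero, zero_mul] at h1
      filter_upwards [(h1.mono_left nhdsWithin_le_nhds).eventually_lt_const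
        (by norm_num : (0 : ℝ) < 1 / 2)] with t ht using ht.le
    refine tendsto_of_tendsto_of_tendsto_of_le_of_le' tendsto_const_nhds hlim
      (Eventually.of_forall fun t => zero_le) ?_
    filter_upwards [hev, self_mem_nhdsWithin] with t ht ht0
    refine (eLpNorm_le_of_ae_bound (C := |t| * B ^ 2) (ae_of_all _ fun z => ?_)).trans (by simp)
    simp only [hf, ht, if_true]
    refine (abs_sqrt_one_add_sub_le ht0 ?_).trans ?_
    · linarith [(abs_le.1 (hth t z ht)).1]
    · exact mul_le_mul_of_nonneg_left (sq_le_sq.2 ((hB z).trans (le_abs_self B))) (abs_nonneg _)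

/-- Bounded functions with mean zero are dense in the square-integrable ones. -/
theorem exists_bounded_centred_approx {φ : E → ℝ} (hφ : MemLp φ 2 (P : Measure E))
    (h0 : ∫ z, φ z ∂(P : Measure E) = 0) {ε : ℝ} (hε : 0 < ε) :
    ∃ (h : E → ℝ) (B : ℝ), Measurable h ∧ (∀ z, |h z| ≤ B) ∧ ∫ z, h z ∂(P : Measure E) = 0 ∧
      ∫ z, (φ z - h z) ^ 2 ∂(P : Measure E) < ε := by
  obtain ⟨G, hG, hGL⟩ := hφ.exists_simpleFunc_eLpNorm_sub_lt ENNReal.ofNat_ne_top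
    (ε := ENNReal.ofReal (√ε)) (by simpa using hε)
  obtain ⟨C, hC⟩ := G.exists_forall_norm_le
  have hGi : Integrable G (P : Measure E) := hGL.integrable (by norm_num)
  have hD : MemLp (fun z => φ z - G z) 2 (P : Measure E) := hφ.sub hGL
  set q := ∫ z, G z ∂(P : Measure E) with hq
  have hDq : ∫ z, (φ z - G z) ∂(P : Measure E) = -q := by
    rw [integral_sub (hφ.integrable (by norm_num)) hGi, h0, zero_sub]
  have hlt : ∫ z, (φ z - G z) ^ 2 ∂(P : Measure E) < ε := by
    rw [integral_sq_eq_toReal_eLpNorm hD]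
    have h1 : (eLpNorm (φ - ⇑G) 2 (P : Measure E)).toReal < √ε := by
      refine ((ENNReal.toReal_lt_toReal (ne_top_of_lt hG) ENNReal.ofReal_ne_top).2 hG).trans_eq ?_
      exact ENNReal.toReal_ofReal (Real.sqrt_nonneg _)
    calc _ < √ε ^ 2 := pow_lt_pow_left₀ h1 ENNReal.toReal_nonneg two_ne_zero
      _ = ε := Real.sq_sqrt hε.le
  -- Centring the simple function cannot worsen the approximation: as `φ` is centred, the squared
  -- distance drops by `q²`.
  refine ⟨fun z => G z - q, C + |q|, G.measurable.sub_const q, fun z => ?_, ?_, ?_⟩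
  · exact (abs_sub _ _).trans (add_le_add_left (hC z) _)
  · rw [integral_sub hGi (integrable_const _)]
    simp [hq]
  · refine lt_of_le_of_lt ?_ hlt
    have h1 : ∀ z, (φ z - (G z - q)) ^ 2 = (φ z - G z) ^ 2 + 2 * q * (φ z - G z) + q ^ 2 :=
      fun z => by ring
    simp_rw [h1]
    rw [integral_add, integral_add, integral_const_mul, hDq]
    · simp only [integral_const, probReal_univ, smul_eq_mul, one_mul]
      nlinarith [sq_nonneg q]
    · exact hD.integrable_sq
    · exact (hD.integrable (by norm_num)).const_mul _
    · exact hD.integrable_sq.add ((hD.integrable (by norm_num)).const_mul _)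
    · exact integrable_const _

/-- The tangent space of the nonparametric model is maximal. -/
theorem toLp_mem_tangentSpace {φ : E → ℝ} (hφ : MemLp φ 2 (P : Measure E))
    (h0 : ∫ z, φ z ∂(P : Measure E) = 0) : hφ.toLp φ ∈ tangentSpace P := by
  rw [tangentSpace, ← SetLike.mem_coe, Submodule.topologicalClosure_coe, Metric.mem_closure_iff]
  intro ε hε
  obtain ⟨h, B, hm, hB, hh0, hlt⟩ := exists_bounded_centred_approx hφ h0 (pow_pos hε 2)
  have hL : MemLp h 2 (P : Measure E) := memLp_of_le_bdd hm hB 2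
  obtain ⟨path, hpath⟩ := exists_isRegularSubmodel (P := P) hm hB hh0
  refine ⟨hL.toLp h, Submodule.subset_span ⟨path, h, hpath, hL.coeFn_toLp⟩, ?_⟩
  have hD : MemLp (fun z => φ z - h z) 2 (P : Measure E) := hφ.sub hL
  rw [integral_sq_eq_toReal_eLpNorm hD] at hlt
  rw [dist_eq_norm, ← MemLp.toLp_sub, Lp.norm_toLp]
  exact lt_of_pow_lt_pow_left₀ 2 hε.le hlt

/-- The variance of the efficient influence function is the efficiency bound. -/
theorem isEfficiencyBound_of_hasDerivAt {τ : ProbabilityMeasure E → ℝ} {φ : E → ℝ}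
    (hφ : MemLp φ 2 (P : Measure E)) (h0 : ∫ z, φ z ∂(P : Measure E) = 0)
    (hder : ∀ path s, IsRegularSubmodel P path s →
      HasDerivAt (fun t => τ (path t)) (∫ z, φ z * s z ∂(P : Measure E)) 0)
    (hne : ∃ (h : E → ℝ) (B : ℝ), Measurable h ∧ (∀ z, |h z| ≤ B) ∧
      ∫ z, h z ∂(P : Measure E) = 0 ∧ 0 < ∫ z, h z ^ 2 ∂(P : Measure E)) :
    IsEfficiencyBound P τ Var[φ; (P : Measure E)] := by
  have hvar : Var[φ; (P : Measure E)] = ∫ z, φ z ^ 2 ∂(P : Measure E) :=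
    variance_of_integral_eq_zero hφ.1.aemeasurable h0
  rw [hvar]
  constructor
  · rintro b ⟨path, s, D, hs, hpos, hD, rfl⟩
    rw [hD.unique (hder path s hs), div_le_iff₀ hpos]
    exact sq_integral_mul_le hφ hs.score_memLp
  · intro b hb
    have key : ∀ (h : E → ℝ) (B : ℝ), Measurable h → (∀ z, |h z| ≤ B) →
        ∫ z, h z ∂(P : Measure E) = 0 → 0 < ∫ z, h z ^ 2 ∂(P : Measure E) →
        (∫ z, φ z * h z ∂(P : Measure E)) ^ 2 ≤ b * ∫ z, h z ^ 2 ∂(P : Measure E) := by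
      intro h B hm hB hh0 hpos
      obtain ⟨path, hpath⟩ := exists_isRegularSubmodel (P := P) hm hB hh0
      exact (div_le_iff₀ hpos).1 (hb ⟨path, h, _, hpath, hpos, hder path h hpath, rfl⟩)
    -- A nonzero score is needed here: otherwise the set of Cramér-Rao bounds could be empty, with
    -- every real number as an upper bound.
    have hb0 : 0 ≤ b := by
      obtain ⟨h, B, hm, hB, hh0, hpos⟩ := hne
      exact nonneg_of_mul_nonneg_left ((sq_nonneg _).trans (key h B hm hB hh0 hpos)) hpos
    refine le_of_forall_pos_le_add fun ε hε => ?_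
    obtain ⟨h, B, hm, hB, hh0, hlt⟩ := exists_bounded_centred_approx hφ h0 hε
    have hL : MemLp h 2 (P : Measure E) := memLp_of_le_bdd hm hB 2
    have hle : (∫ z, φ z * h z ∂(P : Measure E)) ^ 2 ≤ b * ∫ z, h z ^ 2 ∂(P : Measure E) := by
      -- An approximant with zero norm is no admissible score, but then Cauchy-Schwarz makes the
      -- inequality trivial.
      rcases (integral_nonneg (μ := (P : Measure E)) (f := fun z => h z ^ 2)
        fun z => sq_nonneg _).eq_or_lt with hz | hz
      · have h1 := sq_integral_mul_le hφ hL
        change 0 = ∫ z, h z ^ 2 ∂(P : Measure E) at hz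
        rw [← hz, mul_zero] at h1 ⊢
        exact h1
      · exact key h B hm hB hh0 hz
    have hexp : ∫ z, (φ z - h z) ^ 2 ∂(P : Measure E) = ∫ z, φ z ^ 2 ∂(P : Measure E)
        - 2 * ∫ z, φ z * h z ∂(P : Measure E) + ∫ z, h z ^ 2 ∂(P : Measure E) := by
      have h1 : ∀ z, (φ z - h z) ^ 2 = φ z ^ 2 - 2 * (φ z * h z) + h z ^ 2 := fun z => by ring
      have h2 : Integrable (fun z => φ z * h z) (P : Measure E) := hφ.integrable_mul hL
      simp_rw [h1]
      rw [integral_add, integral_sub, integral_const_mul]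
      · exact hφ.integrable_sq
      · exact h2.const_mul 2
      · exact hφ.integrable_sq.sub (h2.const_mul 2)
      · exact hL.integrable_sq
    rw [hexp] at hlt
    set x := ∫ z, φ z * h z ∂(P : Measure E)
    set y := ∫ z, h z ^ 2 ∂(P : Measure E) with hy
    have hy0 : 0 ≤ y := integral_nonneg fun z => sq_nonneg _
    -- From `x² ≤ b y` by the arithmetic-geometric mean inequality. Then `∫ φ² = ∫ (φ - h)² + 2 x -
    -- y` is less than `ε + b`, with no division by `y`.
    have h2x : 2 * x ≤ y + b := by
      refine abs_le_of_sq_le_sq' ?_ (by positivity) |>.2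
      nlinarith [sq_nonneg (y - b)]
    linarith

/-- The centred indicator of `S` serves; its variance is `q (1 - q)`. -/
theorem exists_bounded_centred_pos {S : Set E} (hS : MeasurableSet S)
    (h1 : 0 < (P : Measure E).real S) (h2 : (P : Measure E).real S < 1) :
    ∃ (h : E → ℝ) (B : ℝ), Measurable h ∧ (∀ z, |h z| ≤ B) ∧
      ∫ z, h z ∂(P : Measure E) = 0 ∧ 0 < ∫ z, h z ^ 2 ∂(P : Measure E) := by
  set q := (P : Measure E).real S with hq
  have hm : Measurable (S.indicator (1 : E → ℝ)) := measurable_one.indicator hS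
  have hb : ∀ z, |S.indicator (1 : E → ℝ) z| ≤ 1 := fun z => by
    by_cases hz : z ∈ S <;> simp [hz]
  have hi : Integrable (S.indicator (1 : E → ℝ)) (P : Measure E) :=
    Integrable.of_bound hm.aestronglyMeasurable 1 (ae_of_all _ hb)
  refine ⟨fun z => S.indicator 1 z - q, 1 + |q|, hm.sub_const q, fun z => ?_, ?_, ?_⟩
  · exact (abs_sub _ _).trans (add_le_add_left (hb z) _)
  · rw [integral_sub hi (integrable_const _), integral_indicator_one hS]
    simp [hq]
  · have h3 : ∀ z, (S.indicator (1 : E → ℝ) z - q) ^ 2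
        = (1 - 2 * q) * S.indicator 1 z + q ^ 2 := fun z => by
      by_cases hz : z ∈ S
      · simp [hz]; ring
      · simp [hz]
    simp_rw [h3]
    rw [integral_add (hi.const_mul _) (integrable_const _), integral_const_mul,
      integral_indicator_one hS]
    simp only [integral_const, probReal_univ, smul_eq_mul, one_mul]
    rw [← hq]
    nlinarith

end TangentSpace

/-! ### Overlap excludes a degenerate observed law. -/

section Overlap

variable {K : ℕ} {M d : Fin K → ℕ} {P : ProbabilityMeasure (Obs M d)}

/-- Under overlap the observed-data law is not degenerate. -/
theorem exists_bounded_centred_pos_of_overlap (hp : ∀ k, 0 < typeProb P k) {c : ℝ} (hc : 0 < c)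
    (he : ∀ k a, ∀ᵐ x ∂(covLaw P k), c < propensity P k a x ∧ propensity P k a x < 1 - c) :
    ∃ (h : Obs M d → ℝ) (B : ℝ), Measurable h ∧ (∀ z, |h z| ≤ B) ∧
      ∫ z, h z ∂(P : Measure (Obs M d)) = 0 ∧ 0 < ∫ z, h z ^ 2 ∂(P : Measure (Obs M d)) := by
  -- Any point of the sample space supplies a type `k` and a treatment `a`. The event `L = k, A = a`
  -- has probability `p_k` times the mean propensity, which overlap keeps strictly between zero and
  -- one.
  obtain ⟨⟨k, o⟩⟩ := (P : Measure (Obs M d)).nonempty_of_neZero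
  set a := o.2.1
  have := isProbabilityMeasure_typeLaw P (hp k)
  set S : Set (Obs M d) := Sigma.mk k '' {o : TypeObs (M k) (d k) | o.2.1 = a} with hS
  have hSm : MeasurableSet S :=
    (measurableEmbedding_mk k).measurableSet_image.2 (measurableSet_treat a)
  have hcov : IsProbabilityMeasure (covLaw P k) := by
    unfold covLaw
    exact Measure.isProbabilityMeasure_map measurable_cov.aemeasurable
  have h1 : (typeLaw P k).real {o : TypeObs (M k) (d k) | o.2.1 = a}
      = ∫ x, propensity P k a x ∂(covLaw P k) := by
    have h2 := integral_treat (typeLaw P k) (h := fun _ => 1) measurable_const a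
    simp only [mul_one] at h2
    rw [← integral_indicator_one (measurableSet_treat a)]
    refine Eq.trans (integral_congr_ae (ae_of_all _ fun o => ?_)) h2
    simp [Set.indicator_apply]
  have hei : Integrable (propensity P k a) (covLaw P k) :=
    Integrable.of_bound (measurable_clusterPropensity (typeLaw P k) a).aestronglyMeasurable 1
      (ae_of_all _ fun x => abs_le.2
        ⟨by exact neg_one_lt_zero.le.trans (clusterPropensity_nonneg (typeLaw P k) a x),
          clusterPropensity_le_one (typeLaw P k) a x⟩)
  have hconst : ∀ b : ℝ, ∫ _x, b ∂(covLaw P k) = b := fun b => by simp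
  have hlo : c ≤ ∫ x, propensity P k a x ∂(covLaw P k) := by
    rw [← hconst c]
    exact integral_mono_ae (integrable_const _) hei ((he k a).mono fun x hx => hx.1.le)
  have hhi : ∫ x, propensity P k a x ∂(covLaw P k) ≤ 1 - c := by
    rw [← hconst (1 - c)]
    exact integral_mono_ae hei (integrable_const _) ((he k a).mono fun x hx => hx.2.le)
  have hPS : (P : Measure (Obs M d)).real S
      = typeProb P k * ∫ x, propensity P k a x ∂(covLaw P k) := by
    have h2 : (typeLaw P k).real {o : TypeObs (M k) (d k) | o.2.1 = a}
        = (typeProb P k)⁻¹ * (P : Measure (Obs M d)).real S := by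
      rw [Measure.real, typeLaw_apply, ENNReal.toReal_mul, ENNReal.toReal_inv,
        ENNReal.toReal_ofReal (hp k).le]
      rfl
    rw [← h1, h2, mul_inv_cancel_left₀ (hp k).ne']
  have hpk : typeProb P k ≤ 1 := measureReal_le_one
  refine exists_bounded_centred_pos hSm ?_ ?_
  · rw [hPS]
    exact mul_pos (hp k) (hc.trans_le hlo)
  · rw [hPS]
    calc _ ≤ 1 * (1 - c) := mul_le_mul hpk hhi (hc.le.trans hlo) zero_le_one
      _ < 1 := by linarith

end Overlap

/-! ### Efficient influence function and efficiency bound of `τ`. -/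

section Efficiency

variable {K de dg : ℕ} {M d : Fin K → ℕ} {w : Weights M d}
  {m : WorkingModel M d de dg} {psiBeta : Obs M d → Beta de dg → Beta de dg}
  {Ω₀ : Set (Param K de dg)} {θ₀ : Fin K → ℝ} {β₀ : Beta de dg}

theorem aemeasurable_tauHat {Ω : Type*} [MeasurableSpace Ω] {μ : Measure Ω}
    {P : ProbabilityMeasure (Obs M d)} {Z : ℕ → Ω → Obs M d}
    (hZ : ∀ i, HasLaw (Z i) (P : Measure (Obs M d)) μ) {v : Fin K → ℝ → ℝ}
    (hv : ∀ k, Measurable (v k)) {θHat : ℕ → Ω → Fin K → ℝ} (hθHat : ∀ N, Measurable (θHat N))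
    (N : ℕ) : AEMeasurable (tauHat v Z θHat N) μ := by
  have hpHat : ∀ k, AEMeasurable (fun ω => pHat Z N ω k) μ := by
    intro k
    simp only [pHat, ← Finset.sum_boole]
    exact (Finset.aemeasurable_fun_sum _ fun i _ =>
      (measurable_typeIndicator k).comp_aemeasurable (hZ i).aemeasurable).div_const _
  unfold tauHat
  exact Finset.aemeasurable_fun_sum _ fun k _ => ((hv k).comp_aemeasurable (hpHat k)).mul
    ((measurable_pi_apply k).comp (hθHat N)).aemeasurable

/-- The score at the true nuisance functions is square-integrable if both models are correct. -/
theorem memLp_aipw_of_isTrue {P : ProbabilityMeasure (Obs M d)}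
    (hR : RegularityConditions P w m psiBeta Ω₀ (θ₀, β₀))
    (hE : IsTrueE P m β₀.1) (hG : IsTrueG P m β₀.2) (k : Fin K) :
    MemLp (fun z => if z.1 = k then aipw w (propensity P) (outcomeReg P) z else 0) 2
      (P : Measure (Obs M d)) := by
  have h1 := (memLp_clm_psi hR
    ((ContinuousLinearMap.proj (R := ℝ) (φ := fun _ : Fin K => ℝ) k).comp
      (ContinuousLinearMap.fst ℝ (Fin K → ℝ) (Beta de dg)))).1
  have h2 := h1.add ((memLp_of_le_bdd (μ := (P : Measure (Obs M d))) (measurable_typeIndicator k)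
    (C := 1) (fun z => by split_ifs <;> simp) 2).const_mul (θ₀ k))
  refine (memLp_congr_ae ?_).1 h2
  filter_upwards [aipw_congr (w := w) hE.2 hG.2] with z hz
  rw [hz]
  change psiTheta w m z (θ₀, β₀) k + θ₀ k * (if z.1 = k then 1 else 0) = _
  simp only [psiTheta]
  split_ifs <;> ring

/-- The efficient influence function and the efficiency bound of `τ`. -/
theorem isEfficientInfluenceFunction_tauInfluence {Q : ProbabilityMeasure (Full M d)}
    (hQ : CausalAssumptions Q) (hp : ∀ k, 0 < typeProb (observedLaw Q) k)
    (hw : ∀ k a, Measurable (w k a))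
    (hθ : ∀ k a, Integrable (fun u : TypeFull (M k) (d k) => w k a u.2.2 ⬝ᵥ u.1 a) (typeLaw Q k))
    {v : Fin K → ℝ → ℝ} (hv : ∀ k, ContDiff ℝ 1 (v k))
    (hφ : ∀ k, MemLp (fun z => if z.1 = k then
      aipw w (propensity (observedLaw Q)) (outcomeReg (observedLaw Q)) z else 0) 2
      (observedLaw Q : Measure (Obs M d)))
    {φ : Obs M d → ℝ}
    (hφ_eq : φ = tauInfluence (observedLaw Q) v (causalTheta w Q)
      (plugInfluence (observedLaw Q) w (causalTheta w Q) (propensity (observedLaw Q))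
        (outcomeReg (observedLaw Q))))
    (hφL : MemLp φ 2 (observedLaw Q : Measure (Obs M d)))
    (hφ0 : ∫ z, φ z ∂(observedLaw Q : Measure (Obs M d)) = 0) :
    IsEfficientInfluenceFunction (observedLaw Q) (tauFunctional w v) φ ∧
      IsEfficiencyBound (observedLaw Q) (tauFunctional w v)
        Var[φ; (observedLaw Q : Measure (Obs M d))] := by
  obtain ⟨c, hc, hover⟩ := hQ.overlap
  have hθeq : thetaFunctional w (observedLaw Q) = causalTheta w Q :=
    funext fun k => (integrable_reg_and_sum_integral hw hθ hQ k).2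
  have hder : ∀ path s, IsRegularSubmodel (observedLaw Q) path s →
      HasDerivAt (fun t => tauFunctional w v (path t))
        (∫ z, φ z * s z ∂(observedLaw Q : Measure (Obs M d))) 0 := by
    intro path s h
    have h1 := h.hasDerivAt_tauFunctional hw hp (integrable_outcome hQ) hc
      (fun k a => (hover k a).mono fun x hx => hx.1.le)
      (fun k => (integrable_reg_and_sum_integral hw hθ hQ k).1) hφ hv
    rwa [hθeq, ← hφ_eq] at h1
  exact ⟨⟨hder, hφL, toLp_mem_tangentSpace hφL hφ0⟩,
    isEfficiencyBound_of_hasDerivAt hφL hφ0 hder (exists_bounded_centred_pos_of_overlap hp hc hover)⟩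

end Efficiency
end
end PartialInterference

/-! ### Assembly of the theorem. -/

theorem theorem2 {K de dg : ℕ} {M d : Fin K → ℕ}
    -- population law of the full data; observed data law `observedLaw Q`
    (Q : ProbabilityMeasure (Full M d)) (hQ : CausalAssumptions Q)
    (hp : ∀ k, 0 < typeProb (observedLaw Q) k)
    -- estimand
    (w : Weights M d) (hw : ∀ k a, Measurable (w k a))
    (hθ : ∀ k a, Integrable (fun u : TypeFull (M k) (d k) => w k a u.2.2 ⬝ᵥ u.1 a) (typeLaw Q k))
    (v : Fin K → ℝ → ℝ) (hv : ∀ k, ContDiff ℝ 1 (v k))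
    -- working models and estimating equations
    (m : WorkingModel M d de dg)
    (psiBeta : Obs M d → Beta de dg → Beta de dg)
    (hpsiBeta : ∀ β, Measurable (fun z => psiBeta z β))
    (Ω₀ : Set (Param K de dg)) (θ₀ : Fin K → ℝ) (β₀ : Beta de dg)
    (hR : RegularityConditions (observedLaw Q) w m psiBeta Ω₀ (θ₀, β₀))
    -- independent clusters
    {Ω : Type*} [MeasurableSpace Ω] (μ : Measure Ω) [IsProbabilityMeasure μ]
    (Z : ℕ → Ω → Obs M d)
    (hZ : ∀ i, HasLaw (Z i) (observedLaw Q : Measure (Obs M d)) μ) (hind : iIndepFun Z μ)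
    -- estimators: solutions of the estimating equations, with probability tending to one
    (θHat : ℕ → Ω → Fin K → ℝ) (βHat : ℕ → Ω → Beta de dg)
    (hθHat : ∀ N, Measurable (θHat N)) (hβHat : ∀ N, Measurable (βHat N))
    (hsol : Tendsto (fun N => μ {ω | ∑ i ∈ Finset.range N,
      psi w m psiBeta (Z i ω) (θHat N ω, βHat N ω) ≠ 0}) atTop (𝓝 0))
    -- probability limit of `βHat`, which is the true parameter of each correct working model
    (hlim : TendstoInMeasure μ βHat atTop (fun _ => β₀))
    (hlimE : InModelE (observedLaw Q) m → IsTrueE (observedLaw Q) m β₀.1)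
    (hlimG : InModelG (observedLaw Q) m → IsTrueG (observedLaw Q) m β₀.2) :
    -- the observed-data functional identifies the causal estimand
    tauFunctional w v (observedLaw Q) = causalTau w v Q ∧
    -- double robustness: asymptotic linearity if at least one working model is correct
    (InModelE (observedLaw Q) m ∨ InModelG (observedLaw Q) m →
      IsAsymptoticallyLinear μ (observedLaw Q) Z (tauHat v Z θHat) (causalTau w v Q)
        (tauInfluence (observedLaw Q) v (causalTheta w Q)
          (parInfluence (observedLaw Q) w m psiBeta (causalTheta w Q) β₀))) ∧
    -- local efficiency if both are correct
    (InModelE (observedLaw Q) m ∧ InModelG (observedLaw Q) m →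
      ∃ φ : Obs M d → ℝ,
        φ = tauInfluence (observedLaw Q) v (causalTheta w Q)
          (plugInfluence (observedLaw Q) w (causalTheta w Q)
            (propensity (observedLaw Q)) (outcomeReg (observedLaw Q))) ∧
        tauInfluence (observedLaw Q) v (causalTheta w Q)
          (parInfluence (observedLaw Q) w m psiBeta (causalTheta w Q) β₀)
            =ᵐ[(observedLaw Q : Measure (Obs M d))] φ ∧
        tauInfluence (observedLaw Q) v (causalTheta w Q)
          (plugInfluence (observedLaw Q) w (causalTheta w Q) (m.e β₀.1) (m.g β₀.2))
            =ᵐ[(observedLaw Q : Measure (Obs M d))] φ ∧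
        IsEfficientInfluenceFunction (observedLaw Q) (tauFunctional w v) φ ∧
        IsEfficiencyBound (observedLaw Q) (tauFunctional w v)
          Var[φ; (observedLaw Q : Measure (Obs M d))] ∧
        IsAsymptoticallyLinear μ (observedLaw Q) Z (tauHat v Z θHat) (causalTau w v Q) φ ∧
        TendstoInDistribution (fun (N : ℕ) ω => √(N : ℝ) * (tauHat v Z θHat N ω - causalTau w v Q))
          atTop id (fun _ => μ)
          (gaussianReal 0 (Var[φ; (observedLaw Q : Measure (Obs M d))]).toNNReal)) := by
  have hτ : ∑ k, v k (typeProb (observedLaw Q) k) * causalTheta w Q k = causalTau w v Q :=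
    Finset.sum_congr rfl fun k _ => by rw [typeProb_observedLaw]
  have hAL : IsTrueE (observedLaw Q) m β₀.1 ∨ IsTrueG (observedLaw Q) m β₀.2 →
      IsAsymptoticallyLinear μ (observedLaw Q) Z (tauHat v Z θHat) (causalTau w v Q)
        (tauInfluence (observedLaw Q) v (causalTheta w Q)
          (parInfluence (observedLaw Q) w m psiBeta (causalTheta w Q) β₀)) := by
    intro h
    -- One correct model identifies the population root with the causal parameter; the expansion
    -- around the root then needs no further model assumption.
    have hroot := root_eq_causalTheta hQ hp hw hθ hR h
    subst hroot
    rw [← hτ]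
    exact isAsymptoticallyLinear_tauHat hR hZ hind hp hv hsol hlim
  refine ⟨tauFunctional_eq_causalTau hw hθ hQ v, fun h => hAL (h.imp hlimE hlimG), ?_⟩
  rintro ⟨hmE, hmG⟩
  have hE := hlimE hmE
  have hG := hlimG hmG
  have hroot := root_eq_causalTheta hQ hp hw hθ hR (Or.inl hE)
  subst hroot
  have hplug := tauInfluence_congr v (causalTheta w Q)
    (plugInfluence_congr (w := w) (causalTheta w Q) hE.2 hG.2)
  have hpar := parInfluence_eq_plugInfluence hQ hp hw hθ hR hE hG
  have hae : tauInfluence (observedLaw Q) v (causalTheta w Q)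
      (parInfluence (observedLaw Q) w m psiBeta (causalTheta w Q) β₀)
        =ᵐ[(observedLaw Q : Measure (Obs M d))] tauInfluence (observedLaw Q) v (causalTheta w Q)
          (plugInfluence (observedLaw Q) w (causalTheta w Q) (propensity (observedLaw Q))
            (outcomeReg (observedLaw Q))) := by
    rw [hpar]
    exact hplug.symm
  have hlin := (hAL (Or.inl hE)).congr hae hZ
  obtain ⟨hEIF, hbound⟩ := isEfficientInfluenceFunction_tauInfluence hQ hp hw hθ hv
    (memLp_aipw_of_isTrue hR hE hG) rfl hlin.1 hlin.2.1
  refine ⟨_, rfl, hae, hplug.symm, hEIF, hbound, hlin, ?_⟩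
  exact hlin.tendstoInDistribution hZ hind
    (aemeasurable_tauHat hZ (fun k => (hv k).continuous.measurable) hθHat)
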